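/- Let $\mathbb K$ be a field of characteristic zero, let $X=(x_1,\dots,x_n)$ and $Y=(y_1,\dots,y_m)$, and for an ideal $I\subseteq\mathbb K[X,Y]$ let $$A(I)=\{(f,g)\in\mathbb K[X]\times\mathbb K[Y] : f-g\in I\},$$ a unital $\mathbb K$-subalgebra of $\mathbb K[X]\times\mathbb K[Y]$ (with componentwise operations). Let $I\subseteq\mathbb K[X,Y]$ be such that $I=I_0\cap I_1$ for some ideal $I_0$ of dimension zero (the unit ideal being allowed as well) and some principal ideal $I_1$ whose generator is not in $\mathbb K[X]\cup\mathbb K[Y]$. (1) The $\mathbb K$-algebra $A(I)$ is finitely generated. (2) Assume moreover that $\mathbb K$ is a computable field (its elements are effectively coded, each by exactly one code, and the field operations are computable on the codes), and that there is an algorithm which decides, for a given univariate polynomial over $\mathbb K$, whether all its roots in the algebraic closure of $\mathbb K$ are roots of unity. Then there is an algorithm for computing a finite set of generators of $A(I)$: there is one algorithm (a partial recursive function) which, given $n$, $m$ and any finite list of polynomials generating an ideal $I\subseteq\mathbb K[X,Y]$ of the above form, terminates and returns a finite list of pairs $(f,g)\in\mathbb K[X]\times\mathbb K[Y]$ that generates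 $A(I)$ as a $\mathbb K$-algebra. -/

import Mathlib

noncomputable section

namespace SeparatedVariables

/-- `𝕂[X, Y]`, with `X = x₁, …, xₙ` and `Y = y₁, …, yₘ`. -/
abbrev PolyXY (K : Type*) [Field K] (n m : ℕ) : Type _ := MvPolynomial (Fin n ⊕ Fin m) K

/-- The inclusion `𝕂[X] ⊆ 𝕂[X, Y]`. -/
def inclX (K : Type*) [Field K] (n m : ℕ) : MvPolynomial (Fin n) K →ₐ[K] PolyXY K n m :=
  MvPolynomial.rename Sum.inl

/-- The inclusion `𝕂[Y] ⊆ 𝕂[X, Y]`. -/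
def inclY (K : Type*) [Field K] (n m : ℕ) : MvPolynomial (Fin m) K →ₐ[K] PolyXY K n m :=
  MvPolynomial.rename Sum.inr

/-- The algebra of separated elements of an ideal `I` of `𝕂[X, Y]`: all pairs
`(f, g) ∈ 𝕂[X] × 𝕂[Y]` with `f - g ∈ I`, with componentwise operations. -/
def separatedAlgebra {K : Type*} [Field K] {n m : ℕ} (I : Ideal (PolyXY K n m)) :
    Subalgebra K (MvPolynomial (Fin n) K × MvPolynomial (Fin m) K) where
  carrier := {fg | inclX K n m fg.1 - inclY K n m fg.2 ∈ I}
  mul_mem' := by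
    rintro ⟨f, g⟩ ⟨f', g'⟩ h h'
    simp only [Set.mem_ofPred_eq, Prod.mk_mul_mk, map_mul] at h h' ⊢
    have e : inclX K n m f * inclX K n m f' - inclY K n m g * inclY K n m g'
        = inclX K n m f' * (inclX K n m f - inclY K n m g)
          + inclY K n m g * (inclX K n m f' - inclY K n m g') := by ring
    rw [e]
    exact I.add_mem (I.mul_mem_left _ h) (I.mul_mem_left _ h')
  add_mem' := by
    rintro ⟨f, g⟩ ⟨f', g'⟩ h h'
    simp only [Set.mem_ofPred_eq, Prod.mk_add_mk, map_add] at h h' ⊢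
    rw [add_sub_add_comm]
    exact I.add_mem h h'
  algebraMap_mem' := by
    intro r
    simp only [Set.mem_ofPred_eq, Prod.algebraMap_apply, AlgHom.commutes, sub_self, I.zero_mem]

/-- `I` is the intersection of an ideal `I₀` of dimension zero and a principal ideal whose
generator `p` lies neither in `𝕂[X]` nor in `𝕂[Y]`. (The unit ideal is allowed as `I₀`.) -/
def IsZeroDimInfPrincipal {K : Type*} [Field K] {n m : ℕ} (I : Ideal (PolyXY K n m)) : Prop :=
  ∃ (I₀ : Ideal (PolyXY K n m)) (p : PolyXY K n m),
    ringKrullDim (PolyXY K n m ⧸ I₀) ≤ 0 ∧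
    p ∉ (inclX K n m).range ∧ p ∉ (inclY K n m).range ∧
    I = I₀ ⊓ Ideal.span {p}

/-- A computable field: its elements are coded by natural numbers (the `Primcodable` structure;
codes are unique, so that equality is decidable), and the field operations are computable. -/
structure IsComputableField (K : Type*) [Field K] [Primcodable K] : Prop where
  add : Computable₂ (fun a b : K => a + b)
  mul : Computable₂ (fun a b : K => a * b)
  neg : Computable (fun a : K => -a)
  inv : Computable (fun a : K => a⁻¹)

/-- The univariate polynomial with the given coefficients, constant term first. -/
def univariate {K : Type*} [Field K] : List K → Polynomial K
  | [] => 0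
  | a :: l => Polynomial.C a + Polynomial.X * univariate l

/-- Roots of unity can be recognized: there is an algorithm which decides, for a given univariate
polynomial over `K`, whether all its roots in the algebraic closure are roots of unity.
(For polynomials `z - a` this tests whether `a ∈ K` is a root of unity.) -/
def DecidesRootsOfUnity (K : Type*) [Field K] [Primcodable K] : Prop :=
  ComputablePred fun q : List K =>
    ∀ z : AlgebraicClosure K, Polynomial.aeval z (univariate q) = 0 → ∃ N : ℕ, 0 < N ∧ z ^ N = 1

/-- Data for a polynomial in one group of variables: a list of terms, each given by its
coefficient and its list of exponents. -/
abbrev PolyCode (K : Type*) : Type _ := List (K × List ℕ)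

/-- The polynomial in `k` variables given by such data (missing exponents count as `0`,
superfluous ones are ignored). -/
def PolyCode.toPoly {K : Type*} [Field K] (k : ℕ) (c : PolyCode K) : MvPolynomial (Fin k) K :=
  (c.map fun t => MvPolynomial.monomial
    (Finsupp.equivFunOnFinite.symm fun i : Fin k => t.2.getD i 0) t.1).sum

/-- Data for a polynomial in two groups of variables: a list of terms, each given by its
coefficient, its list of exponents of `X`, and its list of exponents of `Y`. -/
abbrev PolyXYCode (K : Type*) : Type _ := List (K × List ℕ × List ℕ)

/-- The element of `𝕂[X, Y]` given by such data. -/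
def PolyXYCode.toPoly {K : Type*} [Field K] (n m : ℕ) (c : PolyXYCode K) : PolyXY K n m :=
  (c.map fun t => MvPolynomial.monomial
    (Finsupp.equivFunOnFinite.symm
      (Sum.elim (fun i : Fin n => t.2.1.getD i 0) (fun j : Fin m => t.2.2.getD j 0))) t.1).sum

/-- The ideal of `𝕂[X, Y]` generated by a finite list of polynomials. -/
def idealOf {K : Type*} [Field K] (n m : ℕ) (L : List (PolyXYCode K)) : Ideal (PolyXY K n m) :=
  Ideal.span {q | ∃ c ∈ L, q = PolyXYCode.toPoly n m c}

/-- The subalgebra of `𝕂[X] × 𝕂[Y]` generated by a finite list of pairs of polynomials. -/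
def algebraOf {K : Type*} [Field K] (n m : ℕ) (L : List (PolyCode K × PolyCode K)) :
    Subalgebra K (MvPolynomial (Fin n) K × MvPolynomial (Fin m) K) :=
  Algebra.adjoin K {fg | ∃ c ∈ L, fg = (PolyCode.toPoly n c.1, PolyCode.toPoly m c.2)}

end SeparatedVariables

end

open SeparatedVariables

namespace SeparatedVariables

open Polynomial

/-! ### Approximate roots -/

/-! The principal case carries everything: for `p` outside `𝕂[X] ∪ 𝕂[Y]` the algebra `A((p))` is
generated by a single pair `t` (`separatedAlgebra_span_eq_adjoin`). Since `I ⊆ (p)`, the algebra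
`A(I)` lies in `𝕂[t]`, hence is the image of a subalgebra of the univariate polynomial ring, and
those are finitely generated (`fg_of_subalgebra_polynomial`).

For the principal case, let `(f, g)` be a nonconstant pair. Give the variables `X` the weight `deg
g` and the variables `Y` the weight `deg f`. The top form `P` of `p` divides the difference of the
top forms of `f` and `g`, so it has pure terms in `X` and in `Y`, visible along directions `v` and
`w` (`HasShape`). Then all pairs have balanced degrees, and pairs of equal degree are proportional
up to lower degree (`HasShape.regular`, `HasShape.exists_sub_totalDegree_lt`). On the plane `s v + t
w`, every pair of degrees `N`, `M` shows that `P` divides some `s ^ N - γ t ^ M`, and the exponents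
occurring in such relations are closed under subtraction. The heart is the converse: each such
exponent is the degree of a pair (`HasShape.exists_of_planeHom_dvd`). A suitable power of a given
pair has the degree of an `N`-th power; approximate `N`-th roots of its two components, taken after
a translation that makes them monic, again form a separated multiple of `p`, by a divisibility
criterion for leading forms (`dvd_of_dvd_mul_sub`). So all degrees are multiples of the least one,
and a pair of least degree generates.

The algorithm searches for an output together with a certificate of its correctness. It is enough
that the certificates are semidecidable, sound (`Cert.algebraOf_eq`) and always available
(`exists_cert`). A certificate contains `p` with `I ⊆ (p)`. If `A((p))` is not just the constants,
there is `(F, G) ∈ A(I)` with `F` nonconstant and `p F ∈ I`; multiplication by it maps `A((p))` into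
`A(I)`, so `A(I)` is generated in degrees at most twice those of `F` and `G`
(`separatedAlgebra_le_of_totalDegree_le`). Completeness of the output up to this bound is a
statement about non-membership in `I`, and it is certified by a finite-dimensional representation of
the polynomial ring (`Cover`, `exists_cover`); these suffice because affine algebras are residually
finite-dimensional.

If `A((p))` consists of constants, this needs its own certificate (`TrivCert`). For suitable weights
the top form has no pure terms, which settles the matter, or it has both kinds. In the latter case a
nonconstant pair would force the univariate restriction `U` of `P` to divide some `1 - γ z ^ M`.
This is refuted by a multiple factor of `U` or by two roots whose quotient is not a root of unity,
which is where the decision procedure enters. Otherwise `U` divides a binomial with a known exponent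
`E`; then a nonconstant pair would exist in a degree computed from `E`, and a finite check excludes
it. -/

/-- Starting from `X ^ d`, the coefficients of the root are corrected one at a time from the top:
adding a term of degree `j` changes the `q`-th power in degree `d * (q - 1) + j` by `q` times its
coefficient, and `q` is invertible. -/
theorem exists_monic_pow_approx {A : Type*} [CommRing A] [Nontrivial A] {q d : ℕ}
    (hq : IsUnit (q : A)) (hq0 : 0 < q) {f : A[X]} (hf : f.Monic)
    (hdeg : f.natDegree = d * q) :
    ∃ u : A[X], u.Monic ∧ u.natDegree = d ∧ (f - u ^ q).degree < ((d * (q - 1) : ℕ) : WithBot ℕ) := by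
  suffices H : ∀ k, k ≤ d → ∃ u : A[X], u.Monic ∧ u.natDegree = d ∧
      (f - u ^ q).degree < ((d * (q - 1) + (d - k) : ℕ) : WithBot ℕ) by
    obtain ⟨u, h1, h2, h3⟩ := H d le_rfl
    exact ⟨u, h1, h2, by simpa using h3⟩
  have hdq : d * (q - 1) + d = d * q := by
    obtain ⟨q, rfl⟩ := Nat.exists_eq_succ_of_ne_zero hq0.ne'
    simp [Nat.mul_succ]
  intro k
  induction k with
  | zero =>
    intro _
    refine ⟨X ^ d, monic_X_pow d, natDegree_X_pow d, ?_⟩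
    rw [Nat.sub_zero, hdq, ← pow_mul]
    have h := degree_sub_lt_left (p := f) (q := X ^ (d * q)) ?_ hf.ne_zero ?_
    · rwa [degree_eq_natDegree hf.ne_zero, hdeg] at h
    · rw [degree_X_pow, degree_eq_natDegree hf.ne_zero, hdeg]
    · rw [hf.leadingCoeff, (monic_X_pow _).leadingCoeff]
  | succ k ih =>
    intro hk
    obtain ⟨u, hu, hud, hlt⟩ := ih (by omega)
    set j := d - (k + 1) with hj
    have hjd : j < d := by omega
    rw [show d - k = j + 1 by omega] at hlt
    obtain ⟨e, he⟩ := hq.exists_right_inv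
    -- `e` inverts `q`, so this term removes the leading error coefficient.
    set h : A[X] := C (e * (f - u ^ q).coeff (d * (q - 1) + j)) * X ^ j with hh
    have hdegh : h.degree < u.degree := by
      rw [degree_eq_natDegree hu.ne_zero, hud]
      exact (degree_C_mul_X_pow_le _ _).trans_lt (by exact_mod_cast hjd)
    have hu' : (u + h).Monic := hu.add_of_left hdegh
    have hud' : (u + h).natDegree = d := by
      rw [natDegree_add_eq_left_of_degree_lt hdegh, hud]
    refine ⟨u + h, hu', hud', ?_⟩
    -- `(u + h) ^ q - u ^ q = T * h`, where `T` is a sum of `q` monic polynomials of degree `d * (q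
    -- - 1)` and so has top coefficient `q`.
    set T : A[X] := ∑ i ∈ Finset.range q, (u + h) ^ i * u ^ (q - 1 - i) with hS
    have key : (u + h) ^ q = u ^ q + T * h := by
      have := (Commute.all (u + h) u).geom_sum₂_mul q
      rw [add_sub_cancel_left] at this
      rw [hS, this]; ring
    have hterm : ∀ i ∈ Finset.range q, ((u + h) ^ i * u ^ (q - 1 - i)).Monic ∧
        ((u + h) ^ i * u ^ (q - 1 - i)).natDegree = d * (q - 1) := by
      intro i hi
      rw [Finset.mem_range] at hi
      refine ⟨(hu'.pow _).mul (hu.pow _), ?_⟩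
      rw [(hu'.pow _).natDegree_mul (hu.pow _), hu'.natDegree_pow, hu.natDegree_pow, hud, hud',
        ← add_mul, mul_comm, show i + (q - 1 - i) = q - 1 by omega]
    have hSdeg : T.natDegree ≤ d * (q - 1) :=
      natDegree_sum_le_of_forall_le _ _ fun i hi => (hterm i hi).2.le
    have hScoeff : T.coeff (d * (q - 1)) = q := by
      rw [hS, finsetSum_coeff, Finset.sum_congr rfl (g := fun _ => (1 : A))]
      · simp
      · intro i hi
        rw [← (hterm i hi).2]
        exact (hterm i hi).1.coeff_natDegree
    have hhdeg : h.natDegree ≤ j := natDegree_C_mul_X_pow_le _ _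
    have hle : (f - (u + h) ^ q).natDegree ≤ d * (q - 1) + j := by
      rw [key, ← sub_sub]
      refine (natDegree_sub_le _ _).trans (max_le ?_ ?_)
      · by_cases h0 : f - u ^ q = 0
        · simp [h0]
        · rw [degree_eq_natDegree h0] at hlt
          have : (f - u ^ q).natDegree < d * (q - 1) + (j + 1) := by exact_mod_cast hlt
          omega
      · exact natDegree_mul_le.trans (add_le_add hSdeg hhdeg)
    have hcoeff : (f - (u + h) ^ q).coeff (d * (q - 1) + j) = 0 := by
      rw [key, ← sub_sub, coeff_sub, coeff_mul_add_eq_of_natDegree_le hSdeg hhdeg, hScoeff, hh,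
        coeff_C_mul_X_pow, if_pos rfl, ← mul_assoc, he, one_mul, sub_self]
    refine lt_of_le_of_ne (natDegree_le_iff_degree_le.1 hle) fun heq => ?_
    have : (f - (u + h) ^ q).natDegree = d * (q - 1) + j := natDegree_eq_of_degree_eq_some heq
    rw [← this, coeff_natDegree, leadingCoeff_eq_zero] at hcoeff
    rw [hcoeff, degree_zero] at heq
    exact WithBot.bot_ne_coe heq

/-! ### A divisibility criterion in graded domains

A grading is given by a ring homomorphism `ω : R → R[τ]`. -/

/-- Since `r` has lower degree than `Q`, the leading form of `z * Q - r` is the product of those of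
`z` and `Q`. The leading form of `p` divides it, hence by `hP` that of `z`; subtracting a multiple
of `p` lowers the degree of `z`. The hypotheses `h1` and `h2` say that elements are recovered at `τ
= 1` and that leading forms are homogeneous. -/
theorem dvd_of_dvd_mul_sub {R : Type*} [CommRing R] [IsDomain R] (ω : R →+* R[X])
    (h1 : ∀ x, (ω x).eval 1 = x)
    (h2 : ∀ x, ω (ω x).leadingCoeff = C (ω x).leadingCoeff * X ^ (ω x).natDegree)
    {p Q r : R} (hr : (ω r).degree < (ω Q).degree)
    (hP : ∀ h, (ω p).leadingCoeff ∣ h * (ω Q).leadingCoeff → (ω p).leadingCoeff ∣ h)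
    {z : R} (hdvd : p ∣ z * Q - r) : p ∣ z := by
  have hinj : ∀ x, ω x = 0 → x = 0 := fun x hx => by rw [← h1 x, hx, eval_zero]
  suffices H : ∀ (n : ℕ) (z : R), (ω z).degree < n → p ∣ z * Q - r → p ∣ z by
    refine H ((ω z).natDegree + 1) z ?_ hdvd
    exact degree_le_natDegree.trans_lt (by exact_mod_cast Nat.lt_succ_self _)
  clear hdvd z
  intro n
  induction n with
  | zero =>
    intro z hz _
    have : ω z = 0 := by
      rw [← degree_eq_bot]
      exact Nat.WithBot.lt_zero_iff.1 hz
    rw [hinj z this]; exact dvd_zero _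
  | succ n ih =>
    intro z hz hd
    by_cases hz0 : ω z = 0
    · rw [hinj z hz0]; exact dvd_zero _
    obtain ⟨k, hk⟩ := hd
    have hlt : (ω r).degree < (ω (z * Q)).degree := by
      rw [map_mul, degree_mul]
      refine hr.trans_le ?_
      rw [degree_eq_natDegree hz0]
      exact le_add_of_nonneg_left (by exact_mod_cast Nat.zero_le _)
    have hlead : (ω z).leadingCoeff * (ω Q).leadingCoeff
        = (ω p).leadingCoeff * (ω k).leadingCoeff := by
      rw [← leadingCoeff_mul, ← leadingCoeff_mul, ← map_mul, ← map_mul, ← hk, map_sub,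
        leadingCoeff_sub_of_degree_lt hlt]
    obtain ⟨c, hc⟩ := hP _ ⟨_, hlead⟩
    have hp0 : ω p ≠ 0 := by
      intro h0
      rw [h0, leadingCoeff_zero, zero_mul, leadingCoeff_eq_zero] at hc
      exact hz0 hc
    have hP0 : (ω p).leadingCoeff ≠ 0 := leadingCoeff_ne_zero.2 hp0
    have hc0 : c ≠ 0 := by
      rintro rfl
      rw [mul_zero, leadingCoeff_eq_zero] at hc
      exact hz0 hc
    -- The cofactor `c` is itself homogeneous: cancel the leading form of `p` in the homogeneity
    -- relation for that of `z`. Therefore `p * c` has exactly the leading form of `z`.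
    have e : X ^ (ω p).natDegree * ω c = C c * X ^ (ω z).natDegree := by
      have := h2 z
      rw [hc, map_mul, h2 p, C_mul, mul_assoc, mul_assoc] at this
      exact mul_left_cancel₀ (C_ne_zero.2 hP0) this
    have hωc : ω c ≠ 0 := fun h => hc0 (hinj c h)
    have hlc : (ω c).leadingCoeff = c := by
      have := congrArg leadingCoeff e
      rwa [leadingCoeff_mul, (monic_X_pow _).leadingCoeff, one_mul, leadingCoeff_mul,
        (monic_X_pow _).leadingCoeff, mul_one, leadingCoeff_C] at this
    have hdc : (ω p).natDegree + (ω c).natDegree = (ω z).natDegree := by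
      have := congrArg natDegree e
      rwa [natDegree_mul (monic_X_pow _).ne_zero hωc, natDegree_X_pow,
        natDegree_C_mul_X_pow _ _ hc0] at this
    have hred : (ω (z - p * c)).degree < (ω z).degree := by
      rw [map_sub, map_mul]
      refine degree_sub_lt_left ?_ hz0 ?_
      · rw [degree_eq_natDegree hz0, degree_mul, degree_eq_natDegree hp0, degree_eq_natDegree hωc,
          ← hdc, Nat.cast_add]
      · rw [leadingCoeff_mul, hlc, hc]
    have hz' : p ∣ z - p * c := by
      refine ih _ ?_ ⟨k - c * Q, by rw [mul_sub, ← hk]; ring⟩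
      refine hred.trans_le ?_
      rw [degree_eq_natDegree hz0] at hz ⊢
      have : (ω z).natDegree < n + 1 := by exact_mod_cast hz
      exact_mod_cast Nat.lt_succ_iff.1 this
    have := dvd_add hz' (dvd_mul_right p c)
    rwa [sub_add_cancel] at this

/-! ### Weighted homogeneous polynomials under substitutions -/

section Substitution

variable {K σ B : Type*} [Field K] [CommRing B] [Algebra K B] {wt : σ → ℕ} {y : σ → B[X]}

theorem natDegree_aeval_monomial_le (hy : ∀ i, (y i).natDegree ≤ wt i) (e : σ →₀ ℕ) (c : K) :
    (MvPolynomial.aeval y (MvPolynomial.monomial e c)).natDegree ≤ Finsupp.weight wt e ∧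
    (MvPolynomial.aeval y (MvPolynomial.monomial e c)).coeff (Finsupp.weight wt e)
      = MvPolynomial.aeval (fun i => (y i).coeff (wt i)) (MvPolynomial.monomial e c) := by
  classical
  have hprod : ∀ s : Finset σ, (∏ i ∈ s, y i ^ e i).natDegree ≤ ∑ i ∈ s, e i * wt i ∧
      (∏ i ∈ s, y i ^ e i).coeff (∑ i ∈ s, e i * wt i) = ∏ i ∈ s, (y i).coeff (wt i) ^ e i := by
    intro s
    induction s using Finset.induction_on with
    | empty => simp
    | insert a s ha ih =>
      rw [Finset.prod_insert ha, Finset.sum_insert ha, Finset.prod_insert ha]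
      have h1 : (y a ^ e a).natDegree ≤ e a * wt a :=
        natDegree_pow_le.trans (Nat.mul_le_mul_left _ (hy a))
      refine ⟨natDegree_mul_le.trans (add_le_add h1 ih.1), ?_⟩
      rw [coeff_mul_add_eq_of_natDegree_le h1 ih.1, ih.2, coeff_pow_of_natDegree_le (hy a)]
  have hw : Finsupp.weight wt e = ∑ i ∈ e.support, e i * wt i := by
    rw [Finsupp.weight_apply, Finsupp.sum]; simp
  obtain ⟨hA, hB⟩ := hprod e.support
  rw [MvPolynomial.aeval_monomial, MvPolynomial.aeval_monomial, Finsupp.prod, Finsupp.prod, hw,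
    Polynomial.algebraMap_apply]
  refine ⟨(natDegree_C_mul_le _ _).trans hA, ?_⟩
  rw [coeff_C_mul, hB]

theorem IsWeightedHomogeneous.aeval_coeff (hy : ∀ i, (y i).natDegree ≤ wt i) {W : ℕ}
    {q : MvPolynomial σ K} (hq : q.IsWeightedHomogeneous wt W) :
    (MvPolynomial.aeval y q).natDegree ≤ W ∧ (MvPolynomial.aeval y q).coeff W
      = MvPolynomial.aeval (fun i => (y i).coeff (wt i)) q := by
  have hm : ∀ e ∈ q.support, Finsupp.weight wt e = W := fun e he =>
    hq (MvPolynomial.mem_support_iff.1 he)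
  constructor
  · conv_lhs => rw [q.as_sum, map_sum]
    exact natDegree_sum_le_of_forall_le _ _ fun e he =>
      (hm e he) ▸ (natDegree_aeval_monomial_le hy e _).1
  · conv_lhs => rw [q.as_sum, map_sum, finsetSum_coeff]
    conv_rhs => rw [q.as_sum, map_sum]
    exact Finset.sum_congr rfl fun e he => (hm e he) ▸ (natDegree_aeval_monomial_le hy e _).2

theorem degree_aeval_lt (hy : ∀ i, (y i).natDegree ≤ wt i) {W : ℕ} {q : MvPolynomial σ K}
    (hq : ∀ e ∈ q.support, Finsupp.weight wt e < W) :
    (MvPolynomial.aeval y q).degree < (W : WithBot ℕ) := by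
  rw [q.as_sum, map_sum]
  refine (degree_sum_le _ _).trans_lt ?_
  rw [Finset.sup_lt_iff (by exact WithBot.bot_lt_coe W)]
  intro e he
  exact (natDegree_le_iff_degree_le.1 (natDegree_aeval_monomial_le hy e _).1).trans_lt
    (by exact_mod_cast hq e he)

end Substitution


/-! ### Top forms with respect to weights. -/

/-- `Q` is the part of weight `W` of `q`, and all other terms of `q` have smaller weight. -/
structure IsTopForm {K σ : Type*} [Field K] (wt : σ → ℕ) (q Q : MvPolynomial σ K) (W : ℕ) :
    Prop where
  homogeneous : Q.IsWeightedHomogeneous wt W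
  lower : ∀ e ∈ (q - Q).support, Finsupp.weight wt e < W

/-- Terms of smaller weight cannot reach degree `W`, so the top coefficient of a substitution is the
substitution of top coefficients into the top form. Gradings and translations are all handled
through this statement. -/
theorem IsTopForm.aeval_coeff {K σ B : Type*} [Field K] [CommRing B] [Algebra K B] {wt : σ → ℕ}
    {y : σ → B[X]} (hy : ∀ i, (y i).natDegree ≤ wt i) {W : ℕ} {q Q : MvPolynomial σ K}
    (h : IsTopForm wt q Q W) :
    (MvPolynomial.aeval y q).natDegree ≤ W ∧ (MvPolynomial.aeval y q).coeff W
      = MvPolynomial.aeval (fun i => (y i).coeff (wt i)) Q := by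
  obtain ⟨h1, h2⟩ := IsWeightedHomogeneous.aeval_coeff hy h.homogeneous
  have h3 := degree_aeval_lt hy h.lower
  have e : MvPolynomial.aeval y q = MvPolynomial.aeval y (q - Q) + MvPolynomial.aeval y Q := by
    rw [← map_add, sub_add_cancel]
  rw [e]
  refine ⟨(natDegree_add_le _ _).trans (max_le ?_ h1), ?_⟩
  · exact natDegree_le_iff_degree_le.2 h3.le
  · rw [coeff_add, coeff_eq_zero_of_degree_lt h3, zero_add, h2]

theorem isTopForm_homogeneousComponent {K σ : Type*} [Field K] (f : MvPolynomial σ K) {a : ℕ}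
    (ha : 0 < a) : IsTopForm (fun _ => a) f (f.homogeneousComponent f.totalDegree)
      (a * f.totalDegree) := by
  have hw : ∀ e : σ →₀ ℕ, Finsupp.weight (fun _ => a) e = a * e.degree := by
    intro e
    rw [Finsupp.weight_apply, Finsupp.sum, Finsupp.degree_apply, Finset.mul_sum]
    exact Finset.sum_congr rfl fun i _ => by simp [mul_comm]
  constructor
  · intro e he
    rw [hw]
    have := MvPolynomial.homogeneousComponent_isHomogeneous f.totalDegree f he
    rw [Finsupp.degree_eq_weight_one]
    exact congrArg (a * ·) this
  · intro e he
    rw [hw]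
    refine Nat.mul_lt_mul_of_pos_left ?_ ha
    rw [MvPolynomial.mem_support_iff, MvPolynomial.coeff_sub,
      MvPolynomial.coeff_homogeneousComponent] at he
    have hne : e.degree ≠ f.totalDegree := by
      intro h
      rw [if_pos h, sub_self] at he
      exact he rfl
    rw [if_neg hne, sub_zero] at he
    have := MvPolynomial.le_totalDegree (MvPolynomial.mem_support_iff.2 he)
    exact lt_of_le_of_ne (by rwa [Finsupp.degree_apply]) hne

theorem homogeneousComponent_totalDegree_ne_zero {K σ : Type*} [Field K] {f : MvPolynomial σ K}
    (hf : f ≠ 0) : f.homogeneousComponent f.totalDegree ≠ 0 := by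
  obtain ⟨e, he, hd⟩ := Finset.exists_mem_eq_sup f.support
    (MvPolynomial.support_nonempty.2 hf) (fun e => e.sum fun _ k => k)
  intro h
  have := congrArg (MvPolynomial.coeff e) h
  rw [MvPolynomial.coeff_homogeneousComponent, if_pos, MvPolynomial.coeff_zero] at this
  · exact MvPolynomial.mem_support_iff.1 he this
  · rw [MvPolynomial.totalDegree, hd, Finsupp.degree_apply]; rfl

/-! ### Top forms of separated multiples. -/

section

variable {K : Type*} [Field K] {n m : ℕ}

/-- The weights `a` for the variables in `X` and `b` for the variables in `Y`. -/
noncomputable def weights (n m a b : ℕ) : Fin n ⊕ Fin m → ℕ := Sum.elim (fun _ => a) (fun _ => b)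

theorem mem_separatedAlgebra_span {p : PolyXY K n m}
    {fg : MvPolynomial (Fin n) K × MvPolynomial (Fin m) K} :
    fg ∈ separatedAlgebra (Ideal.span {p}) ↔ p ∣ inclX K n m fg.1 - inclY K n m fg.2 :=
  Ideal.mem_span_singleton

/-- The grading homomorphism of `𝕂[X, Y]` with the given weights. -/
noncomputable def gradeHom (K : Type*) [Field K] (n m a b : ℕ) : PolyXY K n m →ₐ[K] (PolyXY K n m)[X] :=
  MvPolynomial.aeval fun i => C (MvPolynomial.X i) * X ^ weights n m a b i

theorem gradeHom_topForm {a b W : ℕ} {p P : PolyXY K n m} (h : IsTopForm (weights n m a b) p P W) :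
    (gradeHom K n m a b p).natDegree ≤ W ∧ (gradeHom K n m a b p).coeff W = P := by
  obtain ⟨h1, h2⟩ := h.aeval_coeff (B := PolyXY K n m)
    (y := fun i => C (MvPolynomial.X i) * X ^ weights n m a b i)
    (fun i => natDegree_C_mul_X_pow_le _ _)
  refine ⟨h1, h2.trans ?_⟩
  simp only [coeff_C_mul_X_pow, if_true]
  exact MvPolynomial.aeval_X_left_apply P

theorem gradeHom_inclX {a : ℕ} (ha : 0 < a) (b : ℕ) (f : MvPolynomial (Fin n) K) :
    (gradeHom K n m a b (inclX K n m f)).natDegree ≤ a * f.totalDegree ∧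
    (gradeHom K n m a b (inclX K n m f)).coeff (a * f.totalDegree)
      = inclX K n m (f.homogeneousComponent f.totalDegree) := by
  obtain ⟨h1, h2⟩ := (isTopForm_homogeneousComponent f ha).aeval_coeff (B := PolyXY K n m)
    (y := fun i => C (MvPolynomial.X (Sum.inl i)) * X ^ a)
    (fun i => natDegree_C_mul_X_pow_le _ _)
  have e : gradeHom K n m a b (inclX K n m f)
      = MvPolynomial.aeval (fun i => C (MvPolynomial.X (Sum.inl i)) * X ^ a) f := by
    simp only [gradeHom, inclX, MvPolynomial.aeval_rename]; rfl
  rw [e]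
  refine ⟨h1, h2.trans ?_⟩
  simp only [coeff_C_mul_X_pow, if_true]
  exact (DFunLike.congr_fun (MvPolynomial.algHom_ext (f := MvPolynomial.aeval _) (g := inclX K n m)
    fun i => by simp [inclX]) _)

theorem gradeHom_inclY {b : ℕ} (hb : 0 < b) (a : ℕ) (g : MvPolynomial (Fin m) K) :
    (gradeHom K n m a b (inclY K n m g)).natDegree ≤ b * g.totalDegree ∧
    (gradeHom K n m a b (inclY K n m g)).coeff (b * g.totalDegree)
      = inclY K n m (g.homogeneousComponent g.totalDegree) := by
  obtain ⟨h1, h2⟩ := (isTopForm_homogeneousComponent g hb).aeval_coeff (B := PolyXY K n m)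
    (y := fun i => C (MvPolynomial.X (Sum.inr i)) * X ^ b)
    (fun i => natDegree_C_mul_X_pow_le _ _)
  have e : gradeHom K n m a b (inclY K n m g)
      = MvPolynomial.aeval (fun i => C (MvPolynomial.X (Sum.inr i)) * X ^ b) g := by
    simp only [gradeHom, inclY, MvPolynomial.aeval_rename]; rfl
  rw [e]
  refine ⟨h1, h2.trans ?_⟩
  simp only [coeff_C_mul_X_pow, if_true]
  exact (DFunLike.congr_fun (MvPolynomial.algHom_ext (f := MvPolynomial.aeval _) (g := inclY K n m)
    fun i => by simp [inclY]) _)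

/-- The top form of a polynomial divides the top form of each of its separated multiples. -/
theorem topForm_dvd {a b W : ℕ} (ha : 0 < a) (hb : 0 < b) {p P : PolyXY K n m}
    (hP : IsTopForm (weights n m a b) p P W) (hP0 : P ≠ 0)
    {f : MvPolynomial (Fin n) K} {g : MvPolynomial (Fin m) K}
    (hfg : p ∣ inclX K n m f - inclY K n m g) (h0 : 0 < f.totalDegree ∨ 0 < g.totalDegree) :
    (b * g.totalDegree < a * f.totalDegree ∧ f ≠ 0 ∧
      P ∣ inclX K n m (f.homogeneousComponent f.totalDegree)) ∨
    (a * f.totalDegree < b * g.totalDegree ∧ g ≠ 0 ∧ P ∣ inclY K n m (g.homogeneousComponent g.totalDegree)) ∨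
    (a * f.totalDegree = b * g.totalDegree ∧ 0 < f.totalDegree ∧ 0 < g.totalDegree ∧
      P ∣ inclX K n m (f.homogeneousComponent f.totalDegree)
        - inclY K n m (g.homogeneousComponent g.totalDegree)) := by
  obtain ⟨hp1, hp2⟩ := gradeHom_topForm hP
  obtain ⟨hf1, hf2⟩ := gradeHom_inclX (m := m) ha b f
  obtain ⟨hg1, hg2⟩ := gradeHom_inclY (n := n) hb a g
  set ω := gradeHom K n m a b with hω
  have hlp : (ω p).leadingCoeff = P := by
    rw [leadingCoeff, natDegree_eq_of_le_of_coeff_ne_zero hp1 (by rwa [hp2]), hp2]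
  -- Leading coefficients of the grading homomorphism are multiplicative, and that of `p` is `P`;
  -- the three cases below only differ in what the leading form of the difference is.
  have hdvd : ∀ (D : ℕ) (Q : PolyXY K n m),
      (ω (inclX K n m f - inclY K n m g)).natDegree ≤ D →
      (ω (inclX K n m f - inclY K n m g)).coeff D = Q → P ∣ Q := by
    intro D Q h1 h2
    by_cases hQ : Q = 0
    · rw [hQ]; exact dvd_zero _
    have : (ω (inclX K n m f - inclY K n m g)).leadingCoeff = Q := by
      rw [leadingCoeff, natDegree_eq_of_le_of_coeff_ne_zero h1 (by rwa [h2]), h2]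
    obtain ⟨k, hk⟩ := hfg
    rw [← this, ← hlp, hk, map_mul, leadingCoeff_mul]
    exact dvd_mul_right _ _
  rw [map_sub] at hdvd
  rcases lt_trichotomy (b * g.totalDegree) (a * f.totalDegree) with h | h | h
  · left
    refine ⟨h, ?_, hdvd (a * f.totalDegree) _ ?_ ?_⟩
    · rintro rfl; simp at h
    · exact (natDegree_sub_le _ _).trans (max_le hf1 (hg1.trans h.le))
    · rw [coeff_sub, hf2, coeff_eq_zero_of_natDegree_lt (hg1.trans_lt h), sub_zero]
  · right; right
    have h0' : 0 < f.totalDegree ∧ 0 < g.totalDegree := by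
      have hab : 0 < b * g.totalDegree := by
        rcases h0 with h0 | h0
        · rw [h]; exact Nat.mul_pos ha h0
        · exact Nat.mul_pos hb h0
      have hab' := hab
      rw [h] at hab'
      exact ⟨Nat.pos_of_mul_pos_left hab', Nat.pos_of_mul_pos_left hab⟩
    refine ⟨h.symm, h0'.1, h0'.2, hdvd (a * f.totalDegree) _ ?_ ?_⟩
    · exact (natDegree_sub_le _ _).trans (max_le hf1 (hg1.trans h.le))
    · rw [coeff_sub, hf2, ← h, hg2]
  · right; left
    refine ⟨h, ?_, (dvd_neg (α := PolyXY K n m)).1 (hdvd (b * g.totalDegree) _ ?_ ?_)⟩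
    · rintro rfl; simp at h
    · exact (natDegree_sub_le _ _).trans (max_le (hf1.trans h.le) hg1)
    · rw [coeff_sub, hg2, coeff_eq_zero_of_natDegree_lt (hf1.trans_lt h), zero_sub]

/-- Restriction of `X` to the line spanned by `v`. -/
noncomputable def lineX (v : Fin n → K) (m : ℕ) : PolyXY K n m →ₐ[K] (MvPolynomial (Fin m) K)[X] :=
  MvPolynomial.aeval (Sum.elim (fun i => C (MvPolynomial.C (v i)) * X)
    (fun j => C (MvPolynomial.X j)))

/-- Restriction of `Y` to the line spanned by `w`. -/
noncomputable def lineY (n : ℕ) (w : Fin m → K) : PolyXY K n m →ₐ[K] (MvPolynomial (Fin n) K)[X] :=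
  MvPolynomial.aeval (Sum.elim (fun i => C (MvPolynomial.X i))
    (fun j => C (MvPolynomial.C (w j)) * X))

theorem lineX_inclY (v : Fin n → K) (g : MvPolynomial (Fin m) K) :
    lineX v m (inclY K n m g) = C g := by
  have : ((lineX v m).comp (inclY K n m)) = Polynomial.CAlgHom := by
    ext j : 1
    simp [lineX, inclY]
  exact DFunLike.congr_fun this g

theorem lineY_inclX (w : Fin m → K) (f : MvPolynomial (Fin n) K) :
    lineY n w (inclX K n m f) = C f := by
  have : ((lineY n w).comp (inclX K n m)) = Polynomial.CAlgHom := by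
    ext j : 1
    simp [lineY, inclX]
  exact DFunLike.congr_fun this f

/-- A divisor of a nonzero polynomial in `Y` alone is constant along the line `X = τ v`; compare `τ
= 1` and `τ = 0` at `Y = 0`. For a top form with a pure term in `X` this is absurd. -/
theorem aeval_eq_of_lineX_dvd {v : Fin n → K} {Q : PolyXY K n m} {g : MvPolynomial (Fin m) K}
    (hg : g ≠ 0) (h : lineX v m Q ∣ C g) :
    MvPolynomial.aeval (Sum.elim v 0 : Fin n ⊕ Fin m → K) Q
      = MvPolynomial.aeval (0 : Fin n ⊕ Fin m → K) Q := by
  have h0 : (lineX v m Q).natDegree = 0 := by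
    have := natDegree_le_of_dvd h (C_ne_zero.2 hg)
    simpa using this
  have key : ∀ c : K, MvPolynomial.aeval (Sum.elim (fun i => v i * c) 0 : Fin n ⊕ Fin m → K) Q
      = (MvPolynomial.aeval (0 : Fin m → K))
        ((lineX v m Q).eval (MvPolynomial.C c)) := by
    intro c
    have : (MvPolynomial.aeval (Sum.elim (fun i => v i * c) 0 : Fin n ⊕ Fin m → K) :
        PolyXY K n m →ₐ[K] K) = ((MvPolynomial.aeval (0 : Fin m → K)).comp
        ((Polynomial.aeval (R := MvPolynomial (Fin m) K) (MvPolynomial.C c)).restrictScalars K)).comp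
        (lineX v m) := by
      ext i : 1
      rcases i with i | i <;> simp [lineX]
    rw [this]
    simp
  have k1 := key 1
  have k0 := key 0
  rw [eq_C_of_natDegree_eq_zero h0, eval_C] at k0 k1
  simp only [mul_one, mul_zero] at k0 k1
  rw [k1, ← k0]
  congr 2
  ext i
  rcases i with i | i <;> simp

theorem aeval_eq_of_lineY_dvd {w : Fin m → K} {Q : PolyXY K n m} {f : MvPolynomial (Fin n) K}
    (hf : f ≠ 0) (h : lineY n w Q ∣ C f) :
    MvPolynomial.aeval (Sum.elim 0 w : Fin n ⊕ Fin m → K) Q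
      = MvPolynomial.aeval (0 : Fin n ⊕ Fin m → K) Q := by
  have h0 : (lineY n w Q).natDegree = 0 := by
    have := natDegree_le_of_dvd h (C_ne_zero.2 hf)
    simpa using this
  have key : ∀ c : K, MvPolynomial.aeval (Sum.elim 0 (fun i => w i * c) : Fin n ⊕ Fin m → K) Q
      = (MvPolynomial.aeval (0 : Fin n → K))
        ((lineY n w Q).eval (MvPolynomial.C c)) := by
    intro c
    have : (MvPolynomial.aeval (Sum.elim 0 (fun i => w i * c) : Fin n ⊕ Fin m → K) :
        PolyXY K n m →ₐ[K] K) = ((MvPolynomial.aeval (0 : Fin n → K)).comp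
        ((Polynomial.aeval (R := MvPolynomial (Fin n) K) (MvPolynomial.C c)).restrictScalars K)).comp
        (lineY n w) := by
      ext i : 1
      rcases i with i | i <;> simp [lineY]
    rw [this]
    simp
  have k1 := key 1
  have k0 := key 0
  rw [eq_C_of_natDegree_eq_zero h0, eval_C] at k0 k1
  simp only [mul_one, mul_zero] at k0 k1
  rw [k1, ← k0]
  congr 2
  ext i
  rcases i with i | i <;> simp

/-- The top form of `p` contains pure terms in `X` and in `Y`, visible on the lines spanned by `v`
and `w`. -/
structure HasShape (p P : PolyXY K n m) (a b W : ℕ) (v : Fin n → K) (w : Fin m → K) : Prop where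
  a_pos : 0 < a
  b_pos : 0 < b
  W_pos : 0 < W
  top : IsTopForm (weights n m a b) p P W
  pureX : MvPolynomial.aeval (Sum.elim v 0 : Fin n ⊕ Fin m → K) P ≠ 0
  pureY : MvPolynomial.aeval (Sum.elim 0 w : Fin n ⊕ Fin m → K) P ≠ 0

theorem IsTopForm.aeval_zero {σ : Type*} {wt : σ → ℕ} {q Q : MvPolynomial σ K} {W : ℕ}
    (h : IsTopForm wt q Q W) (hW : 0 < W) : MvPolynomial.aeval (0 : σ → K) Q = 0 := by
  rw [MvPolynomial.aeval_zero, Algebra.algebraMap_self_apply,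
    MvPolynomial.constantCoeff_eq]
  by_contra h0
  have := h.homogeneous h0
  simp at this
  omega

theorem HasShape.ne_zero {p P : PolyXY K n m} {a b W : ℕ} {v : Fin n → K} {w : Fin m → K}
    (h : HasShape p P a b W v w) : P ≠ 0 := by
  rintro rfl
  exact h.pureX (map_zero _)

theorem lineX_inclX (v : Fin n → K) {f : MvPolynomial (Fin n) K} {N : ℕ}
    (hf : f.IsHomogeneous N) :
    lineX v m (inclX K n m f) = C (MvPolynomial.C (MvPolynomial.aeval v f)) * X ^ N := by
  have e : lineX v m (inclX K n m f)
      = MvPolynomial.aeval (fun i => C (MvPolynomial.C (v i)) * X) f := by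
    simp only [lineX, inclX, MvPolynomial.aeval_rename]; rfl
  rw [e, f.as_sum, map_sum, map_sum, map_sum, map_sum, Finset.sum_mul]
  refine Finset.sum_congr rfl fun d hd => ?_
  have hdN : d.degree = N := by
    rw [Finsupp.degree_eq_weight_one]; exact hf (MvPolynomial.mem_support_iff.1 hd)
  rw [MvPolynomial.aeval_monomial, MvPolynomial.aeval_monomial, Finsupp.prod, Finsupp.prod, ← hdN,
    Finsupp.degree_apply, ← Finset.prod_pow_eq_pow_sum]
  simp only [map_mul, map_prod, map_pow, mul_pow, Finset.prod_mul_distrib, mul_assoc]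
  rfl

theorem lineY_inclY (w : Fin m → K) {g : MvPolynomial (Fin m) K} {N : ℕ}
    (hg : g.IsHomogeneous N) :
    lineY n w (inclY K n m g) = C (MvPolynomial.C (MvPolynomial.aeval w g)) * X ^ N := by
  have e : lineY n w (inclY K n m g)
      = MvPolynomial.aeval (fun i => C (MvPolynomial.C (w i)) * X) g := by
    simp only [lineY, inclY, MvPolynomial.aeval_rename]; rfl
  rw [e, g.as_sum, map_sum, map_sum, map_sum, map_sum, Finset.sum_mul]
  refine Finset.sum_congr rfl fun d hd => ?_
  have hdN : d.degree = N := by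
    rw [Finsupp.degree_eq_weight_one]; exact hg (MvPolynomial.mem_support_iff.1 hd)
  rw [MvPolynomial.aeval_monomial, MvPolynomial.aeval_monomial, Finsupp.prod, Finsupp.prod, ← hdN,
    Finsupp.degree_apply, ← Finset.prod_pow_eq_pow_sum]
  simp only [map_mul, map_prod, map_pow, mul_pow, Finset.prod_mul_distrib, mul_assoc]
  rfl

/-- The pairs in the separated algebra of `p` have comparable degrees, and their top forms do not
vanish in the directions `v` and `w`. -/
theorem HasShape.regular {p P : PolyXY K n m} {a b W : ℕ} {v : Fin n → K} {w : Fin m → K}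
    (h : HasShape p P a b W v w) {f : MvPolynomial (Fin n) K} {g : MvPolynomial (Fin m) K}
    (hfg : p ∣ inclX K n m f - inclY K n m g) (h0 : 0 < f.totalDegree ∨ 0 < g.totalDegree) :
    a * f.totalDegree = b * g.totalDegree ∧ 0 < f.totalDegree ∧ 0 < g.totalDegree ∧
    P ∣ inclX K n m (f.homogeneousComponent f.totalDegree)
        - inclY K n m (g.homogeneousComponent g.totalDegree) ∧
    MvPolynomial.aeval v (f.homogeneousComponent f.totalDegree) ≠ 0 ∧
    MvPolynomial.aeval w (g.homogeneousComponent g.totalDegree) ≠ 0 := by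
  -- Because of its pure terms, `P` cannot divide a nonzero polynomial in one group of variables,
  -- even after restriction to a line. This excludes unbalanced degrees and vanishing values along
  -- `v` and `w`.
  have hX : ∀ k : MvPolynomial (Fin m) K, k ≠ 0 → ¬ lineX v m P ∣ C k := fun k hk hd =>
    h.pureX ((aeval_eq_of_lineX_dvd hk hd).trans (h.top.aeval_zero h.W_pos))
  have hY : ∀ k : MvPolynomial (Fin n) K, k ≠ 0 → ¬ lineY n w P ∣ C k := fun k hk hd =>
    h.pureY ((aeval_eq_of_lineY_dvd hk hd).trans (h.top.aeval_zero h.W_pos))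
  rcases topForm_dvd h.a_pos h.b_pos h.top h.ne_zero hfg h0 with ⟨_, h1⟩ | ⟨_, h1⟩ | ⟨h1, h2, h3, h4⟩
  · have := map_dvd (lineY n w) h1.2
    rw [lineY_inclX] at this
    exact absurd this (hY _ (homogeneousComponent_totalDegree_ne_zero h1.1))
  · have := map_dvd (lineX v m) h1.2
    rw [lineX_inclY] at this
    exact absurd this (hX _ (homogeneousComponent_totalDegree_ne_zero h1.1))
  · have hf0 : f ≠ 0 := by rintro rfl; simp at h2
    have hg0 : g ≠ 0 := by rintro rfl; simp at h3
    refine ⟨h1, h2, h3, h4, fun hv => ?_, fun hw => ?_⟩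
    · refine hX _ (homogeneousComponent_totalDegree_ne_zero hg0) ?_
      have := map_dvd (lineX v m) h4
      rw [map_sub, lineX_inclX v (MvPolynomial.homogeneousComponent_isHomogeneous _ _), hv,
        lineX_inclY, map_zero, map_zero, zero_mul, zero_sub] at this
      exact (dvd_neg (α := (MvPolynomial (Fin m) K)[X])).1 this
    · refine hY _ (homogeneousComponent_totalDegree_ne_zero hf0) ?_
      have := map_dvd (lineY n w) h4
      rwa [map_sub, lineY_inclY w (MvPolynomial.homogeneousComponent_isHomogeneous _ _), hw,
        lineY_inclX, map_zero, map_zero, zero_mul, sub_zero] at this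

end


/-! ### Restriction to the plane spanned by two directions. -/

noncomputable instance commSemiringPolynomialPolynomial {S : Type*} [CommRing S] :
    CommSemiring S[X][X] := Polynomial.commSemiring

noncomputable instance commSemiringPolynomialPolynomialPolynomial {S : Type*} [CommRing S] :
    CommSemiring S[X][X][X] := Polynomial.commSemiring

noncomputable instance commRingPolynomialPolynomialPolynomial {S : Type*} [CommRing S] :
    CommRing S[X][X][X] := Polynomial.commRing

variable {K : Type*} [Field K] {n m : ℕ}

/-- Restriction to the plane spanned by the directions `v` and `w`, with coordinates `s = C X` and
`t = X`. -/
noncomputable def planeHom (A : Type*) [CommRing A] [Algebra K A] (v : Fin n → K) (w : Fin m → K) :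
    PolyXY K n m →ₐ[K] A[X][X] :=
  MvPolynomial.aeval (Sum.elim (fun i => C (C (algebraMap K A (v i)) * X))
    (fun j => C (C (algebraMap K A (w j))) * X))

theorem eval_planeHom {A : Type*} [CommRing A] [Algebra K A] (v : Fin n → K) (w : Fin m → K)
    (c d : K) (P : PolyXY K n m) :
    eval₂ (evalRingHom (algebraMap K A c)) (algebraMap K A d) (planeHom A v w P)
      = algebraMap K A (MvPolynomial.aeval
        (Sum.elim (fun i => v i * c) (fun j => w j * d) : Fin n ⊕ Fin m → K) P) := by
  have : ((eval₂RingHom (evalRingHom (algebraMap K A c)) (algebraMap K A d)).comp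
      (planeHom A v w : PolyXY K n m →+* A[X][X]))
      = (algebraMap K A).comp (MvPolynomial.aeval
        (Sum.elim (fun i => v i * c) (fun j => w j * d) : Fin n ⊕ Fin m → K) :
          PolyXY K n m →ₐ[K] K) := by
    refine MvPolynomial.ringHom_ext ?_ ?_
    · intro r
      simp [planeHom]
    · rintro (i | i) <;> simp [planeHom]
  exact DFunLike.congr_fun this P

section Shape

variable {p P : PolyXY K n m} {a b W : ℕ} {v : Fin n → K} {w : Fin m → K}
  {A : Type*} [CommRing A] [IsDomain A] [Algebra K A]

/-- A weighted form of positive weight vanishes at the origin. -/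
theorem HasShape.not_isUnit_planeHom (h : HasShape p P a b W v w) :
    ¬ IsUnit (planeHom A v w P) := by
  intro hu
  have := hu.map (eval₂RingHom (evalRingHom (algebraMap K A 0)) (algebraMap K A 0))
  rw [coe_eval₂RingHom, eval_planeHom] at this
  simp only [mul_zero] at this
  have e : (Sum.elim (fun _ => 0) (fun _ => 0) : Fin n ⊕ Fin m → K) = 0 := by
    ext i; rcases i with i | i <;> rfl
  rw [e, h.top.aeval_zero h.W_pos, map_zero] at this
  exact not_isUnit_zero this

/-- The coordinate `s` is prime and does not divide the restricted form, whose value at `s = 0`, `t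
= 1` is its nonzero pure part in `Y`. So `s` may be cancelled. -/
theorem HasShape.dvd_of_dvd_mul_s (h : HasShape p P a b W v w) {k : A[X][X]} {j : ℕ}
    (hd : planeHom A v w P ∣ k * C X ^ j) : planeHom A v w P ∣ k := by
  obtain ⟨c, hc⟩ := hd
  have hprime : Prime (C X : A[X][X]) := prime_C_iff.2 prime_X
  have hnd : ¬ (C X : A[X][X]) ∣ planeHom A v w P := by
    intro hd
    have := map_dvd (eval₂RingHom (evalRingHom (algebraMap K A 0)) (algebraMap K A 1)) hd
    rw [coe_eval₂RingHom, eval_planeHom] at this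
    simp only [mul_zero, mul_one, eval₂_C, coe_evalRingHom, eval_X, map_zero, zero_dvd_iff,
      map_eq_zero_iff _ (algebraMap K A).injective] at this
    exact h.pureY this
  obtain ⟨e, rfl⟩ := hprime.pow_dvd_of_dvd_mul_left j hnd ⟨k, by rw [← hc, mul_comm]⟩
  refine ⟨e, mul_right_cancel₀ (pow_ne_zero j hprime.ne_zero) (hc.trans ?_)⟩
  ring

/-- As for `s`, now with the pure part in `X`. -/
theorem HasShape.dvd_of_dvd_mul_t (h : HasShape p P a b W v w) {k : A[X][X]} {j : ℕ}
    (hd : planeHom A v w P ∣ k * X ^ j) : planeHom A v w P ∣ k := by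
  obtain ⟨c, hc⟩ := hd
  have hprime : Prime (X : A[X][X]) := prime_X
  have hnd : ¬ (X : A[X][X]) ∣ planeHom A v w P := by
    intro hd
    have := map_dvd (eval₂RingHom (evalRingHom (algebraMap K A 1)) (algebraMap K A 0)) hd
    rw [coe_eval₂RingHom, eval_planeHom] at this
    simp only [mul_zero, mul_one, eval₂_X, map_zero, zero_dvd_iff,
      map_eq_zero_iff _ (algebraMap K A).injective] at this
    exact h.pureX this
  obtain ⟨e, rfl⟩ := hprime.pow_dvd_of_dvd_mul_left j hnd ⟨k, by rw [← hc, mul_comm]⟩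
  refine ⟨e, mul_right_cancel₀ (pow_ne_zero j hprime.ne_zero) (hc.trans ?_)⟩
  ring

end Shape

/-! ### Translations along the chosen directions. -/

/-- Translation along `v`. -/
noncomputable def shiftHom {σ : Type*} (v : σ → K) :
    MvPolynomial σ K →ₐ[K] (MvPolynomial σ K)[X] :=
  MvPolynomial.aeval fun i => C (MvPolynomial.X i) + C (MvPolynomial.C (v i)) * X

theorem natDegree_shift_le {B : Type*} [CommRing B] (x y : B) :
    (C x + C y * X : B[X]).natDegree ≤ 1 :=
  (natDegree_add_le _ _).trans (max_le (by simp) (by simpa using natDegree_C_mul_X_pow_le y 1))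

/-- The top coefficient in the translation parameter is a scalar, the value of the top form at `v`.
If it is not zero, then a scalar multiple of `f` becomes monic, so that approximate roots exist. -/
theorem shiftHom_spec {σ : Type*} (v : σ → K) (f : MvPolynomial σ K) :
    (shiftHom v f).natDegree ≤ f.totalDegree ∧ (shiftHom v f).coeff f.totalDegree
      = MvPolynomial.C (MvPolynomial.aeval v (f.homogeneousComponent f.totalDegree)) := by
  obtain ⟨h1, h2⟩ := (isTopForm_homogeneousComponent f one_pos).aeval_coeff
    (B := MvPolynomial σ K)
    (y := fun i => C (MvPolynomial.X i) + C (MvPolynomial.C (v i)) * X)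
    (fun i => natDegree_shift_le _ _)
  rw [one_mul] at h1 h2
  refine ⟨h1, h2.trans ?_⟩
  have : (MvPolynomial.aeval fun i => ((C (MvPolynomial.X i) + C (MvPolynomial.C (v i)) * X :
      (MvPolynomial σ K)[X]).coeff 1)) = (Algebra.ofId K (MvPolynomial σ K)).comp
        (MvPolynomial.aeval v : MvPolynomial σ K →ₐ[K] K) := by
    ext i : 1
    simp [Algebra.ofId_apply]
  rw [this]; rfl

/-- Translation along `v` and `w`, with parameters `s = C X` and `t = X`. -/
noncomputable def shiftXY (v : Fin n → K) (w : Fin m → K) :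
    PolyXY K n m →ₐ[K] (PolyXY K n m)[X][X] :=
  MvPolynomial.aeval (Sum.elim
    (fun i => C (C (MvPolynomial.X (Sum.inl i)) + C (MvPolynomial.C (v i)) * X))
    (fun j => C (C (MvPolynomial.X (Sum.inr j))) + C (C (MvPolynomial.C (w j))) * X))

theorem shiftXY_inclX (v : Fin n → K) (w : Fin m → K) (f : MvPolynomial (Fin n) K) :
    shiftXY v w (inclX K n m f) = C ((shiftHom v f).map (inclX K n m : _ →+* PolyXY K n m)) := by
  have : (shiftXY v w : PolyXY K n m →+* _).comp (inclX K n m : _ →+* PolyXY K n m)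
      = (C : _ →+* (PolyXY K n m)[X][X]).comp ((mapRingHom (inclX K n m : _ →+* PolyXY K n m)).comp
        (shiftHom v : MvPolynomial (Fin n) K →+* (MvPolynomial (Fin n) K)[X])) := by
    refine MvPolynomial.ringHom_ext ?_ ?_
    · intro r; simp [shiftXY, shiftHom, inclX, Polynomial.algebraMap_apply]
    · intro i; simp [shiftXY, shiftHom, inclX]
  exact DFunLike.congr_fun this f

theorem shiftXY_inclY (v : Fin n → K) (w : Fin m → K) (g : MvPolynomial (Fin m) K) :
    shiftXY v w (inclY K n m g)
      = (shiftHom w g).map ((C : PolyXY K n m →+* _).comp (inclY K n m : _ →+* PolyXY K n m)) := by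
  have : (shiftXY v w : PolyXY K n m →+* _).comp (inclY K n m : _ →+* PolyXY K n m)
      = ((mapRingHom ((C : PolyXY K n m →+* _).comp (inclY K n m : _ →+* PolyXY K n m))).comp
        (shiftHom w : MvPolynomial (Fin m) K →+* (MvPolynomial (Fin m) K)[X])) := by
    refine MvPolynomial.ringHom_ext ?_ ?_
    · intro r; simp [shiftXY, shiftHom, inclY, Polynomial.algebraMap_apply]
    · intro i; simp [shiftXY, shiftHom, inclY]
  exact DFunLike.congr_fun this g

/-! ### The weighted grading in the translation parameters. -/

section Grading

variable {S : Type*} [CommRing S]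

/-- The grading homomorphism of `S[s][t]` for which `s` has weight `a` and `t` has weight `b`. -/
noncomputable def bigrade (S : Type*) [CommRing S] (a b : ℕ) : S[X][X] →+* S[X][X][X] :=
  eval₂RingHom (eval₂RingHom ((C : S[X][X] →+* _).comp ((C : S[X] →+* _).comp C)) (C (C X) * X ^ a))
    (C X * X ^ b)

theorem bigrade_monomial (a b i j : ℕ) (c : S) :
    bigrade S a b (monomial j (monomial i c)) = C (monomial j (monomial i c)) * X ^ (a * i + b * j) := by
  simp only [bigrade, coe_eval₂RingHom, eval₂_monomial, RingHom.coe_comp, Function.comp_apply]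
  simp only [← C_mul_X_pow_eq_monomial, C_mul, C_pow]
  ring

theorem eval_one_bigrade (a b : ℕ) (x : S[X][X]) : (bigrade S a b x).eval 1 = x := by
  have : (evalRingHom 1).comp (bigrade S a b) = RingHom.id _ := by
    ext <;> simp [bigrade]
  exact DFunLike.congr_fun this x

/-- Every coefficient is homogeneous of its own degree, since this holds for monomials. It supplies
the homogeneity hypothesis of `dvd_of_dvd_mul_sub`. -/
theorem bigrade_coeff (a b : ℕ) (x : S[X][X]) (k : ℕ) :
    bigrade S a b ((bigrade S a b x).coeff k) = C ((bigrade S a b x).coeff k) * X ^ k := by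
  induction x using Polynomial.induction_on' with
  | add p q hp hq => rw [map_add, coeff_add, map_add, hp, hq, C_add, add_mul]
  | monomial j q =>
    induction q using Polynomial.induction_on' with
    | add p q hp hq => rw [map_add, map_add, coeff_add, map_add, hp, hq, C_add, add_mul]
    | monomial i c =>
      rw [bigrade_monomial, coeff_C_mul_X_pow]
      split_ifs with h
      · rw [bigrade_monomial, h]
      · simp

theorem degree_bigrade_C_lt {a b k : ℕ} (ha : 0 < a) {h : S[X]} (hh : h.degree < (k : WithBot ℕ)) :
    (bigrade S a b (C h)).degree < ((a * k : ℕ) : WithBot ℕ) := by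
  conv_lhs => rw [h.as_sum_support, map_sum, map_sum]
  refine (degree_sum_le _ _).trans_lt ?_
  rw [Finset.sup_lt_iff (by exact WithBot.bot_lt_coe _)]
  intro i hi
  have := bigrade_monomial a b i 0 (h.coeff i)
  rw [monomial_zero_left] at this
  rw [this]
  refine (degree_C_mul_X_pow_le _ _).trans_lt ?_
  have hik : i < k := by
    exact_mod_cast (le_degree_of_mem_supp i hi).trans_lt hh
  have : a * i + b * 0 < a * k := by
    rw [mul_zero, add_zero]; exact Nat.mul_lt_mul_of_pos_left hik ha
  exact_mod_cast this

theorem degree_bigrade_map_lt {a b k : ℕ} (hb : 0 < b) {B : Type*} [CommRing B] (φ : B →+* S)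
    {h : B[X]} (hh : h.degree < (k : WithBot ℕ)) :
    (bigrade S a b (h.map ((C : S →+* S[X]).comp φ))).degree < ((b * k : ℕ) : WithBot ℕ) := by
  conv_lhs => rw [h.as_sum_support, Polynomial.map_sum, map_sum]
  refine (degree_sum_le _ _).trans_lt ?_
  rw [Finset.sup_lt_iff (by exact WithBot.bot_lt_coe _)]
  intro i hi
  have := bigrade_monomial a b 0 i (φ (h.coeff i))
  rw [monomial_zero_left] at this
  rw [map_monomial, RingHom.comp_apply, this]
  refine (degree_C_mul_X_pow_le _ _).trans_lt ?_
  have hik : i < k := by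
    exact_mod_cast (le_degree_of_mem_supp i hi).trans_lt hh
  have : a * 0 + b * i < b * k := by
    rw [mul_zero, zero_add]; exact Nat.mul_lt_mul_of_pos_left hik hb
  exact_mod_cast this

theorem bigrade_C_monic {a b d : ℕ} (ha : 0 < a) {h : S[X]} (hh : h.Monic) (hd : h.natDegree = d) :
    (bigrade S a b (C h)).natDegree ≤ a * d ∧ (bigrade S a b (C h)).coeff (a * d) = C X ^ d := by
  nontriviality S
  have hlt : (h - X ^ d).degree < (d : WithBot ℕ) := by
    have := degree_sub_lt_left (p := h) (q := X ^ d) (by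
      rw [degree_X_pow, degree_eq_natDegree hh.ne_zero, hd]) hh.ne_zero (by
      rw [hh.leadingCoeff, (monic_X_pow _).leadingCoeff])
    rwa [degree_eq_natDegree hh.ne_zero, hd] at this
  have h1 := degree_bigrade_C_lt (b := b) ha hlt
  have h2 : bigrade S a b (C X ^ d) = C (C X ^ d) * X ^ (a * d) := by
    have := bigrade_monomial a b d 0 (1 : S)
    rwa [monomial_zero_left, mul_zero, add_zero, monomial_one_right_eq_X_pow,
      show C (X ^ d : S[X]) = C X ^ d from C_pow] at this
  have e : bigrade S a b (C h) = bigrade S a b (C (h - X ^ d)) + C (C X ^ d) * X ^ (a * d) := by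
    rw [← h2, ← map_add, ← C_pow, ← C_add, sub_add_cancel]
  rw [e]
  refine ⟨(natDegree_add_le _ _).trans (max_le (natDegree_le_iff_degree_le.2 h1.le)
    (natDegree_C_mul_X_pow_le _ _)), ?_⟩
  rw [coeff_add, coeff_eq_zero_of_degree_lt h1, zero_add, coeff_C_mul_X_pow, if_pos rfl]

theorem bigrade_map_monic {a b d : ℕ} (hb : 0 < b) {B : Type*} [CommRing B] (φ : B →+* S)
    {h : B[X]} (hh : h.Monic) (hd : h.natDegree = d) :
    (bigrade S a b (h.map ((C : S →+* S[X]).comp φ))).natDegree ≤ b * d ∧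
    (bigrade S a b (h.map ((C : S →+* S[X]).comp φ))).coeff (b * d) = X ^ d := by
  nontriviality S
  have : Nontrivial B := φ.domain_nontrivial
  have hlt : (h - X ^ d).degree < (d : WithBot ℕ) := by
    have := degree_sub_lt_left (p := h) (q := X ^ d) (by
      rw [degree_X_pow, degree_eq_natDegree hh.ne_zero, hd]) hh.ne_zero (by
      rw [hh.leadingCoeff, (monic_X_pow _).leadingCoeff])
    rwa [degree_eq_natDegree hh.ne_zero, hd] at this
  have h1 := degree_bigrade_map_lt (a := a) hb φ hlt
  have h2 : bigrade S a b (X ^ d) = C (X ^ d) * X ^ (b * d) := by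
    have := bigrade_monomial a b 0 d (1 : S)
    rwa [monomial_zero_left, mul_zero, zero_add, C_1, monomial_one_right_eq_X_pow] at this
  have e : bigrade S a b (h.map ((C : S →+* S[X]).comp φ))
      = bigrade S a b ((h - X ^ d).map ((C : S →+* S[X]).comp φ)) + C (X ^ d) * X ^ (b * d) := by
    rw [← h2, ← map_add, Polynomial.map_sub, Polynomial.map_pow, Polynomial.map_X, sub_add_cancel]
  rw [e]
  refine ⟨(natDegree_add_le _ _).trans (max_le (natDegree_le_iff_degree_le.2 h1.le)
    (natDegree_C_mul_X_pow_le _ _)), ?_⟩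
  rw [coeff_add, coeff_eq_zero_of_degree_lt h1, zero_add, coeff_C_mul_X_pow, if_pos rfl]

end Grading

/-- In `p (x + s v, y + t w)` only `s` and `t` carry weight, so the part of highest weight is `P (s
v, t w)`, and it is not zero because `P` has a pure term. -/
theorem HasShape.bigrade_shiftXY {p P : PolyXY K n m} {a b W : ℕ} {v : Fin n → K} {w : Fin m → K}
    (h : HasShape p P a b W v w) :
    (bigrade (PolyXY K n m) a b (shiftXY v w p)).leadingCoeff = planeHom (PolyXY K n m) v w P := by
  have ha := h.a_pos
  have hb := h.b_pos
  have hne : planeHom (PolyXY K n m) v w P ≠ 0 := by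
    intro h0
    have h1 := eval_planeHom (A := PolyXY K n m) v w 1 0 P
    rw [h0] at h1
    simp only [eval₂_zero, mul_one, mul_zero] at h1
    exact h.pureX ((map_eq_zero_iff _ (algebraMap K (PolyXY K n m)).injective).1 h1.symm)
  set y : Fin n ⊕ Fin m → (PolyXY K n m)[X][X][X] := Sum.elim
    (fun i => C (C (C (MvPolynomial.X (Sum.inl i)))) + C (C (C (MvPolynomial.C (v i)) * X)) * X ^ a)
    (fun j => C (C (C (MvPolynomial.X (Sum.inr j)))) + C (C (C (MvPolynomial.C (w j))) * X) * X ^ b)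
    with hy
  have hdeg : ∀ i, (y i).natDegree ≤ weights n m a b i := by
    rintro (i | i) <;>
    exact (natDegree_add_le _ _).trans (max_le (by simp) (natDegree_C_mul_X_pow_le _ _))
  obtain ⟨h1, h2⟩ := h.top.aeval_coeff (B := (PolyXY K n m)[X][X]) hdeg
  have e1 : MvPolynomial.aeval y p = bigrade (PolyXY K n m) a b (shiftXY v w p) := by
    have : ((MvPolynomial.aeval y : PolyXY K n m →ₐ[K] _) : PolyXY K n m →+* _)
        = (bigrade (PolyXY K n m) a b).comp (shiftXY v w : PolyXY K n m →+* _) := by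
      refine MvPolynomial.ringHom_ext ?_ ?_
      · intro r; simp [shiftXY, bigrade, Polynomial.algebraMap_apply]
      · rintro (i | i)
        · simp [shiftXY, bigrade, hy, mul_assoc]
        · simp [shiftXY, bigrade, hy, mul_assoc]
    exact DFunLike.congr_fun this p
  have e2 : (MvPolynomial.aeval fun i => (y i).coeff (weights n m a b i))
      = planeHom (PolyXY K n m) v w := by
    refine MvPolynomial.algHom_ext ?_
    rintro (i | i)
    · simp only [planeHom, hy, weights, Sum.elim_inl, coeff_add, coeff_C, ha.ne',
        coeff_C_mul_X_pow, if_true, if_false, zero_add, MvPolynomial.aeval_X]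
      rfl
    · simp only [planeHom, hy, weights, Sum.elim_inr, coeff_add, coeff_C, hb.ne',
        coeff_C_mul_X_pow, if_true, if_false, zero_add, MvPolynomial.aeval_X]
      rfl
  rw [e1] at h1 h2
  rw [e2] at h2
  rw [leadingCoeff, natDegree_eq_of_le_of_coeff_ne_zero h1 (by rwa [h2]), h2]


/-! ### Extraction of roots from separated multiples. -/

variable {K : Type*} [Field K] {n m : ℕ}

/-- Modulo `z` the elements `x` and `y` agree, so each of the `q` summands becomes `x ^ (q - 1)`. -/
theorem dvd_geom_sum_sub {R : Type*} [CommRing R] {x y z : R} (h : z ∣ x - y) (q : ℕ) :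
    z ∣ (∑ i ∈ Finset.range q, x ^ i * y ^ (q - 1 - i)) - q * x ^ (q - 1) := by
  have e : (q : R) * x ^ (q - 1) = ∑ i ∈ Finset.range q, x ^ i * x ^ (q - 1 - i) := by
    rw [Finset.sum_congr rfl (g := fun _ => x ^ (q - 1))]
    · simp
    · intro i hi
      rw [Finset.mem_range] at hi
      rw [← pow_add]; congr 1; omega
  rw [e, ← Finset.sum_sub_distrib]
  refine Finset.dvd_sum fun i _ => ?_
  rw [← mul_sub]
  exact Dvd.dvd.mul_left (((dvd_sub_comm).1 h).trans (sub_dvd_pow_sub_pow _ _ _)) _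

/-- Carries divisibility relations over `K[s, t]` to the translated ring, where the leading form of
`p` lives. -/
theorem map_planeHom (A : Type*) [CommRing A] [Algebra K A] (v : Fin n → K) (w : Fin m → K)
    (P : PolyXY K n m) :
    mapRingHom (mapRingHom (algebraMap K A)) (planeHom K v w P) = planeHom A v w P := by
  have : (mapRingHom (mapRingHom (algebraMap K A))).comp (planeHom K v w : PolyXY K n m →+* _)
      = (planeHom A v w : PolyXY K n m →+* _) := by
    refine MvPolynomial.ringHom_ext ?_ ?_
    · intro r; simp [planeHom, Polynomial.algebraMap_apply]
    · rintro (i | i) <;> simp [planeHom]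
  exact DFunLike.congr_fun this P

/-- Let `U` and `Z` be approximate `q`-th roots of `F` and `G`, and let `Q` be the cofactor in `U ^
q - (θ Z) ^ q = (U - θ Z) Q`. Up to a remainder of smaller weight than `Q`, this is the given
multiple `F - θ ^ q G` of the translated `p`. Modulo the restricted top form, the leading form of
`Q` is `q s ^ (d (q - 1))`, which can be cancelled. So `dvd_of_dvd_mul_sub` applies to `U - θ Z`. -/
theorem HasShape.exists_monic_dvd_sub [CharZero K] {p P : PolyXY K n m} {a b W : ℕ} {v : Fin n → K}
    {w : Fin m → K} (h : HasShape p P a b W v w) {d d' q : ℕ} (hq : 0 < q)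
    (hdd : a * d = b * d') {F : (MvPolynomial (Fin n) K)[X]} {G : (MvPolynomial (Fin m) K)[X]}
    (hF : F.Monic) (hFd : F.natDegree = d * q) (hG : G.Monic) (hGd : G.natDegree = d' * q)
    {θ : K}
    (hθ : planeHom K v w P ∣ C X ^ d - C (C θ) * X ^ d')
    (hFG : shiftXY v w p ∣ C (F.map (inclX K n m : MvPolynomial (Fin n) K →+* PolyXY K n m)) -
      C (C (MvPolynomial.C (θ ^ q))) *
        G.map ((C : PolyXY K n m →+* _).comp (inclY K n m : MvPolynomial (Fin m) K →+* PolyXY K n m))) :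
    ∃ (u : (MvPolynomial (Fin n) K)[X]) (z : (MvPolynomial (Fin m) K)[X]),
      u.Monic ∧ u.natDegree = d ∧ shiftXY v w p ∣ C (u.map (inclX K n m : MvPolynomial (Fin n) K →+* PolyXY K n m)) -
        C (C (MvPolynomial.C θ)) *
          z.map ((C : PolyXY K n m →+* _).comp (inclY K n m : MvPolynomial (Fin m) K →+* PolyXY K n m)) := by
  have hqK : (q : K) ≠ 0 := Nat.cast_ne_zero.2 hq.ne'
  have hunit : ∀ (A : Type _) [CommRing A] [Algebra K A], IsUnit (q : A) := by
    intro A _ _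
    have := (IsUnit.mk0 _ hqK).map (algebraMap K A)
    rwa [map_natCast] at this
  obtain ⟨u, hu, hud, hul⟩ := exists_monic_pow_approx (hunit _) hq hF hFd
  obtain ⟨z, hz, hzd, hzl⟩ := exists_monic_pow_approx (hunit _) hq hG hGd
  refine ⟨u, z, hu, hud, ?_⟩
  set iX : MvPolynomial (Fin n) K →+* PolyXY K n m := (inclX K n m : MvPolynomial (Fin n) K →+* PolyXY K n m) with hiX
  set iY : MvPolynomial (Fin m) K →+* PolyXY K n m := (inclY K n m : MvPolynomial (Fin m) K →+* PolyXY K n m) with hiY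
  set c : (PolyXY K n m)[X][X] := C (C (MvPolynomial.C θ)) with hc
  set U : (PolyXY K n m)[X][X] := C (u.map iX) with hU
  set Z : (PolyXY K n m)[X][X] := z.map ((C : (PolyXY K n m) →+* (PolyXY K n m)[X]).comp iY) with hZ
  set Q : (PolyXY K n m)[X][X] := ∑ i ∈ Finset.range q, U ^ i * (c * Z) ^ (q - 1 - i) with hQ
  set D := a * d with hD
  obtain ⟨hU1, hU2⟩ := bigrade_C_monic (S := PolyXY K n m) (b := b) h.a_pos (hu.map iX)
    (hu.natDegree_map iX |>.trans hud)
  obtain ⟨hZ1, hZ2⟩ := bigrade_map_monic (a := a) h.b_pos iY hz hzd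
  rw [← hdd] at hZ1 hZ2
  have hωc : bigrade (PolyXY K n m) a b c = C c := by simp [bigrade, hc]
  have hcZ1 : (bigrade (PolyXY K n m) a b (c * Z)).natDegree ≤ D := by
    rw [map_mul, hωc]; exact (natDegree_C_mul_le _ _).trans hZ1
  have hcZ2 : (bigrade (PolyXY K n m) a b (c * Z)).coeff D = c * X ^ d' := by
    rw [map_mul, hωc, coeff_C_mul, hZ2]
  set Q0 : (PolyXY K n m)[X][X] := ∑ i ∈ Finset.range q, (C X ^ d) ^ i * (c * X ^ d') ^ (q - 1 - i) with hQ0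
  have hsum : ∀ i ∈ Finset.range q, i * D + (q - 1 - i) * D = (q - 1) * D := by
    intro i hi
    rw [Finset.mem_range] at hi
    rw [← add_mul]; congr 1; omega
  have hQ1 : (bigrade (PolyXY K n m) a b Q).natDegree ≤ (q - 1) * D := by
    rw [hQ, map_sum]
    refine natDegree_sum_le_of_forall_le _ _ fun i hi => ?_
    rw [map_mul, map_pow, map_pow, ← hsum i hi]
    exact natDegree_mul_le.trans (add_le_add (natDegree_pow_le_of_le _ hU1)
      (natDegree_pow_le_of_le _ hcZ1))
  have hQ2 : (bigrade (PolyXY K n m) a b Q).coeff ((q - 1) * D) = Q0 := by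
    rw [hQ, map_sum, finsetSum_coeff, hQ0]
    refine Finset.sum_congr rfl fun i hi => ?_
    rw [map_mul, map_pow, map_pow, ← hsum i hi, coeff_mul_add_eq_of_natDegree_le
      (natDegree_pow_le_of_le _ hU1) (natDegree_pow_le_of_le _ hcZ1),
      coeff_pow_of_natDegree_le hU1, coeff_pow_of_natDegree_le hcZ1, hU2, hcZ2]
  set Ps := planeHom (PolyXY K n m) v w P with hPs
  have hθS : Ps ∣ C X ^ d - c * X ^ d' := by
    have := map_dvd (mapRingHom (mapRingHom (algebraMap K (PolyXY K n m)))) hθ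
    rw [map_planeHom] at this
    simpa [hc, MvPolynomial.algebraMap_eq] using this
  -- Modulo `Ps` the two quantities `s ^ d` and `θ t ^ d'` agree by `hθ`.
  have hQ0mod : Ps ∣ Q0 - C (C (MvPolynomial.C (q : K))) * C X ^ (d * (q - 1)) := by
    have := dvd_geom_sum_sub hθS q
    rw [← pow_mul] at this
    convert this using 2
    simp
  have hcancel : ∀ k : (PolyXY K n m)[X][X], Ps ∣ k * Q0 → Ps ∣ k := by
    intro k hk
    have h1 : Ps ∣ k * C (C (MvPolynomial.C (q : K))) * C X ^ (d * (q - 1)) := by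
      have := dvd_sub hk (Dvd.dvd.mul_left hQ0mod k)
      rwa [← mul_sub, sub_sub_cancel, ← mul_assoc] at this
    have h2 := h.dvd_of_dvd_mul_s h1
    have hu : IsUnit (C (C (MvPolynomial.C (q : K))) : (PolyXY K n m)[X][X]) :=
      (((IsUnit.mk0 _ hqK).map (MvPolynomial.C : K →+* (PolyXY K n m))).map C).map C
    exact hu.dvd_mul_right.1 h2
  -- If the sum vanished, cancelling it would make `Ps` a divisor of `1`.
  have hQ00 : Q0 ≠ 0 := by
    intro h0
    refine h.not_isUnit_planeHom (A := PolyXY K n m) (isUnit_of_dvd_one (hcancel 1 ?_))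
    rw [h0, mul_zero]; exact dvd_zero _
  have hQnat : (bigrade (PolyXY K n m) a b Q).natDegree = (q - 1) * D :=
    natDegree_eq_of_le_of_coeff_ne_zero hQ1 (by rwa [hQ2])
  have hQlc : (bigrade (PolyXY K n m) a b Q).leadingCoeff = Q0 := by rw [leadingCoeff, hQnat, hQ2]
  have hQne : bigrade (PolyXY K n m) a b Q ≠ 0 := by
    intro h0
    rw [h0, coeff_zero] at hQ2
    exact hQ00 hQ2.symm
  set G' : (PolyXY K n m)[X][X] := G.map ((C : (PolyXY K n m) →+* (PolyXY K n m)[X]).comp iY) with hG'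
  -- Chosen so that `(U - c * Z) * Q - r` is exactly the given multiple of the translated `p`; both
  -- parts have small degree since the roots are approximate.
  set r : (PolyXY K n m)[X][X] := (c ^ q * (G' - Z ^ q)) - (C (F.map iX) - U ^ q) with hr
  refine dvd_of_dvd_mul_sub (bigrade (PolyXY K n m) a b) (eval_one_bigrade a b) (fun x => bigrade_coeff a b x _)
    (Q := Q) (r := r) ?_ ?_ ?_
  · rw [degree_eq_natDegree hQne, hQnat, hr, map_sub]
    have e1 : (bigrade (PolyXY K n m) a b (C (F.map iX) - U ^ q)).degree
        < (((q - 1) * D : ℕ) : WithBot ℕ) := by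
      have := degree_bigrade_C_lt (S := PolyXY K n m) (b := b) h.a_pos (degree_map_le.trans_lt hul : 
        ((F - u ^ q).map iX).degree < _)
      rw [Polynomial.map_sub, Polynomial.map_pow, C_sub, C_pow] at this
      rwa [hD, show (q - 1) * (a * d) = a * (d * (q - 1)) by ring]
    have e2 : (bigrade (PolyXY K n m) a b (c ^ q * (G' - Z ^ q))).degree
        < (((q - 1) * D : ℕ) : WithBot ℕ) := by
      have := degree_bigrade_map_lt (a := a) h.b_pos iY hzl
      rw [Polynomial.map_sub, Polynomial.map_pow] at this
      rw [map_mul, map_pow, hωc, ← C_pow, hdd, show (q - 1) * (b * d') = b * (d' * (q - 1)) by ring]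
      refine lt_of_le_of_lt ?_ this
      rw [degree_mul]
      calc _ ≤ 0 + _ := add_le_add_left degree_C_le _
        _ = _ := zero_add _
    exact (degree_sub_le _ _).trans_lt (max_lt e2 e1)
  · rw [hQlc, h.bigrade_shiftXY]
    exact hcancel
  · have e : (U - c * Z) * Q = U ^ q - (c * Z) ^ q := by
      rw [hQ, mul_comm]
      exact (Commute.all U (c * Z)).geom_sum₂_mul q
    have e3 : c ^ q = C (C (MvPolynomial.C (θ ^ q))) := by simp [hc]
    rw [e, hr, e3, mul_pow, e3]
    convert hFG using 1
    ring


/-! ### Realizing exponents by separated multiples. -/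

variable {K : Type*} [Field K] {n m : ℕ}

theorem map_dvd_map_sub_map {R S : Type*} [CommRing R] [CommRing S] (φ : R →+* S) {p x y : R}
    (h : p ∣ x - y) : φ p ∣ φ x - φ y := by
  rw [← map_sub]
  exact map_dvd φ h

theorem shiftXY_dvd_sub (v : Fin n → K) (w : Fin m → K) {p x y : PolyXY K n m}
    (h : p ∣ x - y) : shiftXY v w p ∣ shiftXY v w x - shiftXY v w y := by
  obtain ⟨k, hk⟩ := h
  refine ⟨shiftXY v w k, ?_⟩
  have e : shiftXY v w x = shiftXY v w y + shiftXY v w p * shiftXY v w k := by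
    rw [← map_mul, ← map_add, ← hk, add_sub_cancel]
  rw [e]
  ring

theorem planeHom_inclX (v : Fin n → K) (w : Fin m → K) {f : MvPolynomial (Fin n) K} {N : ℕ}
    (hf : f.IsHomogeneous N) :
    planeHom K v w (inclX K n m f) = C (C (MvPolynomial.aeval v f)) * C X ^ N := by
  have e : planeHom K v w (inclX K n m f)
      = MvPolynomial.aeval (fun i => C (C (v i) * X)) f := by
    simp only [planeHom, inclX, MvPolynomial.aeval_rename]; rfl
  rw [e, f.as_sum, map_sum, map_sum, map_sum, map_sum, Finset.sum_mul]
  refine Finset.sum_congr rfl fun d hd => ?_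
  have hdN : d.degree = N := by
    rw [Finsupp.degree_eq_weight_one]; exact hf (MvPolynomial.mem_support_iff.1 hd)
  rw [MvPolynomial.aeval_monomial, MvPolynomial.aeval_monomial, Finsupp.prod, Finsupp.prod, ← hdN,
    Finsupp.degree_apply, ← Finset.prod_pow_eq_pow_sum]
  simp only [map_mul, map_prod, map_pow, mul_pow, Finset.prod_mul_distrib, mul_assoc]
  rfl

theorem planeHom_inclY (v : Fin n → K) (w : Fin m → K) {g : MvPolynomial (Fin m) K} {N : ℕ}
    (hg : g.IsHomogeneous N) :
    planeHom K v w (inclY K n m g) = C (C (MvPolynomial.aeval w g)) * X ^ N := by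
  have e : planeHom K v w (inclY K n m g)
      = MvPolynomial.aeval (fun i => C (C (w i)) * X) g := by
    simp only [planeHom, inclY, MvPolynomial.aeval_rename]; rfl
  rw [e, g.as_sum, map_sum, map_sum, map_sum, map_sum, Finset.sum_mul]
  refine Finset.sum_congr rfl fun d hd => ?_
  have hdN : d.degree = N := by
    rw [Finsupp.degree_eq_weight_one]; exact hg (MvPolynomial.mem_support_iff.1 hd)
  rw [MvPolynomial.aeval_monomial, MvPolynomial.aeval_monomial, Finsupp.prod, Finsupp.prod, ← hdN,
    Finsupp.degree_apply, ← Finset.prod_pow_eq_pow_sum]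
  simp only [map_mul, map_prod, map_pow, mul_pow, Finset.prod_mul_distrib, mul_assoc]
  rfl

/-- A coordinate divided by a nonzero entry of `v` grows at unit speed along `v`. It makes the
translation parameter eliminable. -/
theorem exists_linear_form {v : Fin n → K} (hv : v ≠ 0) :
    ∃ l : MvPolynomial (Fin n) K, shiftHom v l = X + C l := by
  obtain ⟨i, hi⟩ := Function.ne_iff.1 hv
  refine ⟨MvPolynomial.C (v i)⁻¹ * MvPolynomial.X i, ?_⟩
  have : shiftHom v (MvPolynomial.C (v i)⁻¹) = C (MvPolynomial.C (v i)⁻¹) :=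
    (shiftHom v).commutes _
  rw [map_mul, this, shiftHom, MvPolynomial.aeval_X, mul_add, ← mul_assoc, ← C_mul, ← C_mul,
    ← MvPolynomial.C_mul, inv_mul_cancel₀ hi, MvPolynomial.C_1, C_1, one_mul, add_comm]

theorem HasShape.v_ne_zero {p P : PolyXY K n m} {a b W : ℕ} {v : Fin n → K} {w : Fin m → K}
    (h : HasShape p P a b W v w) : v ≠ 0 := by
  rintro rfl
  refine h.pureX ?_
  have : (Sum.elim 0 0 : Fin n ⊕ Fin m → K) = 0 := by ext i; rcases i with i | i <;> rfl
  rw [this, h.top.aeval_zero h.W_pos]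

/-- Descent from the translated polynomial ring. -/
theorem exists_dvd_of_shiftXY_dvd {p : PolyXY K n m} {v : Fin n → K} (hv : v ≠ 0) {w : Fin m → K}
    {u : (MvPolynomial (Fin n) K)[X]} (hu : u.Monic) {θ : K} {z : (MvPolynomial (Fin m) K)[X]}
    (h : shiftXY v w p ∣ C (u.map (inclX K n m : MvPolynomial (Fin n) K →+* PolyXY K n m)) -
        C (C (MvPolynomial.C θ)) * z.map
          ((C : PolyXY K n m →+* _).comp (inclY K n m : MvPolynomial (Fin m) K →+* PolyXY K n m))) :
    ∃ (f : MvPolynomial (Fin n) K) (g : MvPolynomial (Fin m) K),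
      p ∣ inclX K n m f - inclY K n m g ∧ (shiftHom v f).natDegree = u.natDegree := by
  obtain ⟨l, hl⟩ := exists_linear_form hv
  set τX : MvPolynomial (Fin n) K →ₐ[K] MvPolynomial (Fin n) K :=
    MvPolynomial.aeval fun i => MvPolynomial.X i - MvPolynomial.C (v i) * l with hτX
  set τ : PolyXY K n m →ₐ[K] PolyXY K n m := MvPolynomial.aeval (Sum.elim
    (fun i => inclX K n m (MvPolynomial.X i - MvPolynomial.C (v i) * l))
    (fun j => MvPolynomial.X (Sum.inr j))) with hτ
  -- The values `s = l` and `t = 0`, together with `x ↦ x - l v`, undo the translation; this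
  -- retraction moves the divisibility back to `𝕂[X, Y]` and keeps the two groups of variables
  -- apart.
  set ψ : (PolyXY K n m)[X][X] →+* PolyXY K n m :=
    eval₂RingHom (eval₂RingHom (τ : PolyXY K n m →+* PolyXY K n m) (inclX K n m l)) 0 with hψ
  have h1 : ψ.comp (shiftXY v w : PolyXY K n m →+* _) = RingHom.id _ := by
    refine MvPolynomial.ringHom_ext ?_ ?_
    · intro r
      simp [hψ, shiftXY, Polynomial.algebraMap_apply, hτ]
    · rintro (i | i)
      · simp [hψ, shiftXY, hτ, inclX]
      · simp [hψ, shiftXY, hτ]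
  have h2 : (τ : PolyXY K n m →+* PolyXY K n m).comp
      (inclX K n m : MvPolynomial (Fin n) K →+* PolyXY K n m)
      = (inclX K n m : MvPolynomial (Fin n) K →+* PolyXY K n m).comp (τX : _ →+* _) := by
    refine MvPolynomial.ringHom_ext ?_ ?_
    · intro r; simp [hτ, hτX, inclX]
    · intro i; simp [hτ, hτX, inclX]
  have h3 : ∀ g, τ (inclY K n m g) = inclY K n m g := by
    intro g
    have : τ.comp (inclY K n m) = inclY K n m := by
      ext j : 1
      simp [hτ, inclY]
    exact DFunLike.congr_fun this g
  refine ⟨u.eval₂ (τX : _ →+* _) l, MvPolynomial.C θ * z.coeff 0, ?_, ?_⟩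
  · have := map_dvd_map_sub_map (R := (PolyXY K n m)[X][X]) ψ h
    rw [show ψ (shiftXY v w p) = p from DFunLike.congr_fun h1 p, map_mul] at this
    convert this using 2
    · rw [hψ, coe_eval₂RingHom, eval₂_C, coe_eval₂RingHom, eval₂_map, h2,
        show inclX K n m (eval₂ (τX : _ →+* _) l u)
          = (inclX K n m : MvPolynomial (Fin n) K →+* PolyXY K n m) (eval₂ (τX : _ →+* _) l u)
          from rfl, hom_eval₂]
      rfl
    · rw [map_mul]
      congr 1
      · simp [hψ, inclY, hτ]
      · rw [hψ, coe_eval₂RingHom, eval₂_map, eval₂_at_zero]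
        simp [h3]
  -- The elements `x - l v` are invariant under translation along `v`. Hence translating the new `f`
  -- only shifts the argument of `u` by `l`, which keeps the degree.
  · have h4 : (shiftHom v : MvPolynomial (Fin n) K →+* _).comp
          (τX : MvPolynomial (Fin n) K →+* MvPolynomial (Fin n) K)
        = (C : MvPolynomial (Fin n) K →+* _).comp
          (τX : MvPolynomial (Fin n) K →+* MvPolynomial (Fin n) K) := by
      refine MvPolynomial.ringHom_ext ?_ ?_
      · intro r; simp [shiftHom, hτX, Polynomial.algebraMap_apply]
      · intro i
        have e : shiftHom v (MvPolynomial.C (v i)) = C (MvPolynomial.C (v i)) :=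
          (shiftHom v).commutes _
        have e2 : shiftHom v (MvPolynomial.X i)
            = C (MvPolynomial.X i) + C (MvPolynomial.C (v i)) * X := by simp [shiftHom]
        simp only [RingHom.comp_apply, RingHom.coe_coe, hτX, MvPolynomial.aeval_X, map_sub, map_mul,
          hl, e, e2]
        ring
    have h5 : shiftHom v (u.eval₂ (τX : _ →+* _) l)
        = (u.map (τX : _ →+* _)).comp (X + C l) := by
      rw [show shiftHom v (u.eval₂ (τX : _ →+* _) l)
        = (shiftHom v : MvPolynomial (Fin n) K →+* _) (u.eval₂ (τX : _ →+* _) l) from rfl,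
        hom_eval₂, h4, Polynomial.comp, eval₂_map]
      congr 1
    rw [h5, natDegree_comp, natDegree_X_add_C, mul_one, hu.natDegree_map]

/-- On the plane a form of degree `N` in `X` is its value at `v` times `s ^ N`, and likewise for
`Y`; both values are nonzero, so the relation between top forms can be normalized. -/
theorem HasShape.planeHom_dvd {p P : PolyXY K n m} {a b W : ℕ} {v : Fin n → K} {w : Fin m → K}
    (h : HasShape p P a b W v w) {f : MvPolynomial (Fin n) K} {g : MvPolynomial (Fin m) K}
    (hfg : p ∣ inclX K n m f - inclY K n m g) (h0 : 0 < f.totalDegree) :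
    ∃ γ : K, γ ≠ 0 ∧ γ = MvPolynomial.aeval w (g.homogeneousComponent g.totalDegree)
        / MvPolynomial.aeval v (f.homogeneousComponent f.totalDegree) ∧
      planeHom K v w P ∣ C X ^ f.totalDegree - C (C γ) * X ^ g.totalDegree := by
  obtain ⟨-, -, -, h4, h5, h6⟩ := h.regular hfg (Or.inl h0)
  refine ⟨_, div_ne_zero h6 h5, rfl, ?_⟩
  have := map_dvd (planeHom K v w) h4
  rw [map_sub, planeHom_inclX v w (MvPolynomial.homogeneousComponent_isHomogeneous _ _),
    planeHom_inclY v w (MvPolynomial.homogeneousComponent_isHomogeneous _ _)] at this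
  set c := MvPolynomial.aeval v (f.homogeneousComponent f.totalDegree)
  set c' := MvPolynomial.aeval w (g.homogeneousComponent g.totalDegree)
  have e : (C X ^ f.totalDegree - C (C (c' / c)) * X ^ g.totalDegree : K[X][X])
      = C (C c⁻¹) * (C (C c) * C X ^ f.totalDegree - C (C c') * X ^ g.totalDegree) := by
    rw [mul_sub, ← mul_assoc, ← mul_assoc, ← C_mul, ← C_mul, ← C_mul, ← C_mul, inv_mul_cancel₀ h5,
      C_1, C_1, one_mul, div_eq_inv_mul]
  rw [e]
  exact Dvd.dvd.mul_left this _

/-- If the top form divides `s ^ d - θ t ^ d'`, and there is a nonconstant separated multiple, then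
there is one of degrees `d` and `d'`. -/
theorem HasShape.exists_of_planeHom_dvd [CharZero K] {p P : PolyXY K n m} {a b W : ℕ}
    {v : Fin n → K} {w : Fin m → K} (h : HasShape p P a b W v w)
    {f : MvPolynomial (Fin n) K} {g : MvPolynomial (Fin m) K}
    (hfg : p ∣ inclX K n m f - inclY K n m g) (h0 : 0 < f.totalDegree) {d d' : ℕ} (hd : 0 < d)
    (hdd : a * d = b * d') {θ : K} (hθ : planeHom K v w P ∣ C X ^ d - C (C θ) * X ^ d') :
    ∃ (f' : MvPolynomial (Fin n) K) (g' : MvPolynomial (Fin m) K),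
      p ∣ inclX K n m f' - inclY K n m g' ∧ f'.totalDegree = d ∧ g'.totalDegree = d' := by
  obtain ⟨h1, -, h3, h4, h5, h6⟩ := h.regular hfg (Or.inl h0)
  obtain ⟨γ, hγ0, hγ, hγd⟩ := h.planeHom_dvd hfg h0
  set c := MvPolynomial.aeval v (f.homogeneousComponent f.totalDegree)
  set c' := MvPolynomial.aeval w (g.homogeneousComponent g.totalDegree)
  set N := f.totalDegree with hN
  set M := g.totalDegree with hM
  have hNM : M * d = d' * N := by
    have ha := h.a_pos
    have hb := h.b_pos
    have : b * (M * d) = b * (d' * N) := by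
      rw [← mul_assoc, ← h1, ← mul_assoc, ← hdd]; ring
    exact Nat.eq_of_mul_eq_mul_left hb this
  -- Modulo the restricted `P`, the same power of `s` is congruent to both constants times the same
  -- power of `t`. That power cancels, and `P` is not a unit, so the constants agree.
  have hθN : θ ^ N = γ ^ d := by
    by_contra hne
    have e1 := hγd.trans (sub_dvd_pow_sub_pow _ _ d)
    have e2 := hθ.trans (sub_dvd_pow_sub_pow _ _ N)
    have e3 := dvd_sub e1 e2
    rw [mul_pow, mul_pow, ← pow_mul, ← pow_mul, ← pow_mul, ← pow_mul, hNM, mul_comm d N,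
      sub_sub_sub_cancel_left, ← C_pow, ← C_pow, ← C_pow, ← C_pow, ← sub_mul, ← C_sub,
      ← C_sub] at e3
    have e4 := h.dvd_of_dvd_mul_t (A := K) e3
    refine h.not_isUnit_planeHom (A := K) (isUnit_of_dvd_unit e4 ?_)
    exact ((IsUnit.mk0 _ (sub_ne_zero.2 hne)).map C).map C
  -- The `d`-th powers have degrees `d * N` and `d' * N`, so approximate `N`-th roots of them have
  -- the required degrees `d` and `d'`.
  set f1 := (MvPolynomial.C c⁻¹ * f) ^ d with hf1
  set g1 := (MvPolynomial.C c'⁻¹ * g) ^ d with hg1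
  have hmon : ∀ {σ : Type} (x : σ → K) (q : MvPolynomial σ K)
      (hq : MvPolynomial.aeval x (q.homogeneousComponent q.totalDegree) ≠ 0),
      (shiftHom x (MvPolynomial.C (MvPolynomial.aeval x
        (q.homogeneousComponent q.totalDegree))⁻¹ * q)).Monic ∧
      (shiftHom x (MvPolynomial.C (MvPolynomial.aeval x
        (q.homogeneousComponent q.totalDegree))⁻¹ * q)).natDegree = q.totalDegree := by
    intro σ x q hq
    obtain ⟨e1, e2⟩ := shiftHom_spec x q
    set r := MvPolynomial.aeval x (q.homogeneousComponent q.totalDegree)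
    have e3 : shiftHom x (MvPolynomial.C r⁻¹ * q) = C (MvPolynomial.C r⁻¹) * shiftHom x q := by
      rw [map_mul]; congr 1; exact (shiftHom x).commutes _
    have e4 : (shiftHom x (MvPolynomial.C r⁻¹ * q)).natDegree ≤ q.totalDegree := by
      rw [e3]; exact (natDegree_C_mul_le _ _).trans e1
    have e5 : (shiftHom x (MvPolynomial.C r⁻¹ * q)).coeff q.totalDegree = 1 := by
      rw [e3, coeff_C_mul, e2, ← MvPolynomial.C_mul, inv_mul_cancel₀ hq, MvPolynomial.C_1]
    exact ⟨monic_of_natDegree_le_of_coeff_eq_one _ e4 e5,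
      natDegree_eq_of_le_of_coeff_ne_zero e4 (by rw [e5]; exact one_ne_zero)⟩
  obtain ⟨hF, hFd⟩ := hmon v f h5
  obtain ⟨hG, hGd⟩ := hmon w g h6
  have key := h.exists_monic_dvd_sub (q := N) (d := d) (d' := d') h0 hdd
    (F := shiftHom v f1) (G := shiftHom w g1) (θ := θ)
    (by rw [hf1, map_pow]; exact hF.pow d)
    (by rw [hf1, map_pow, hF.natDegree_pow, hFd])
    (by rw [hg1, map_pow]; exact hG.pow d)
    (by rw [hg1, map_pow, hG.natDegree_pow, hGd, ← hNM, mul_comm]) hθ (by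
      rw [← shiftXY_inclX v w, ← shiftXY_inclY v w, hθN]
      have e : (C (C (MvPolynomial.C (γ ^ d))) : (PolyXY K n m)[X][X])
          = shiftXY v w (inclY K n m (MvPolynomial.C (γ ^ d))) := by
        rw [show inclY K n m (MvPolynomial.C (γ ^ d)) = algebraMap K _ (γ ^ d) from
          (inclY K n m).commutes _, (shiftXY v w).commutes]
        rfl
      rw [e, ← map_mul, ← map_mul]
      refine shiftXY_dvd_sub v w ?_
      have e1 : inclX K n m f1 = (inclX K n m (MvPolynomial.C c⁻¹)) ^ d * (inclX K n m f) ^ d := by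
        rw [hf1, map_pow, map_mul, mul_pow]
      have e2 : inclY K n m (MvPolynomial.C (γ ^ d) * g1)
          = (inclX K n m (MvPolynomial.C c⁻¹)) ^ d * (inclY K n m g) ^ d := by
        rw [hg1, MvPolynomial.C_pow, ← mul_pow, ← mul_assoc, ← MvPolynomial.C_mul, map_pow, map_mul,
          mul_pow, hγ]
        congr 2
        rw [show c' / c * c'⁻¹ = c⁻¹ by field_simp]
        simp [inclX, inclY]
      rw [e1, e2, ← mul_sub]
      exact Dvd.dvd.mul_left (hfg.trans (sub_dvd_pow_sub_pow _ _ _)) _)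
  obtain ⟨u, z, hu, hud, huz⟩ := key
  obtain ⟨f', g', hfg', hdeg⟩ := exists_dvd_of_shiftXY_dvd h.v_ne_zero hu huz
  have hs := shiftHom_spec v f'
  have hpos : 0 < f'.totalDegree := by
    have := hs.1; omega
  obtain ⟨r1, -, -, -, r5, -⟩ := h.regular hfg' (Or.inl hpos)
  -- The degree along `v` is the total degree, since the top form does not vanish at `v`.
  have hf'd : f'.totalDegree = d := by
    rw [← hud, ← hdeg]
    refine (natDegree_eq_of_le_of_coeff_ne_zero hs.1 ?_).symm
    rw [hs.2]
    exact fun h0 => r5 (MvPolynomial.C_injective _ _ (by rw [h0, MvPolynomial.C_0]))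
  refine ⟨f', g', hfg', hf'd, ?_⟩
  rw [hf'd, hdd] at r1
  exact (Nat.eq_of_mul_eq_mul_left h.b_pos r1).symm


/-! ### A single generator for polynomials with pure top terms. -/

section Shape

variable {K : Type*} [Field K] {n m : ℕ}
variable {p P : PolyXY K n m} {a b W : ℕ} {v : Fin n → K} {w : Fin m → K}

/-- A unit would divide `x_i - 0`, whose degrees are not balanced. -/
theorem HasShape.not_isUnit (h : HasShape p P a b W v w) : ¬ IsUnit p := by
  intro hp
  obtain ⟨i, -⟩ := Function.ne_iff.1 h.v_ne_zero
  have h1 : (MvPolynomial.X i : MvPolynomial (Fin n) K).totalDegree = 1 :=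
    MvPolynomial.totalDegree_X i
  have := (h.regular (f := MvPolynomial.X i) (g := 0) (hp.dvd) (Or.inl (by omega))).2.2.1
  simp at this

theorem HasShape.eq_C_of_totalDegree_eq_zero (h : HasShape p P a b W v w)
    {f : MvPolynomial (Fin n) K} {g : MvPolynomial (Fin m) K}
    (hfg : p ∣ inclX K n m f - inclY K n m g) (h0 : f.totalDegree = 0) :
    ∃ c : K, f = MvPolynomial.C c ∧ g = MvPolynomial.C c := by
  have h0' : g.totalDegree = 0 := by
    by_contra hg
    have := (h.regular hfg (Or.inr (Nat.pos_of_ne_zero hg))).2.1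
    omega
  rw [MvPolynomial.totalDegree_eq_zero_iff_eq_C] at h0 h0'
  refine ⟨_, h0, ?_⟩
  by_contra hne
  rw [h0'] at hne
  have hne' : f.coeff 0 - g.coeff 0 ≠ 0 := fun e => hne (by rw [sub_eq_zero.1 e])
  refine h.not_isUnit (isUnit_of_dvd_unit hfg ?_)
  rw [h0, h0']
  have e : inclX K n m (MvPolynomial.C (f.coeff 0)) - inclY K n m (MvPolynomial.C (g.coeff 0))
      = MvPolynomial.C (f.coeff 0 - g.coeff 0) := by
    simp [inclX, inclY]
  rw [e]
  exact (IsUnit.mk0 _ hne').map MvPolynomial.C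

/-- Take the quotient of the values of the two top forms at `v`. If the degree did not drop, then
the top form of the difference, which again belongs to a separated pair, would vanish at `v`. -/
theorem HasShape.exists_sub_totalDegree_lt (h : HasShape p P a b W v w)
    {f f' : MvPolynomial (Fin n) K} {g g' : MvPolynomial (Fin m) K}
    (hfg : p ∣ inclX K n m f - inclY K n m g) (hfg' : p ∣ inclX K n m f' - inclY K n m g')
    (h0 : 0 < f.totalDegree) (hdeg : f'.totalDegree = f.totalDegree) :
    ∃ c : K, (f - MvPolynomial.C c * f').totalDegree < f.totalDegree := by
  set c := MvPolynomial.aeval v (f.homogeneousComponent f.totalDegree)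
    / MvPolynomial.aeval v (f'.homogeneousComponent f.totalDegree) with hc
  have h5 := (h.regular hfg' (Or.inl (by omega))).2.2.2.2.1
  rw [hdeg] at h5
  refine ⟨c, lt_of_le_of_ne ?_ fun heq => ?_⟩
  · refine (MvPolynomial.totalDegree_sub _ _).trans (max_le le_rfl ?_)
    rw [MvPolynomial.C_mul']
    exact (MvPolynomial.totalDegree_smul_le _ _).trans hdeg.le
  · have hs : p ∣ inclX K n m (f - MvPolynomial.C c * f')
        - inclY K n m (g - MvPolynomial.C c * g') := by
      have e : inclX K n m (f - MvPolynomial.C c * f')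
        - inclY K n m (g - MvPolynomial.C c * g') = (inclX K n m f - inclY K n m g)
          - MvPolynomial.C c * (inclX K n m f' - inclY K n m g') := by
        rw [map_sub, map_sub, map_mul, map_mul]
        simp only [inclX, inclY, MvPolynomial.rename_C]
        ring
      rw [e]
      exact dvd_sub hfg (Dvd.dvd.mul_left hfg' _)
    have := (h.regular hs (Or.inl (by omega))).2.2.2.2.1
    rw [heq, map_sub, MvPolynomial.homogeneousComponent_C_mul, map_sub, map_mul,
      MvPolynomial.aeval_C, Algebra.algebraMap_self_apply, hc, div_mul_cancel₀ _ h5] at this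
    exact this (sub_self _)

theorem totalDegree_pow_of_isDomain {σ : Type*} {f : MvPolynomial σ K} (hf : f ≠ 0) (k : ℕ) :
    (f ^ k).totalDegree = k * f.totalDegree := by
  induction k with
  | zero => simp
  | succ k ih =>
    rw [pow_succ, MvPolynomial.totalDegree_mul_of_isDomain (pow_ne_zero _ hf) hf, ih]
    ring

/-- The exponents `e` with `P ∣ s ^ e - θ t ^ e'` are multiples of the smallest degree of a
separated multiple. -/
theorem HasShape.dvd_of_planeHom_dvd [CharZero K] (h : HasShape p P a b W v w)
    {f₀ : MvPolynomial (Fin n) K} {g₀ : MvPolynomial (Fin m) K}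
    (hfg₀ : p ∣ inclX K n m f₀ - inclY K n m g₀) (h0 : 0 < f₀.totalDegree)
    (hmin : ∀ f g, p ∣ inclX K n m f - inclY K n m g → 0 < f.totalDegree →
      f₀.totalDegree ≤ f.totalDegree) (e : ℕ) :
    ∀ e' : ℕ, a * e = b * e' → ∀ θ : K,
      planeHom K v w P ∣ C X ^ e - C (C θ) * X ^ e' → f₀.totalDegree ∣ e := by
  induction e using Nat.strong_induction_on with
  | _ e ih =>
    intro e' hee θ hθ
    rcases Nat.eq_zero_or_pos e with rfl | he
    · exact dvd_zero _
    -- The exponent is realized by a pair, so it is not below the minimum.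
    have hle : f₀.totalDegree ≤ e := by
      obtain ⟨f, g, hfg, hd, -⟩ := h.exists_of_planeHom_dvd hfg₀ h0 he hee hθ
      have := hmin f g hfg (by omega)
      omega
    obtain ⟨γ, hγ0, -, hγ⟩ := h.planeHom_dvd hfg₀ h0
    have hreg := (h.regular hfg₀ (Or.inl h0)).1
    set N := f₀.totalDegree
    set M := g₀.totalDegree
    have hMe : M ≤ e' := by
      have : b * M ≤ b * e' := by rw [← hreg, ← hee]; exact Nat.mul_le_mul_left _ hle
      exact Nat.le_of_mul_le_mul_left this h.b_pos
    obtain ⟨k, rfl⟩ := Nat.exists_eq_add_of_le hle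
    obtain ⟨k', rfl⟩ := Nat.exists_eq_add_of_le hMe
    have hkk : a * k = b * k' := by
      rw [mul_add, mul_add, hreg] at hee; omega
    -- Euclid's step: subtract `s ^ k` times the relation of the minimal pair. A factor `t ^ M`
    -- splits off and cancels, which leaves a relation with exponent `k`.
    have hd : planeHom K v w P ∣ C (C γ) * (C X ^ k - C (C (θ / γ)) * X ^ k') * X ^ M := by
      have e1 : (C (C γ) * (C X ^ k - C (C (θ / γ)) * X ^ k') * X ^ M : K[X][X])
          = (C X ^ (N + k) - C (C θ) * X ^ (M + k')) - (C X ^ N - C (C γ) * X ^ M) * C X ^ k := by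
        have e2 : (C (C θ) : K[X][X]) = C (C γ) * C (C (θ / γ)) := by
          rw [← C_mul, ← C_mul, mul_div_cancel₀ _ hγ0]
        rw [e2]
        ring
      rw [e1]
      exact dvd_sub hθ (Dvd.dvd.mul_right hγ _)
    have hd2 : planeHom K v w P ∣ C (C γ) * (C X ^ k - C (C (θ / γ)) * X ^ k') :=
      h.dvd_of_dvd_mul_t (A := K) hd
    have hd3 : planeHom K v w P ∣ C X ^ k - C (C (θ / γ)) * X ^ k' := by
      have := Dvd.dvd.mul_left hd2 (C (C γ⁻¹))
      rwa [← mul_assoc, ← C_mul, ← C_mul, inv_mul_cancel₀ hγ0, C_1, C_1, one_mul] at this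
    exact (Nat.dvd_add_right (dvd_refl N)).2 (ih k (by omega) k' hkk _ hd3)

theorem mem_separatedAlgebra_span' {f : MvPolynomial (Fin n) K} {g : MvPolynomial (Fin m) K} :
    (f, g) ∈ separatedAlgebra (Ideal.span {p}) ↔ p ∣ inclX K n m f - inclY K n m g :=
  mem_separatedAlgebra_span

/-- The separated algebra of a polynomial with pure top terms has at most one generator. -/
theorem HasShape.exists_generator [CharZero K] (h : HasShape p P a b W v w) :
    separatedAlgebra (Ideal.span {p}) = ⊥ ∨
    ∃ t ∈ separatedAlgebra (Ideal.span {p}),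
      separatedAlgebra (Ideal.span {p}) = Algebra.adjoin K {t} := by
  classical
  by_cases hex : ∃ N, 0 < N ∧ ∃ f g, p ∣ inclX K n m f - inclY K n m g ∧ f.totalDegree = N
  · right
    obtain ⟨h0, f₀, g₀, hfg₀, hN⟩ := Nat.find_spec hex
    have hmin' : ∀ f g, p ∣ inclX K n m f - inclY K n m g → 0 < f.totalDegree →
        Nat.find hex ≤ f.totalDegree := fun f g hfg hpos =>
      Nat.find_min' hex ⟨hpos, f, g, hfg, rfl⟩
    rw [← hN] at h0 hmin'
    have hmem : (f₀, g₀) ∈ separatedAlgebra (Ideal.span {p}) := mem_separatedAlgebra_span'.2 hfg₀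
    refine ⟨(f₀, g₀), hmem, le_antisymm ?_ (Algebra.adjoin_le (Set.singleton_subset_iff.2 hmem))⟩
    suffices hs : ∀ (k : ℕ) (f : MvPolynomial (Fin n) K) (g : MvPolynomial (Fin m) K),
        p ∣ inclX K n m f - inclY K n m g → f.totalDegree = k →
        (f, g) ∈ Algebra.adjoin K {(f₀, g₀)} by
      rintro ⟨f, g⟩ hfg
      exact hs _ f g (mem_separatedAlgebra_span'.1 hfg) rfl
    intro k
    induction k using Nat.strong_induction_on with
    | _ k ih =>
      intro f g hfg hk
      rcases Nat.eq_zero_or_pos f.totalDegree with hz | hpos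
      · obtain ⟨c, rfl, rfl⟩ := h.eq_C_of_totalDegree_eq_zero hfg hz
        exact Subalgebra.algebraMap_mem _ c
      · obtain ⟨θ, -, -, hθ⟩ := h.planeHom_dvd hfg hpos
        obtain ⟨j, hj⟩ := h.dvd_of_planeHom_dvd hfg₀ h0 hmin' _ _
          (h.regular hfg (Or.inl hpos)).1 _ hθ
        have hf₀ : f₀ ≠ 0 := by rintro rfl; simp at h0
        have hpow : p ∣ inclX K n m (f₀ ^ j) - inclY K n m (g₀ ^ j) :=
          mem_separatedAlgebra_span'.1 (pow_mem hmem j)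
        -- The degree of `f` is `j` times the minimal one, so a multiple of the `j`-th power of the
        -- minimal pair lowers it.
        obtain ⟨c, hc⟩ := h.exists_sub_totalDegree_lt hfg hpow hpos (by
          rw [totalDegree_pow_of_isDomain hf₀, hj, mul_comm])
        have hmemj : (f₀ ^ j, g₀ ^ j) ∈ Algebra.adjoin K {(f₀, g₀)} :=
          pow_mem (Algebra.self_mem_adjoin_singleton K (f₀, g₀)) j
        have e1 : ((f, g) : MvPolynomial (Fin n) K × MvPolynomial (Fin m) K)
            = (f - MvPolynomial.C c * f₀ ^ j, g - MvPolynomial.C c * g₀ ^ j)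
              + c • (f₀ ^ j, g₀ ^ j) := by
          rw [MvPolynomial.C_mul', MvPolynomial.C_mul', Prod.smul_mk, Prod.mk_add_mk,
            sub_add_cancel, sub_add_cancel]
        have e2 : (f - MvPolynomial.C c * f₀ ^ j, g - MvPolynomial.C c * g₀ ^ j)
            = (f, g) - c • (f₀ ^ j, g₀ ^ j) := eq_sub_of_add_eq e1.symm
        rw [e1]
        refine add_mem (ih _ (hk ▸ hc) _ _ ?_ rfl) (Subalgebra.smul_mem _ hmemj c)
        refine mem_separatedAlgebra_span'.1 ?_
        rw [e2]
        exact sub_mem (mem_separatedAlgebra_span'.2 hfg) (Subalgebra.smul_mem _ (pow_mem hmem j) c)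
  · left
    rw [eq_bot_iff]
    rintro ⟨f, g⟩ hfg
    rw [mem_separatedAlgebra_span'] at hfg
    have hz : f.totalDegree = 0 := by
      by_contra hne
      exact hex ⟨_, Nat.pos_of_ne_zero hne, f, g, hfg, rfl⟩
    obtain ⟨c, rfl, rfl⟩ := h.eq_C_of_totalDegree_eq_zero hfg hz
    exact Subalgebra.algebraMap_mem _ c

end Shape

/-! ### Principal ideals in general. -/

section Existence

variable {K : Type*} [Field K] {n m : ℕ}

/-- As a polynomial in `Y` over `𝕂[X]`, a divisor of a nonzero element of degree zero has degree
zero. -/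
theorem eq_inclX_of_dvd {q : PolyXY K n m} {f : MvPolynomial (Fin n) K} (hf : f ≠ 0)
    (h : q ∣ inclX K n m f) : q ∈ (inclX K n m).range := by
  set φ : PolyXY K n m →ₐ[K] MvPolynomial (Fin m) (MvPolynomial (Fin n) K) :=
    MvPolynomial.aeval (Sum.elim (fun i => MvPolynomial.C (MvPolynomial.X i)) MvPolynomial.X)
    with hφ
  set ψ : MvPolynomial (Fin m) (MvPolynomial (Fin n) K) →+* PolyXY K n m :=
    MvPolynomial.eval₂Hom (inclX K n m : MvPolynomial (Fin n) K →+* PolyXY K n m)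
      (fun j => MvPolynomial.X (Sum.inr j)) with hψ
  have h1 : ψ.comp (φ : PolyXY K n m →+* _) = RingHom.id _ := by
    refine MvPolynomial.ringHom_ext ?_ ?_
    · intro r
      rw [RingHom.comp_apply, RingHom.coe_coe, ← MvPolynomial.algebraMap_eq, φ.commutes]
      simp [hψ, MvPolynomial.algebraMap_apply, inclX]
    · rintro (i | i) <;> simp [hφ, hψ, inclX]
  have h2 : φ (inclX K n m f) = MvPolynomial.C f := by
    have : (φ.comp (inclX K n m)).toRingHom = MvPolynomial.C := by
      refine MvPolynomial.ringHom_ext ?_ ?_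
      · intro r
        exact (φ.comp (inclX K n m)).commutes r
      · intro i; simp [hφ, inclX]
    exact DFunLike.congr_fun this f
  obtain ⟨k, hk⟩ := map_dvd φ h
  rw [h2] at hk
  have hne : MvPolynomial.C f ≠ (0 : MvPolynomial (Fin m) (MvPolynomial (Fin n) K)) :=
    fun e => hf (MvPolynomial.C_injective _ _ (by rw [e, MvPolynomial.C_0]))
  have hq : φ q ≠ 0 := by intro e; rw [e, zero_mul] at hk; exact hne hk
  have hk0 : k ≠ 0 := by rintro rfl; rw [mul_zero] at hk; exact hne hk
  have hd := congrArg MvPolynomial.totalDegree hk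
  rw [MvPolynomial.totalDegree_C, MvPolynomial.totalDegree_mul_of_isDomain hq hk0] at hd
  have hz : (φ q).totalDegree = 0 := by omega
  rw [MvPolynomial.totalDegree_eq_zero_iff_eq_C] at hz
  have h3 : ψ (φ q) = q := DFunLike.congr_fun h1 q
  rw [hz] at h3
  exact ⟨(φ q).coeff 0, Eq.trans (by simp [hψ]) h3⟩

/-- Exchange of the two groups of variables. -/
noncomputable def swapXY (K : Type*) [Field K] (n m : ℕ) : PolyXY K n m ≃ₐ[K] PolyXY K m n :=
  MvPolynomial.renameEquiv K (Equiv.sumComm _ _)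

theorem swapXY_inclY (g : MvPolynomial (Fin m) K) :
    swapXY K n m (inclY K n m g) = inclX K m n g := by
  simp only [swapXY, inclY, inclX, MvPolynomial.renameEquiv_apply, MvPolynomial.rename_rename]
  rfl

theorem eq_inclY_of_dvd {q : PolyXY K n m} {g : MvPolynomial (Fin m) K} (hg : g ≠ 0)
    (h : q ∣ inclY K n m g) : q ∈ (inclY K n m).range := by
  have := map_dvd (swapXY K n m) h
  rw [swapXY_inclY] at this
  obtain ⟨r, hr⟩ := eq_inclX_of_dvd hg this
  refine ⟨r, (swapXY K n m).injective ?_⟩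
  exact (swapXY_inclY r).trans hr

theorem exists_aeval_ne_zero [Infinite K] {σ : Type*} {f : MvPolynomial σ K} (hf : f ≠ 0) :
    ∃ v : σ → K, MvPolynomial.aeval v f ≠ 0 := by
  by_contra! hall
  refine hf (MvPolynomial.funext fun v => ?_)
  have := hall v
  rw [MvPolynomial.aeval_eq_eval] at this
  rw [map_zero]
  exact this

theorem isTopForm_weightedHomogeneousComponent {σ : Type*} (wt : σ → ℕ) (q : MvPolynomial σ K) :
    IsTopForm wt q (MvPolynomial.weightedHomogeneousComponent wt
      (MvPolynomial.weightedTotalDegree wt q) q) (MvPolynomial.weightedTotalDegree wt q) := by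
  classical
  refine ⟨MvPolynomial.weightedHomogeneousComponent_isWeightedHomogeneous _ _, fun e he => ?_⟩
  rw [MvPolynomial.mem_support_iff, MvPolynomial.coeff_sub,
    MvPolynomial.coeff_weightedHomogeneousComponent] at he
  have hne : Finsupp.weight wt e ≠ MvPolynomial.weightedTotalDegree wt q := by
    intro h
    rw [if_pos h, sub_self] at he
    exact he rfl
  rw [if_neg hne, sub_zero] at he
  exact lt_of_le_of_ne (MvPolynomial.le_weightedTotalDegree wt
    (MvPolynomial.mem_support_iff.2 he)) hne

theorem weightedHomogeneousComponent_weightedTotalDegree_ne_zero {σ : Type*} (wt : σ → ℕ)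
    {q : MvPolynomial σ K} (hq : q ≠ 0) : MvPolynomial.weightedHomogeneousComponent wt
      (MvPolynomial.weightedTotalDegree wt q) q ≠ 0 := by
  classical
  obtain ⟨e, he, hd⟩ := Finset.exists_mem_eq_sup q.support
    (MvPolynomial.support_nonempty.2 hq) (fun e => Finsupp.weight wt e)
  intro h
  have := congrArg (MvPolynomial.coeff e) h
  rw [MvPolynomial.coeff_weightedHomogeneousComponent, if_pos, MvPolynomial.coeff_zero] at this
  · exact MvPolynomial.mem_support_iff.1 he this
  · rw [MvPolynomial.weightedTotalDegree, hd]

/-- Nonconstant separated multiples are nonconstant in both groups of variables. -/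
theorem totalDegree_pos_of_dvd {p : PolyXY K n m} (hX : p ∉ (inclX K n m).range)
    (hY : p ∉ (inclY K n m).range) {f : MvPolynomial (Fin n) K} {g : MvPolynomial (Fin m) K}
    (hfg : p ∣ inclX K n m f - inclY K n m g) :
    (∃ c : K, f = MvPolynomial.C c ∧ g = MvPolynomial.C c) ∨
      (0 < f.totalDegree ∧ 0 < g.totalDegree) := by
  have hCX : ∀ c : K, inclX K n m (MvPolynomial.C c) = inclY K n m (MvPolynomial.C c) := by
    intro c; simp [inclX, inclY]
  rcases Nat.eq_zero_or_pos f.totalDegree with h0 | h0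
  · left
    rw [MvPolynomial.totalDegree_eq_zero_iff_eq_C] at h0
    refine ⟨f.coeff 0, h0, ?_⟩
    by_contra hne
    rw [h0, hCX, ← map_sub] at hfg
    exact hY (eq_inclY_of_dvd (sub_ne_zero.2 (Ne.symm hne)) hfg)
  rcases Nat.eq_zero_or_pos g.totalDegree with h1 | h1
  · left
    rw [MvPolynomial.totalDegree_eq_zero_iff_eq_C] at h1
    refine ⟨g.coeff 0, ?_, h1⟩
    by_contra hne
    rw [h1, ← hCX, ← map_sub] at hfg
    exact hX (eq_inclX_of_dvd (sub_ne_zero.2 hne) hfg)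
  exact Or.inr ⟨h0, h1⟩

/-- If there are nonconstant separated multiples, then the top form, for suitable weights, has
pure terms in `X` and in `Y`. -/
theorem exists_hasShape [Infinite K] {p : PolyXY K n m} (hX : p ∉ (inclX K n m).range)
    {f : MvPolynomial (Fin n) K} {g : MvPolynomial (Fin m) K}
    (hfg : p ∣ inclX K n m f - inclY K n m g)
    (hf : 0 < f.totalDegree) (hg : 0 < g.totalDegree) :
    ∃ P W v w, HasShape p P g.totalDegree f.totalDegree W v w := by
  set wt := weights n m g.totalDegree f.totalDegree with hwt
  have hp : p ≠ 0 := by rintro rfl; exact hX (zero_mem _)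
  have htop := isTopForm_weightedHomogeneousComponent wt p
  have hP0 := weightedHomogeneousComponent_weightedTotalDegree_ne_zero wt hp
  set W := MvPolynomial.weightedTotalDegree wt p with hW
  set P := MvPolynomial.weightedHomogeneousComponent wt W p with hP
  have hf0 : f ≠ 0 := by rintro rfl; simp at hf
  have hg0 : g ≠ 0 := by rintro rfl; simp at hg
  -- With these weights the top forms of `f` and `g` have the same weight, so only the balanced case
  -- remains.
  have hdvd : P ∣ inclX K n m (f.homogeneousComponent f.totalDegree)
      - inclY K n m (g.homogeneousComponent g.totalDegree) := by
    rcases topForm_dvd hg hf htop hP0 hfg (Or.inl hf) with ⟨h, -⟩ | ⟨h, -⟩ | ⟨-, -, -, h⟩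
    · exact absurd h (by rw [mul_comm]; exact lt_irrefl _)
    · exact absurd h (by rw [mul_comm]; exact lt_irrefl _)
    · exact h
  obtain ⟨v, hv⟩ := exists_aeval_ne_zero (homogeneousComponent_totalDegree_ne_zero hf0)
  obtain ⟨w, hw⟩ := exists_aeval_ne_zero (homogeneousComponent_totalDegree_ne_zero hg0)
  have hzero : ∀ {σ : Type} {q : MvPolynomial σ K}, 0 < q.totalDegree →
      MvPolynomial.aeval (0 : σ → K) (q.homogeneousComponent q.totalDegree) = 0 := by
    intro σ q hq
    exact (isTopForm_homogeneousComponent q one_pos).aeval_zero (by omega)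
  refine ⟨P, W, v, w, hg, hf, ?_, htop, fun h0 => ?_, fun h0 => ?_⟩
  -- Positive weights and `W = 0` would make `p` constant, hence an element of `𝕂[X]`.
  · by_contra hW0
    have hW0 : W = 0 := by omega
    refine hX ⟨MvPolynomial.C (p.coeff 0), ?_⟩
    have h1 := (MvPolynomial.weightedTotalDegree_eq_zero_iff (w := wt)
      (MvPolynomial.nonTorsionWeight_of (by
        rintro (i | i) <;> simp only [hwt, weights, Sum.elim_inl, Sum.elim_inr] <;> omega)) p).1 hW0
    have h2 : p.totalDegree = 0 := by
      rw [MvPolynomial.totalDegree_eq_zero_iff]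
      intro e he i
      exact h1 e he i
    rw [MvPolynomial.totalDegree_eq_zero_iff_eq_C] at h2
    conv_rhs => rw [h2]
    simp [inclX]
  · obtain ⟨k, hk⟩ := hdvd
    have := congrArg (MvPolynomial.aeval (Sum.elim v 0 : Fin n ⊕ Fin m → K)) hk
    rw [map_mul, h0, zero_mul, map_sub, inclX, inclY, MvPolynomial.aeval_rename,
      MvPolynomial.aeval_rename, Sum.elim_comp_inl, Sum.elim_comp_inr, hzero hg, sub_zero] at this
    exact hv this
  · obtain ⟨k, hk⟩ := hdvd
    have := congrArg (MvPolynomial.aeval (Sum.elim 0 w : Fin n ⊕ Fin m → K)) hk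
    rw [map_mul, h0, zero_mul, map_sub, inclX, inclY, MvPolynomial.aeval_rename,
      MvPolynomial.aeval_rename, Sum.elim_comp_inl, Sum.elim_comp_inr, hzero hf, zero_sub] at this
    exact hw (neg_eq_zero.1 this)

/-- The separated algebra of a polynomial in `X` and `Y` proper has at most one generator. -/
theorem separatedAlgebra_span_eq_adjoin [CharZero K] {p : PolyXY K n m}
    (hX : p ∉ (inclX K n m).range) (hY : p ∉ (inclY K n m).range) :
    ∃ t ∈ separatedAlgebra (Ideal.span {p}),
      separatedAlgebra (Ideal.span {p}) = Algebra.adjoin K {t} := by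
  by_cases hbot : separatedAlgebra (Ideal.span {p}) = ⊥
  · refine ⟨0, zero_mem _, ?_⟩
    rw [hbot, eq_comm, eq_bot_iff]
    exact Algebra.adjoin_le (Set.singleton_subset_iff.2 (zero_mem _))
  have : ∃ f g, p ∣ inclX K n m f - inclY K n m g ∧ 0 < f.totalDegree ∧ 0 < g.totalDegree := by
    by_contra! hall
    refine hbot (eq_bot_iff.2 ?_)
    rintro ⟨f, g⟩ hfg
    rw [mem_separatedAlgebra_span'] at hfg
    rcases totalDegree_pos_of_dvd hX hY hfg with ⟨c, rfl, rfl⟩ | ⟨h1, h2⟩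
    · exact Subalgebra.algebraMap_mem _ c
    · exact absurd h2 (by have := hall f g hfg h1; omega)
  obtain ⟨f, g, hfg, hf, hg⟩ := this
  obtain ⟨P, W, v, w, h⟩ := exists_hasShape hX hfg hf hg
  exact h.exists_generator.resolve_left hbot

end Existence

/-! ### Finite generation. -/

section FiniteGeneration

variable {K : Type*} [Field K]

/-- Fix an element `F` of positive degree. For every residue class modulo `deg F` that occurs among
the degrees, take an element `h r` of least degree in that class. Every degree in the class is then
that of some `h r * F ^ j`, so leading terms can be removed successively, and `F` with the finitely
many `h r` generate. -/
theorem fg_of_subalgebra_polynomial (B : Subalgebra K K[X]) : B.FG := by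
  classical
  by_cases hB : ∃ F ∈ B, 0 < F.natDegree
  · obtain ⟨F, hF, hd⟩ := hB
    have hex : ∀ r : ℕ, ∃ h ∈ B, ∀ x ∈ B, x ≠ 0 → x.natDegree % F.natDegree = r →
        h ≠ 0 ∧ h.natDegree ≤ x.natDegree ∧ h.natDegree % F.natDegree = r := by
      intro r
      by_cases hr : ∃ k, ∃ x ∈ B, x ≠ 0 ∧ x.natDegree % F.natDegree = r ∧ x.natDegree = k
      · obtain ⟨x, hx, hx0, hxr, hxk⟩ := Nat.find_spec hr
        refine ⟨x, hx, fun y hy hy0 hyr => ⟨hx0, ?_, hxr⟩⟩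
        rw [hxk]
        exact Nat.find_min' hr ⟨y, hy, hy0, hyr, rfl⟩
      -- Classes that do not occur get the harmless value `0`.
      · exact ⟨0, zero_mem _, fun x hx hx0 hxr => absurd ⟨_, x, hx, hx0, hxr, rfl⟩ hr⟩
    choose h hhB hh using hex
    refine ⟨insert F ((Finset.range F.natDegree).image h), le_antisymm ?_ ?_⟩
    · refine Algebra.adjoin_le ?_
      intro x hx
      simp only [Finset.coe_insert, Finset.coe_image, Set.mem_insert_iff, Set.mem_image] at hx
      rcases hx with rfl | ⟨r, -, rfl⟩
      · exact hF
      · exact hhB r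
    · set B' := Algebra.adjoin K
        (↑(insert F ((Finset.range F.natDegree).image h)) : Set K[X]) with hB'
      have hFB : F ∈ B' := Algebra.subset_adjoin (by simp)
      have hhB' : ∀ r < F.natDegree, h r ∈ B' := fun r hr => Algebra.subset_adjoin (by
        simp only [Finset.coe_insert, Finset.coe_image]
        exact Or.inr ⟨r, by simpa using hr, rfl⟩)
      suffices hs : ∀ (k : ℕ) (x : K[X]), x ∈ B → x.degree < (k : WithBot ℕ) → x ∈ B' by
        intro x hx
        exact hs (x.natDegree + 1) x hx (by
          exact lt_of_le_of_lt degree_le_natDegree (by exact_mod_cast Nat.lt_succ_self _))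
      intro k
      induction k with
      | zero =>
        intro x _ hx
        have : x = 0 := by
          rw [← degree_eq_bot]
          by_contra hne
          rw [degree_eq_natDegree (fun e => hne (by rw [e, degree_zero]))] at hx
          exact absurd hx (by simp)
        rw [this]; exact zero_mem _
      | succ k ih =>
        intro x hx hxk
        by_cases hx0 : x = 0
        · rw [hx0]; exact zero_mem _
        set r := x.natDegree % F.natDegree with hr
        obtain ⟨h1, h2, h3⟩ := hh r x hx hx0 rfl
        have hrd : r < F.natDegree := Nat.mod_lt _ hd
        obtain ⟨j, hj⟩ : F.natDegree ∣ x.natDegree - (h r).natDegree :=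
          (Nat.modEq_iff_dvd' h2).1 h3
        have hF0 : F ≠ 0 := by rintro rfl; simp at hd
        set y := h r * F ^ j with hy
        have hy0 : y ≠ 0 := mul_ne_zero h1 (pow_ne_zero _ hF0)
        have hyd : y.natDegree = x.natDegree := by
          rw [hy, natDegree_mul h1 (pow_ne_zero _ hF0), natDegree_pow, mul_comm, ← hj]
          omega
        have hyB' : y ∈ B' := mul_mem (hhB' r hrd) (pow_mem hFB j)
        have hyB : y ∈ B := mul_mem (hhB r) (pow_mem hF j)
        set c := x.leadingCoeff / y.leadingCoeff with hc
        have hlt : (x - c • y).degree < x.degree := by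
          refine degree_sub_lt_left ?_ hx0 ?_
          · have hc0 : c ≠ 0 := div_ne_zero (leadingCoeff_ne_zero.2 hx0) (leadingCoeff_ne_zero.2 hy0)
            rw [degree_smul_of_smul_regular _ (IsSMulRegular.of_ne_zero hc0),
              degree_eq_natDegree hx0, degree_eq_natDegree hy0, hyd]
          · rw [smul_eq_C_mul, leadingCoeff_mul, leadingCoeff_C, hc,
              div_mul_cancel₀ _ (leadingCoeff_ne_zero.2 hy0)]
        have hle : x.degree ≤ (k : WithBot ℕ) := by
          rw [degree_eq_natDegree hx0] at hxk ⊢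
          have : x.natDegree < k + 1 := by exact_mod_cast hxk
          exact_mod_cast Nat.lt_succ_iff.1 this
        have := ih (x - c • y) (sub_mem hx (B.smul_mem hyB c)) (lt_of_lt_of_le hlt hle)
        have e : x = (x - c • y) + c • y := by rw [sub_add_cancel]
        rw [e]
        exact add_mem this (B'.smul_mem hyB' c)
  · refine ⟨∅, le_antisymm ?_ ?_⟩
    · simp
    · intro x hx
      have h0 : x.natDegree = 0 := by
        by_contra hne
        exact hB ⟨x, hx, Nat.pos_of_ne_zero hne⟩
      rw [eq_C_of_natDegree_eq_zero h0]
      exact Subalgebra.algebraMap_mem _ _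

/-- Evaluation at `t` maps the preimage of `B` in `K[X]` onto `B`. -/
theorem fg_of_le_adjoin_singleton {R : Type*} [CommRing R] [Algebra K R] {B : Subalgebra K R} {t : R}
    (h : B ≤ Algebra.adjoin K {t}) : B.FG := by
  have e : B = (B.comap (aeval t : K[X] →ₐ[K] R)).map (aeval t) := by
    rw [Subalgebra.map_comap_eq, ← Algebra.adjoin_singleton_eq_range_aeval, inf_eq_left.2 h]
  rw [e]
  exact (fg_of_subalgebra_polynomial _).map _

theorem separatedAlgebra_mono {n m : ℕ} {I J : Ideal (PolyXY K n m)} (h : I ≤ J) :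
    separatedAlgebra I ≤ separatedAlgebra J := fun _ hfg => h hfg

theorem IsZeroDimInfPrincipal.fg_separatedAlgebra [CharZero K] {n m : ℕ}
    {I : Ideal (PolyXY K n m)} (h : IsZeroDimInfPrincipal I) : (separatedAlgebra I).FG := by
  obtain ⟨I₀, p, -, hX, hY, rfl⟩ := h
  obtain ⟨t, -, ht⟩ := separatedAlgebra_span_eq_adjoin hX hY
  exact fg_of_le_adjoin_singleton (t := t) (ht ▸ separatedAlgebra_mono inf_le_right)

end FiniteGeneration


/-! ### Top forms without pure terms. -/

section Mixed

variable {K : Type*} [Field K] {n m : ℕ}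

/-- Setting `Y = 0`. -/
noncomputable def restrictX (K : Type*) [Field K] (n m : ℕ) : PolyXY K n m →ₐ[K] MvPolynomial (Fin n) K :=
  MvPolynomial.aeval (Sum.elim MvPolynomial.X 0)

/-- Setting `X = 0`. -/
noncomputable def restrictY (K : Type*) [Field K] (n m : ℕ) : PolyXY K n m →ₐ[K] MvPolynomial (Fin m) K :=
  MvPolynomial.aeval (Sum.elim 0 MvPolynomial.X)

theorem restrictX_inclX (f : MvPolynomial (Fin n) K) : restrictX K n m (inclX K n m f) = f := by
  rw [restrictX, inclX, MvPolynomial.aeval_rename, Sum.elim_comp_inl, MvPolynomial.aeval_X_left_apply]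

theorem restrictY_inclY (f : MvPolynomial (Fin m) K) : restrictY K n m (inclY K n m f) = f := by
  rw [restrictY, inclY, MvPolynomial.aeval_rename, Sum.elim_comp_inr, MvPolynomial.aeval_X_left_apply]

theorem homogeneousComponent_coeff_zero {σ : Type*} {q : MvPolynomial σ K} (hq : 0 < q.totalDegree) :
    MvPolynomial.constantCoeff (q.homogeneousComponent q.totalDegree) = 0 := by
  rw [MvPolynomial.constantCoeff_eq, MvPolynomial.coeff_homogeneousComponent, if_neg]
  simp; omega

theorem restrictX_inclY (g : MvPolynomial (Fin m) K) :
    restrictX K n m (inclY K n m g) = MvPolynomial.C (MvPolynomial.constantCoeff g) := by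
  rw [restrictX, inclY, MvPolynomial.aeval_rename, Sum.elim_comp_inr, MvPolynomial.aeval_zero]
  rfl

/-- A polynomial whose top form has no pure terms has only constant separated multiples. -/
theorem separatedAlgebra_eq_bot_of_mixed {p P : PolyXY K n m} {a b W : ℕ} (ha : 0 < a) (hb : 0 < b)
    (h : IsTopForm (weights n m a b) p P W) (hP : P ≠ 0) (hX : restrictX K n m P = 0)
    (hY : restrictY K n m P = 0) : separatedAlgebra (Ideal.span {p}) = ⊥ := by
  have key : ∀ (f : MvPolynomial (Fin n) K) (g : MvPolynomial (Fin m) K),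
      p ∣ inclX K n m f - inclY K n m g → f.totalDegree = 0 ∧ g.totalDegree = 0 := by
    intro f g hfg
    by_contra hne
    have h0 : 0 < f.totalDegree ∨ 0 < g.totalDegree := by omega
    -- Setting one group of variables to zero kills `P`, but not the top form it would have to
    -- divide; in the balanced case the other top form disappears as it has no constant term.
    rcases topForm_dvd ha hb h hP hfg h0 with ⟨_, h1, h2⟩ | ⟨_, h1, h2⟩ | ⟨-, h1, h2, h3⟩
    · have := map_dvd (restrictX K n m) h2
      rw [hX, restrictX_inclX, zero_dvd_iff] at this
      exact homogeneousComponent_totalDegree_ne_zero h1 this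
    · have := map_dvd (restrictY K n m) h2
      rw [hY, restrictY_inclY, zero_dvd_iff] at this
      exact homogeneousComponent_totalDegree_ne_zero h1 this
    · have := map_dvd (restrictX K n m) h3
      rw [hX, zero_dvd_iff, map_sub, restrictX_inclX, restrictX_inclY,
        homogeneousComponent_coeff_zero h2, MvPolynomial.C_0, sub_zero] at this
      exact homogeneousComponent_totalDegree_ne_zero (by rintro rfl; simp at h1) this
  have hp : ¬ IsUnit p := by
    intro hp
    -- Without variables `X`, setting `X = 0` is injective, and `P` itself would vanish.
    rcases Nat.eq_zero_or_pos n with rfl | hn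
    · refine hP ?_
      have : Function.Injective (restrictY K 0 m) := by
        refine Function.LeftInverse.injective (g := inclY K 0 m) fun q => ?_
        have : (inclY K 0 m).comp (restrictY K 0 m) = AlgHom.id K _ := by
          ext i : 1
          rcases i with i | i
          · exact i.elim0
          · simp [restrictY, inclY]
        exact DFunLike.congr_fun this q
      exact this (hY.trans (map_zero _).symm)
    · have := (key (MvPolynomial.X ⟨0, hn⟩) 0 hp.dvd).1
      rw [MvPolynomial.totalDegree_X] at this
      omega
  rw [eq_bot_iff]
  rintro ⟨f, g⟩ hfg
  rw [mem_separatedAlgebra_span'] at hfg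
  obtain ⟨h1, h2⟩ := key f g hfg
  rw [MvPolynomial.totalDegree_eq_zero_iff_eq_C] at h1 h2
  rw [h1, h2] at hfg ⊢
  have e : inclX K n m (MvPolynomial.C (f.coeff 0)) - inclY K n m (MvPolynomial.C (g.coeff 0))
      = MvPolynomial.C (f.coeff 0 - g.coeff 0) := by
    simp [inclX, inclY]
  rw [e] at hfg
  have : f.coeff 0 - g.coeff 0 = 0 := by
    by_contra hne
    exact hp (isUnit_of_dvd_unit hfg ((IsUnit.mk0 _ hne).map MvPolynomial.C))
  rw [sub_eq_zero.1 this]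
  exact Subalgebra.algebraMap_mem _ _

end Mixed

/-! ### Univariate restrictions and binomials. -/

section Line

variable {K : Type*} [Field K] {n m : ℕ}

/-- Restriction to the affine line through `v` in the direction `w`. -/
noncomputable def lineU (v : Fin n → K) (w : Fin m → K) : PolyXY K n m →ₐ[K] K[X] :=
  MvPolynomial.aeval (Sum.elim (fun i => C (v i)) (fun j => C (w j) * X))

theorem eval_planeHom_eq_lineU (v : Fin n → K) (w : Fin m → K) (P : PolyXY K n m) :
    mapRingHom (evalRingHom (1 : K)) (planeHom K v w P) = lineU v w P := by
  have : ((mapRingHom (evalRingHom (1 : K))).comp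
      (planeHom K v w : PolyXY K n m →+* K[X][X])) = (lineU v w : PolyXY K n m →+* K[X]) := by
    refine MvPolynomial.ringHom_ext ?_ ?_
    · intro r
      simp [planeHom, lineU]
    · rintro (i | i) <;> simp [planeHom, lineU]
  exact DFunLike.congr_fun this P

variable {p P : PolyXY K n m} {a b W : ℕ} {v : Fin n → K} {w : Fin m → K}

/-- The plane relation of a nonconstant pair, read at `s = 1`. The divisibility is the source of all
univariate obstructions to nonconstant pairs. -/
theorem HasShape.exists_lineU_dvd (h : HasShape p P a b W v w)
    (hA : separatedAlgebra (Ideal.span {p}) ≠ ⊥) :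
    ∃ (f : MvPolynomial (Fin n) K) (g : MvPolynomial (Fin m) K) (M : ℕ) (γ : K),
      p ∣ inclX K n m f - inclY K n m g ∧ 0 < f.totalDegree ∧ 0 < M ∧ γ ≠ 0 ∧
      lineU v w P ∣ 1 - C γ * X ^ M := by
  by_contra! hno
  refine hA (eq_bot_iff.2 ?_)
  rintro ⟨f, g⟩ hfg
  rw [mem_separatedAlgebra_span'] at hfg
  rcases Nat.eq_zero_or_pos f.totalDegree with h0 | h0
  · obtain ⟨c, rfl, rfl⟩ := h.eq_C_of_totalDegree_eq_zero hfg h0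
    exact Subalgebra.algebraMap_mem _ c
  · obtain ⟨γ, hγ, -, hd⟩ := h.planeHom_dvd hfg h0
    refine absurd ?_ (hno f g _ γ hfg h0 (h.regular hfg (Or.inl h0)).2.2.1 hγ)
    have := map_dvd (mapRingHom (evalRingHom (1 : K))) hd
    rw [eval_planeHom_eq_lineU] at this
    simpa using this

theorem HasShape.lineU_eval_zero (h : HasShape p P a b W v w) : (lineU v w P).eval 0 ≠ 0 := by
  have : (lineU v w P).eval 0 = MvPolynomial.aeval (Sum.elim v 0 : Fin n ⊕ Fin m → K) P := by
    have : (Polynomial.aeval (0 : K)).comp (lineU v w)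
        = (MvPolynomial.aeval (Sum.elim v 0 : Fin n ⊕ Fin m → K) : PolyXY K n m →ₐ[K] K) := by
      ext i : 1
      rcases i with i | i <;> simp [lineU]
    rw [← this]
    simp
  rw [this]
  exact h.pureX

/-- In characteristic zero a binomial `1 - γ X ^ M` is coprime to its derivative, hence has no
multiple factors. -/
theorem not_mul_self_dvd_of_dvd [CharZero K] {U h : K[X]} {γ : K} {M : ℕ} (hM : 0 < M)
    (hU : U ∣ 1 - C γ * X ^ M) (hh : 0 < h.natDegree) : ¬ h * h ∣ U := by
  intro hd
  have hd1 := hd.trans hU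
  have hder : h ∣ derivative (1 - C γ * X ^ M) := by
    obtain ⟨k, hk⟩ := hd1
    rw [hk, mul_assoc, derivative_mul]
    exact dvd_add (Dvd.dvd.mul_left (dvd_mul_right _ _) _) (dvd_mul_right _ _)
  have h1 : h ∣ 1 - C γ * X ^ M := (dvd_mul_right _ _).trans hd1
  have h2 : h ∣ 1 := by
    -- The Bézout identity: `X / M` times the derivative is `-γ X ^ M`.
    have e : (1 : K[X]) = (1 - C γ * X ^ M) - C ((M : K)⁻¹) * X * derivative (1 - C γ * X ^ M) := by
      obtain ⟨k, rfl⟩ := Nat.exists_eq_succ_of_ne_zero hM.ne'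
      have hk : ((k + 1 : ℕ) : K) ≠ 0 := Nat.cast_ne_zero.2 (Nat.succ_ne_zero k)
      simp only [derivative_sub, derivative_one, derivative_C_mul_X_pow, Nat.succ_eq_add_one,
        Nat.add_sub_cancel]
      have : C (((k + 1 : ℕ) : K)⁻¹) * X * (0 - C (γ * ((k + 1 : ℕ) : K)) * X ^ k)
          = - (C (((k + 1 : ℕ) : K)⁻¹ * (γ * ((k + 1 : ℕ) : K))) * X ^ (k + 1)) := by
        rw [zero_sub, mul_neg, pow_succ', mul_mul_mul_comm, ← C_mul]
      rw [this, mul_comm γ, ← mul_assoc, inv_mul_cancel₀ hk, one_mul, sub_neg_eq_add,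
        sub_add_cancel]
    rw [e]
    exact dvd_sub h1 (Dvd.dvd.mul_left hder _)
  have := natDegree_eq_zero_of_isUnit (isUnit_of_dvd_one h2)
  omega

/-- Both roots satisfy `γ z ^ M = 1`; divide one equation by the other. -/
theorem pow_eq_one_of_dvd {L : Type*} [Field L] [Algebra K L] {U : K[X]} {γ : K} {M : ℕ}
    (hU : U ∣ 1 - C γ * X ^ M) {x ζ : L} (hx : aeval x U = 0) (hζ : aeval (ζ * x) U = 0) :
    ζ ^ M = 1 := by
  obtain ⟨k, hk⟩ := hU
  have h1 := congrArg (aeval x) hk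
  have h2 := congrArg (aeval (ζ * x)) hk
  simp only [map_mul, hx, hζ, zero_mul, map_sub, map_one, aeval_C, map_pow, aeval_X] at h1 h2
  rw [sub_eq_zero] at h1 h2
  rw [mul_pow, mul_left_comm, ← h1, mul_one] at h2
  exact h2.symm

theorem IsWeightedHomogeneous.aeval_pow_mul {σ B : Type*} [CommRing B] [Algebra K B] {wt : σ → ℕ}
    {Q : MvPolynomial σ K} (hQ : Q.IsWeightedHomogeneous wt W) (c : B) (y : σ → B) :
    MvPolynomial.aeval (fun i => c ^ wt i * y i) Q = c ^ W * MvPolynomial.aeval y Q := by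
  conv_lhs => rw [Q.as_sum]
  conv_rhs => rw [Q.as_sum]
  rw [map_sum, map_sum, Finset.mul_sum]
  refine Finset.sum_congr rfl fun d hd => ?_
  rw [MvPolynomial.aeval_monomial, MvPolynomial.aeval_monomial,
    ← hQ (MvPolynomial.mem_support_iff.1 hd), Finsupp.weight_apply, Finsupp.sum, Finsupp.prod,
    Finsupp.prod, ← Finset.prod_pow_eq_pow_sum]
  simp only [mul_pow, Finset.prod_mul_distrib, ← pow_mul, smul_eq_mul]
  rw [mul_left_comm]
  simp only [mul_comm (wt _)]

/-- The restriction to the plane has a constant leading coefficient in the second coordinate. -/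
theorem HasShape.exists_leadingCoeff_planeHom (h : HasShape p P a b W v w) :
    ∃ c : K, c ≠ 0 ∧ (planeHom K v w P).leadingCoeff = C c := by
  set Q := planeHom K v w P
  set c := MvPolynomial.aeval (Sum.elim 0 w : Fin n ⊕ Fin m → K) P with hc
  refine ⟨c, h.pureY, ?_⟩
  -- Replacing `t` by `t ^ b` turns the degree in `t` into a part of the weight, while `s` counts as
  -- a scalar. The coefficient in degree `W` is then the pure part in `Y`, because `a > 0` removes
  -- every term containing a variable of `X`.
  set y : Fin n ⊕ Fin m → K[X][X] :=
    Sum.elim (fun i => C (C (v i) * X)) (fun j => C (C (w j)) * X ^ b) with hy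
  have hexp : (Polynomial.expand K[X] b) Q = MvPolynomial.aeval y P := by
    have : ((Polynomial.expand K[X] b : K[X][X] →+* K[X][X]).comp
        (planeHom K v w : PolyXY K n m →+* K[X][X]))
        = (MvPolynomial.aeval y : PolyXY K n m →ₐ[K] K[X][X]).toRingHom := by
      refine MvPolynomial.ringHom_ext ?_ ?_
      · intro r
        have : planeHom K v w (MvPolynomial.C r) = C (C r) := (planeHom K v w).commutes r
        have h2 : MvPolynomial.aeval y (MvPolynomial.C r) = (C (C r) : K[X][X]) :=
          (MvPolynomial.aeval y : PolyXY K n m →ₐ[K] K[X][X]).commutes r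
        simp [this, h2]
      · rintro (i | i) <;> simp [planeHom, hy]
    exact DFunLike.congr_fun this P
  have hdeg : ∀ i, (y i).natDegree ≤ weights n m a b i := by
    rintro (i | i)
    · simp only [hy, Sum.elim_inl, natDegree_C]; exact Nat.zero_le _
    · simp only [hy, Sum.elim_inr, weights]
      exact natDegree_C_mul_X_pow_le _ _
  obtain ⟨h1, h2⟩ := IsWeightedHomogeneous.aeval_coeff hdeg h.top.homogeneous
  have h3 : MvPolynomial.aeval (fun i => (y i).coeff (weights n m a b i)) P = C c := by
    have : (fun i => (y i).coeff (weights n m a b i))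
        = fun i => algebraMap K K[X] ((Sum.elim 0 w : Fin n ⊕ Fin m → K) i) := by
      funext i
      rcases i with i | i
      · simp only [hy, Sum.elim_inl, weights, coeff_C, if_neg h.a_pos.ne', Pi.zero_apply, map_zero]
      · simp only [hy, Sum.elim_inr, weights, coeff_C_mul, coeff_X_pow, if_true, mul_one]
        rfl
    rw [this, hc]
    exact MvPolynomial.aeval_algebraMap_apply _ _ _
  rw [← hexp, h3] at h2
  rw [← hexp, natDegree_expand] at h1
  have hc0 : (C c : K[X]) ≠ 0 := C_ne_zero.2 h.pureY
  rw [coeff_expand h.b_pos] at h2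
  split_ifs at h2 with hdvd
  · have : Q.natDegree = W / b := natDegree_eq_of_le_of_coeff_ne_zero
      ((Nat.le_div_iff_mul_le h.b_pos).2 h1) (by rw [h2]; exact hc0)
    rw [leadingCoeff, this, h2]
  · exact absurd h2.symm hc0

/-- Weighted homogeneity recovers the plane from the line `s = 1`: the restriction to `s = l ^ a` is
a rescaling of the one to `s = 1`. Division by the restricted form is possible since its leading
coefficient is a constant, and the remainder vanishes at all these `s`. -/
theorem HasShape.planeHom_dvd_of_lineU_dvd [Infinite K] (h : HasShape p P a b W v w) {θ : K}
    {d d' : ℕ} (hdd : a * d = b * d') (hU : lineU v w P ∣ 1 - C θ * X ^ d') :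
    planeHom K v w P ∣ C X ^ d - C (C θ) * X ^ d' := by
  obtain ⟨c, hc0, hc⟩ := h.exists_leadingCoeff_planeHom
  set Q := planeHom K v w P with hQ
  set Q' := C (C c⁻¹) * Q with hQ'
  have hmonic : Q'.Monic := by
    refine monic_C_mul_of_mul_leadingCoeff_eq_one ?_
    rw [hc, ← C_mul, inv_mul_cancel₀ hc0, C_1]
  set R := (C X ^ d - C (C θ) * X ^ d') %ₘ Q' with hR
  have hspec : ∀ l : K, l ≠ 0 → R.map (evalRingHom (l ^ a)) = 0 := by
    intro l hl
    rw [hR, map_modByMonic _ hmonic, modByMonic_eq_zero_iff_dvd (hmonic.map _)]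
    have e1 : Q.map (evalRingHom (l ^ a))
        = C l ^ W * (lineU v w P).comp (C (l⁻¹ ^ b) * X) := by
      have e2 : (MvPolynomial.aeval (fun i => (C l) ^ weights n m a b i *
          (Sum.elim (fun i => C (v i)) (fun j => C (w j * l⁻¹ ^ b) * X) :
            Fin n ⊕ Fin m → K[X]) i) P) = Q.map (evalRingHom (l ^ a)) := by
        have : ((mapRingHom (evalRingHom (l ^ a))).comp
            (planeHom K v w : PolyXY K n m →+* K[X][X])) = (MvPolynomial.aeval
            (fun i => (C l) ^ weights n m a b i *
          (Sum.elim (fun i => C (v i)) (fun j => C (w j * l⁻¹ ^ b) * X) :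
            Fin n ⊕ Fin m → K[X]) i) : PolyXY K n m →ₐ[K] K[X]).toRingHom := by
          refine MvPolynomial.ringHom_ext ?_ ?_
          · intro r
            simp [planeHom]
          · rintro (i | i)
            · simp [planeHom, weights, -X_mul_C]
              exact mul_comm _ _
            · have : l ^ b ≠ 0 := pow_ne_zero _ hl
              simp only [planeHom, weights, RingHom.comp_apply, RingHom.coe_coe,
                MvPolynomial.aeval_X, Sum.elim_inr, AlgHom.toRingHom_eq_coe, coe_mapRingHom,
                Polynomial.map_mul, map_X, map_C, ← mul_assoc, ← C_pow, ← C_mul]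
              congr 2
              rw [inv_pow, mul_comm, inv_mul_cancel_left₀ this]
              simp
        exact (DFunLike.congr_fun this P).symm
      rw [← e2, IsWeightedHomogeneous.aeval_pow_mul h.top.homogeneous]
      congr 1
      have : ((Polynomial.compRingHom (C (l⁻¹ ^ b) * X)).comp
          (lineU v w : PolyXY K n m →+* K[X])) = (MvPolynomial.aeval
          (Sum.elim (fun i => C (v i)) (fun j => C (w j * l⁻¹ ^ b) * X) :
            Fin n ⊕ Fin m → K[X]) : PolyXY K n m →ₐ[K] K[X]).toRingHom := by
        refine MvPolynomial.ringHom_ext ?_ ?_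
        · intro r
          simp [lineU]
        · rintro (i | i)
          · simp [lineU]
          · simp [lineU, mul_assoc]
      exact (DFunLike.congr_fun this P).symm
    have e3 : Q.map (evalRingHom (l ^ a))
        ∣ (C X ^ d - C (C θ) * X ^ d' : K[X][X]).map (evalRingHom (l ^ a)) := by
      have e4 : (C X ^ d - C (C θ) * X ^ d' : K[X][X]).map (evalRingHom (l ^ a))
          = C l ^ (a * d) * (1 - C θ * X ^ d').comp (C (l⁻¹ ^ b) * X) := by
        have hone : l ^ (b * d') * (l⁻¹ ^ b) ^ d' = 1 := by
          rw [← pow_mul, ← mul_pow, mul_inv_cancel₀ hl, one_pow]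
        have : C l ^ (b * d') * (C θ * (C (l⁻¹ ^ b) * X) ^ d') = (C θ * X ^ d' : K[X]) := by
          rw [mul_pow, ← C_pow, ← C_pow, mul_left_comm, ← mul_assoc (C (l ^ (b * d'))), ← C_mul,
            hone, C_1, one_mul]
        rw [sub_comp, one_comp, mul_comp, C_comp, pow_comp, X_comp, mul_sub, mul_one]
        nth_rewrite 2 [hdd]
        rw [this]
        simp [pow_mul]
      rw [e1, e4]
      obtain ⟨k, hk⟩ := hU
      rw [hk, mul_comp]
      have hu : IsUnit (C l ^ W : K[X]) := ((IsUnit.mk0 l hl).map C).pow _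
      exact Dvd.dvd.mul_left (hu.mul_left_dvd.2 (dvd_mul_right _ _)) _
    rw [hQ', Polynomial.map_mul, map_C]
    have hu : IsUnit (C (evalRingHom (l ^ a) (C c⁻¹)) : K[X]) := by
      rw [coe_evalRingHom, eval_C]
      exact (IsUnit.mk0 _ (inv_ne_zero hc0)).map C
    exact hu.mul_left_dvd.2 e3
  have hR0 : R = 0 := by
    ext1 j
    rw [coeff_zero]
    -- Substituting the `a`-th power of the variable turns vanishing at `a`-th powers into vanishing
    -- at all nonzero elements, so no roots have to exist in `K`.
    have hroot : ∀ l : K, l ≠ 0 → (Polynomial.expand K a (R.coeff j)).eval l = 0 := by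
      intro l hl
      have := congrArg (fun q => q.coeff j) (hspec l hl)
      simpa [expand_eval] using this
    have : Polynomial.expand K a (R.coeff j) = 0 := by
      refine eq_zero_of_infinite_isRoot _ (Set.Infinite.mono (s := {0}ᶜ) ?_ ?_)
      · intro l hl
        exact hroot l hl
      · exact (Set.finite_singleton (0 : K)).infinite_compl
    exact (expand_eq_zero h.a_pos).1 this
  have hd : Q' ∣ C X ^ d - C (C θ) * X ^ d' := (modByMonic_eq_zero_iff_dvd hmonic).1 hR0
  exact (dvd_mul_left _ _).trans hd

/-- A divisor of a binomial gives separated multiples of bounded degree. -/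
theorem HasShape.exists_totalDegree_eq [CharZero K] (h : HasShape p P a b W v w) {θ : K} {E : ℕ}
    (hE : 0 < E) (hU : lineU v w P ∣ 1 - C θ * X ^ E)
    (hA : separatedAlgebra (Ideal.span {p}) ≠ ⊥) :
    ∃ (f : MvPolynomial (Fin n) K) (g : MvPolynomial (Fin m) K),
      p ∣ inclX K n m f - inclY K n m g ∧ f.totalDegree = b * E ∧ g.totalDegree = a * E := by
  obtain ⟨f, g, -, -, hfg, h0, -⟩ := h.exists_lineU_dvd hA
  refine h.exists_of_planeHom_dvd (θ := θ ^ a) hfg h0 (Nat.mul_pos h.b_pos hE) (by ring) ?_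
  refine h.planeHom_dvd_of_lineU_dvd (by ring) (hU.trans ?_)
  -- The binomial divides `1 - θ ^ a X ^ (a E)`; the exponents `b * E` and `a * E` are balanced.
  have := sub_dvd_pow_sub_pow (1 : K[X]) (C θ * X ^ E) a
  rwa [one_pow, mul_pow, ← C_pow, ← pow_mul, mul_comm E a] at this

end Line


/-! ### Roots whose quotients are roots of unity. -/

section Univariate

variable {K : Type*} [Field K]

theorem aeval_X_ne_zero_of_eval_zero {L : Type*} [Field L] [Algebra K L] {U : K[X]}
    (h0 : U.eval 0 ≠ 0) {x : L} (hx : aeval x U = 0) : x ≠ 0 := by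
  rintro rfl
  have : aeval (0 : L) U = algebraMap K L (U.eval 0) := by
    rw [← map_zero (algebraMap K L), aeval_algebraMap_apply_eq_algebraMap_eval]
  rw [this] at hx
  exact h0 ((map_eq_zero _).1 hx)

/-- Either a polynomial has a multiple factor, or a quotient of two of its roots is not a root of
unity, or it divides a binomial. -/
theorem multiple_factor_or_ratio_or_dvd_binomial [CharZero K] (L : Type*) [Field L] [Algebra K L]
    [IsAlgClosed L] {U : K[X]} (h0 : U.eval 0 ≠ 0) :
    (∃ h : K[X], h.Monic ∧ 0 < h.natDegree ∧ h * h ∣ U) ∨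
    (∃ x ζ : L, aeval x U = 0 ∧ aeval (ζ * x) U = 0 ∧ ∀ N : ℕ, 0 < N → ζ ^ N ≠ 1) ∨
    (∃ (θ : K) (E : ℕ), 0 < E ∧ U ∣ 1 - C θ * X ^ E) := by
  classical
  have hU0 : U ≠ 0 := by rintro rfl; simp at h0
  by_cases hsq : Squarefree U
  swap
  · left
    rw [Squarefree] at hsq
    push Not at hsq
    obtain ⟨h, hd, hu⟩ := hsq
    have hh : h ≠ 0 := by
      rintro rfl
      rw [mul_zero, zero_dvd_iff] at hd
      exact hU0 hd
    refine ⟨normalize h, monic_normalize hh, ?_, ?_⟩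
    · refine Nat.pos_of_ne_zero fun hz => hu ?_
      have hd0 := degree_normalize (p := h)
      rw [degree_eq_natDegree (monic_normalize hh).ne_zero, hz] at hd0
      exact (isUnit_iff_degree_eq_zero).2 hd0.symm
    · exact (mul_dvd_mul (normalize_associated h).dvd (normalize_associated h).dvd).trans hd
  right
  have hsep : U.Separable := PerfectField.separable_iff_squarefree.2 hsq
  by_cases hall : ∀ x ∈ U.rootSet L, ∀ y ∈ U.rootSet L, ∃ N : ℕ, 0 < N ∧ (y / x) ^ N = 1
  swap
  · left
    push Not at hall
    obtain ⟨x, hx, y, hy, hxy⟩ := hall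
    rw [mem_rootSet_of_ne hU0] at hx hy
    have hx0 := aeval_X_ne_zero_of_eval_zero h0 hx
    exact ⟨x, y / x, hx, by rwa [div_mul_cancel₀ _ hx0], hxy⟩
  right
  have hcard := card_rootSet_eq_natDegree (K := L) hsep (IsAlgClosed.splits _)
  choose! N hN0 hN1 using hall
  -- A common exponent for all quotients of roots: all roots have the same `E`-th power.
  set E := ∏ x : U.rootSet L, ∏ y : U.rootSet L, N x y with hE
  have hE0 : 0 < E := Finset.prod_pos fun x _ => Finset.prod_pos fun y _ => hN0 x x.2 y y.2
  have hpow : ∀ x ∈ U.rootSet L, ∀ y ∈ U.rootSet L, y ^ E = x ^ E := by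
    intro x hx y hy
    have hd : N x y ∣ E :=
      (Finset.dvd_prod_of_mem (fun y : U.rootSet L => N x y) (Finset.mem_univ ⟨y, hy⟩)).trans
        (Finset.dvd_prod_of_mem (fun x : U.rootSet L => ∏ y : U.rootSet L, N x y)
          (Finset.mem_univ ⟨x, hx⟩))
    obtain ⟨k, hk⟩ := hd
    have hx0 := aeval_X_ne_zero_of_eval_zero h0 ((mem_rootSet_of_ne hU0).1 hx)
    have : (y / x) ^ E = 1 := by rw [hk, pow_mul, hN1 x hx y hy, one_pow]
    rw [div_pow, div_eq_one_iff_eq (pow_ne_zero _ hx0)] at this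
    exact this
  -- A nonzero constant divides every binomial, so `θ = 0` and `E = 1` will do.
  rcases Nat.eq_zero_or_pos U.natDegree with hd | hd
  · refine ⟨0, 1, one_pos, ?_⟩
    rw [eq_C_of_natDegree_eq_zero hd]
    have : U.coeff 0 ≠ 0 := by rwa [coeff_zero_eq_eval_zero]
    exact ((IsUnit.mk0 _ this).map C).dvd
  obtain ⟨x, hx⟩ : (U.rootSet L).Nonempty := by
    rw [← hcard] at hd
    obtain ⟨x⟩ := Fintype.card_pos_iff.1 hd
    exact ⟨x, x.2⟩
  set r := X ^ E % U with hr
  have hrx : ∀ y ∈ U.rootSet L, aeval y r = x ^ E := by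
    intro y hy
    have h1 := congrArg (aeval y) (EuclideanDomain.div_add_mod (X ^ E) U)
    rw [map_add, map_mul, (mem_rootSet_of_ne hU0).1 hy, zero_mul, zero_add, map_pow, aeval_X] at h1
    rw [hr, h1]
    exact hpow x hx y hy
  have hdeg : r.natDegree < U.natDegree := natDegree_mod_lt _ hd.ne'
  -- The remainder of `X ^ E` takes one value at all roots, of which there are `deg U` by
  -- separability; its degree is smaller, so it is constant.
  have hzero : r.map (algebraMap K L) - C (x ^ E) = 0 := by
    refine eq_zero_of_natDegree_lt_card_of_eval_eq_zero' _ (U.rootSet L).toFinset ?_ ?_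
    · intro y hy
      rw [eval_sub, eval_C, eval_map_algebraMap, hrx y (Set.mem_toFinset.1 hy), sub_self]
    · rw [Set.toFinset_card, hcard]
      refine lt_of_le_of_lt (natDegree_sub_le _ _) ?_
      rw [natDegree_C, natDegree_map]
      exact max_lt hdeg hd
  have hr0 : r.natDegree = 0 := by
    have := congrArg natDegree (sub_eq_zero.1 hzero)
    rwa [natDegree_map, natDegree_C] at this
  obtain ⟨c, hc⟩ : ∃ c, r = C c := ⟨_, eq_C_of_natDegree_eq_zero hr0⟩
  have hcx : algebraMap K L c = x ^ E := by
    have := hrx x hx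
    rwa [hc, aeval_C] at this
  have hc0 : c ≠ 0 := by
    rintro rfl
    rw [map_zero] at hcx
    exact pow_ne_zero E (aeval_X_ne_zero_of_eval_zero h0 ((mem_rootSet_of_ne hU0).1 hx)) hcx.symm
  refine ⟨c⁻¹, E, hE0, ?_⟩
  have h2 : U ∣ X ^ E - C c := by
    rw [← hc, hr]
    exact ⟨X ^ E / U, by rw [sub_eq_iff_eq_add, EuclideanDomain.div_add_mod]⟩
  have e : (1 - C c⁻¹ * X ^ E : K[X]) = - C c⁻¹ * (X ^ E - C c) := by
    rw [mul_sub, neg_mul, neg_mul, ← C_mul, inv_mul_cancel₀ hc0, C_1]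
    ring
  rw [e]
  exact Dvd.dvd.mul_left h2 _

/-- The quotients of roots of `U`, described by polynomial identities over the base field. -/
theorem exists_bivariate_of_ratio {L : Type*} [Field L] [Algebra K L] [Algebra.IsAlgebraic K L]
    {U : K[X]} {x ζ : L} (hx : aeval x U = 0)
    (hζ : aeval (ζ * x) U = 0) : ∃ (τ : K[X]) (h u u' s s' : K[X][X]), aeval ζ τ = 0 ∧ h.Monic ∧
      0 < h.natDegree ∧ U.map C = h * u + C τ * u' ∧
      (U.map C).comp (C X * X) = h * s + C τ * s' := by
  have hint : IsIntegral K ζ := Algebra.IsIntegral.isIntegral ζ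
  set τ := minpoly K ζ with hτ
  have : Fact (Irreducible τ) := ⟨minpoly.irreducible hint⟩
  have hτ0 : τ.eval₂ (algebraMap K L) ζ = 0 := minpoly.aeval K ζ
  let : Algebra (AdjoinRoot τ) L := (AdjoinRoot.lift (algebraMap K L) ζ hτ0).toAlgebra
  have : IsScalarTower K (AdjoinRoot τ) L := by
    refine IsScalarTower.of_algebraMap_eq fun r => ?_
    exact (AdjoinRoot.lift_of hτ0).symm
  have hxint : IsIntegral (AdjoinRoot τ) x :=
    (Algebra.IsIntegral.isIntegral (R := K) x).tower_top
  set h0 := minpoly (AdjoinRoot τ) x with hh0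
  have hlift : ∀ q : (AdjoinRoot τ)[X], q ∈ lifts (AdjoinRoot.mk τ) := by
    intro q
    rw [mem_lifts]
    exact Polynomial.map_surjective _ AdjoinRoot.mk_surjective q
  obtain ⟨h, hhmap, hhdeg, hhmon⟩ :=
    lifts_and_natDegree_eq_and_monic (hlift h0) (minpoly.monic hxint)
  -- Divisibility by the minimal polynomial of `x` over `K(ζ)`, written as `K[X] / (τ)`, lifts to
  -- `K[X][X]` up to a multiple of `τ`.
  have hdiv : ∀ A : K[X][X], aeval x (A.map (AdjoinRoot.mk τ)) = 0 →
      ∃ u u', A = h * u + C τ * u' := by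
    intro A hA
    obtain ⟨k, hk⟩ := minpoly.dvd _ x hA
    obtain ⟨u, rfl⟩ := (mem_lifts _).1 (hlift k)
    have hz : (A - h * u).map (AdjoinRoot.mk τ) = 0 := by
      rw [Polynomial.map_sub, Polynomial.map_mul, hhmap, hk, sub_self]
    have hd : C τ ∣ A - h * u := by
      rw [C_dvd_iff_dvd_coeff]
      intro i
      have := congrArg (fun q => q.coeff i) hz
      simp only [coeff_map, coeff_zero] at this
      exact AdjoinRoot.mk_eq_zero.1 this
    obtain ⟨u', hu'⟩ := hd
    exact ⟨u, u', by rw [← hu', add_sub_cancel]⟩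
  have hmapU : (U.map C).map (AdjoinRoot.mk τ) = U.map (algebraMap K (AdjoinRoot τ)) := by
    rw [Polynomial.map_map]; rfl
  obtain ⟨u, u', hu⟩ := hdiv (U.map C) (by rw [hmapU, aeval_map_algebraMap, hx])
  obtain ⟨s, s', hs⟩ := hdiv ((U.map C).comp (C X * X)) (by
    rw [Polynomial.map_comp, hmapU, aeval_comp, aeval_map_algebraMap]
    have : aeval x ((C X * X : K[X][X]).map (AdjoinRoot.mk τ)) = ζ * x := by
      rw [Polynomial.map_mul, map_C, map_X, map_mul, aeval_C, aeval_X]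
      congr 1
      exact AdjoinRoot.lift_root hτ0
    rw [this, hζ])
  exact ⟨τ, h, u, u', s, s', hτ0, hhmon, by rw [hhdeg]; exact minpoly.natDegree_pos hxint, hu, hs⟩

end Univariate


/-! ### Weights for an arbitrary polynomial. -/

section Weights

variable {K : Type*} [Field K] {n m : ℕ}

theorem weight_weights (a b : ℕ) (d : Fin n ⊕ Fin m →₀ ℕ) :
    Finsupp.weight (weights n m a b) d = a * (∑ i, d (Sum.inl i)) + b * ∑ j, d (Sum.inr j) := by
  rw [Finsupp.weight_apply, Finsupp.sum_fintype _ _ (by simp), Fintype.sum_sum_type,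
    Finset.mul_sum, Finset.mul_sum]
  simp only [weights, Sum.elim_inl, Sum.elim_inr, smul_eq_mul, mul_comm]

theorem coeff_restrictX (q : PolyXY K n m) (e : Fin n →₀ ℕ) :
    (restrictX K n m q).coeff e = q.coeff (e.mapDomain Sum.inl) := by
  classical
  induction q using MvPolynomial.induction_on' with
  | add p q hp hq => rw [map_add, MvPolynomial.coeff_add, MvPolynomial.coeff_add, hp, hq]
  | monomial d c =>
    rw [restrictX, MvPolynomial.aeval_monomial, Finsupp.prod_fintype _ _ (by simp),
      Fintype.prod_sum_type]
    simp only [Sum.elim_inl, Sum.elim_inr, Pi.zero_apply]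
    by_cases hd : ∀ j, d (Sum.inr j) = 0
    · simp only [hd, pow_zero, Finset.prod_const_one, mul_one]
      have h1 : ∏ i : Fin n, (MvPolynomial.X i : MvPolynomial (Fin n) K) ^ d (Sum.inl i)
          = MvPolynomial.monomial (d.comapDomain Sum.inl Sum.inl_injective.injOn) 1 := by
        rw [MvPolynomial.monomial_eq, MvPolynomial.C_1, one_mul, Finsupp.prod_fintype _ _ (by simp)]
        rfl
      rw [h1, MvPolynomial.algebraMap_eq, MvPolynomial.C_mul_monomial, mul_one,
        MvPolynomial.coeff_monomial, MvPolynomial.coeff_monomial]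
      refine if_congr ?_ rfl rfl
      constructor
      · rintro rfl
        rw [Finsupp.mapDomain_comapDomain _ Sum.inl_injective]
        intro x hx
        rcases x with i | j
        · exact ⟨i, rfl⟩
        · exact absurd (hd j) (Finsupp.mem_support_iff.1 hx)
      · rintro rfl
        exact Finsupp.comapDomain_mapDomain _ Sum.inl_injective _
    · push Not at hd
      obtain ⟨j, hj⟩ := hd
      rw [Finset.prod_eq_zero (s := Finset.univ (α := Fin m)) (Finset.mem_univ j) (zero_pow hj), mul_zero, mul_zero,
        MvPolynomial.coeff_zero, MvPolynomial.coeff_monomial, if_neg]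
      rintro rfl
      exact hj (Finsupp.mapDomain_of_notMem_range _ _ (by simp))

theorem aeval_restrictX (v : Fin n → K) (q : PolyXY K n m) :
    MvPolynomial.aeval v (restrictX K n m q) = MvPolynomial.aeval (Sum.elim v 0 : _ → K) q := by
  have : (MvPolynomial.aeval v).comp (restrictX K n m)
      = (MvPolynomial.aeval (Sum.elim v 0 : _ → K) : PolyXY K n m →ₐ[K] K) := by
    ext i : 1
    rcases i with i | i <;> simp [restrictX]
  exact DFunLike.congr_fun this q

theorem restrictX_swapXY (q : PolyXY K n m) : restrictX K m n (swapXY K n m q) = restrictY K n m q := by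
  have : (restrictX K m n).comp (swapXY K n m : PolyXY K n m →ₐ[K] PolyXY K m n)
      = restrictY K n m := by
    ext i : 1
    rcases i with i | i <;> simp [restrictX, restrictY, swapXY]
  exact DFunLike.congr_fun this q

theorem coeff_restrictY (q : PolyXY K n m) (e : Fin m →₀ ℕ) :
    (restrictY K n m q).coeff e = q.coeff (e.mapDomain Sum.inr) := by
  rw [← restrictX_swapXY, coeff_restrictX, swapXY, MvPolynomial.renameEquiv_apply]
  have : e.mapDomain (Sum.inl : Fin m → Fin m ⊕ Fin n)
      = (e.mapDomain (Sum.inr : Fin m → Fin n ⊕ Fin m)).mapDomain (Equiv.sumComm (Fin n) (Fin m)) := by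
    rw [← Finsupp.mapDomain_comp]; rfl
  rw [this, MvPolynomial.coeff_rename_mapDomain _ (Equiv.injective _)]

theorem aeval_restrictY (w : Fin m → K) (q : PolyXY K n m) :
    MvPolynomial.aeval w (restrictY K n m q) = MvPolynomial.aeval (Sum.elim 0 w : _ → K) q := by
  have : (MvPolynomial.aeval w).comp (restrictY K n m)
      = (MvPolynomial.aeval (Sum.elim 0 w : _ → K) : PolyXY K n m →ₐ[K] K) := by
    ext i : 1
    rcases i with i | i <;> simp [restrictY]
  exact DFunLike.congr_fun this q

theorem exists_mem_support_of_notMem_rangeY {p : PolyXY K n m} (h : p ∉ (inclY K n m).range) :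
    ∃ d ∈ p.support, 0 < ∑ i, d (Sum.inl i) := by
  by_contra! hall
  refine h ?_
  obtain ⟨q, hq⟩ := MvPolynomial.exists_rename_eq_of_vars_subset_range p
    (Sum.inr : Fin m → Fin n ⊕ Fin m) Sum.inr_injective (by
      intro x hx
      obtain ⟨d, hd, hxd⟩ := (MvPolynomial.mem_vars_iff_mem_support _).1 hx
      rcases x with i | j
      · have := hall d hd
        rw [Nat.le_zero, Finset.sum_eq_zero_iff] at this
        exact absurd (this i (Finset.mem_univ i)) (Finsupp.mem_support_iff.1 hxd)
      · exact ⟨j, rfl⟩)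
  exact ⟨q, hq⟩

theorem exists_mem_support_of_notMem_rangeX {p : PolyXY K n m} (h : p ∉ (inclX K n m).range) :
    ∃ d ∈ p.support, 0 < ∑ j, d (Sum.inr j) := by
  by_contra! hall
  refine h ?_
  obtain ⟨q, hq⟩ := MvPolynomial.exists_rename_eq_of_vars_subset_range p
    (Sum.inl : Fin n → Fin n ⊕ Fin m) Sum.inl_injective (by
      intro x hx
      obtain ⟨d, hd, hxd⟩ := (MvPolynomial.mem_vars_iff_mem_support _).1 hx
      rcases x with i | j
      · exact ⟨i, rfl⟩
      · have := hall d hd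
        rw [Nat.le_zero, Finset.sum_eq_zero_iff] at this
        exact absurd (this j (Finset.mem_univ j)) (Finsupp.mem_support_iff.1 hxd))
  exact ⟨q, hq⟩

/-- For suitable weights the top form has either no pure terms at all, or pure terms in `X` and
in `Y`. -/
theorem exists_weights [Infinite K] {p : PolyXY K n m} (hX : p ∉ (inclX K n m).range)
    (hY : p ∉ (inclY K n m).range) :
    ∃ (a b W : ℕ) (P : PolyXY K n m), 0 < a ∧ 0 < b ∧ IsTopForm (weights n m a b) p P W ∧ P ≠ 0 ∧
      ((∀ d ∈ P.support, (∃ i, d (Sum.inl i) ≠ 0) ∧ ∃ j, d (Sum.inr j) ≠ 0) ∨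
        ∃ v w, HasShape p P a b W v w) := by
  classical
  obtain ⟨dX, hdX, hdX0⟩ := exists_mem_support_of_notMem_rangeY hY
  obtain ⟨dY, hdY, hdY0⟩ := exists_mem_support_of_notMem_rangeX hX
  obtain ⟨eX, heX, hk⟩ := Finset.exists_mem_eq_sup p.support ⟨_, hdX⟩ (fun d => ∑ i, d (Sum.inl i))
  obtain ⟨eY, heY, hl⟩ := Finset.exists_mem_eq_sup p.support ⟨_, hdX⟩ (fun d => ∑ j, d (Sum.inr j))
  set k := p.support.sup fun d => ∑ i, d (Sum.inl i) with hkdef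
  set l := p.support.sup fun d => ∑ j, d (Sum.inr j) with hldef
  have hk1 : ∀ d ∈ p.support, ∑ i, d (Sum.inl i) ≤ k := fun d hd =>
    Finset.le_sup (f := fun d : Fin n ⊕ Fin m →₀ ℕ => ∑ i, d (Sum.inl i)) hd
  have hl1 : ∀ d ∈ p.support, ∑ j, d (Sum.inr j) ≤ l := fun d hd =>
    Finset.le_sup (f := fun d : Fin n ⊕ Fin m →₀ ℕ => ∑ j, d (Sum.inr j)) hd
  have hk0 : 0 < k := hdX0.trans_le (hk1 _ hdX)
  have hl0 : 0 < l := hdY0.trans_le (hl1 _ hdY)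
  have hp0 : p ≠ 0 := by rintro rfl; simp at hdX
  set wt := weights n m l k
  have htop := isTopForm_weightedHomogeneousComponent wt p
  set W := MvPolynomial.weightedTotalDegree wt p
  have hcoeff : ∀ d, (MvPolynomial.weightedHomogeneousComponent wt W p).coeff d
      = if Finsupp.weight wt d = W then p.coeff d else 0 := fun d =>
    MvPolynomial.coeff_weightedHomogeneousComponent _ _ _
  have hWge : ∀ d ∈ p.support, Finsupp.weight wt d ≤ W := fun d hd =>
    MvPolynomial.le_weightedTotalDegree wt hd
  -- The weights are the degree of `p` in `Y` and its degree in `X`, in this order, so that pure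
  -- terms weigh at most `l * k`. If the top weight is larger, the top form has no pure terms. If it
  -- equals `l * k`, then terms of maximal degree in `X` or in `Y` leave no room for the other
  -- variables and are pure.
  refine ⟨l, k, W, _, hl0, hk0, htop,
    weightedHomogeneousComponent_weightedTotalDegree_ne_zero wt hp0, ?_⟩
  have hWlk : l * k ≤ W := by
    refine le_trans ?_ (hWge eX heX)
    rw [weight_weights, hk]
    exact Nat.le_add_right _ _
  rcases hWlk.lt_or_eq with hlt | heq
  · left
    intro d hd
    rw [MvPolynomial.mem_support_iff, hcoeff] at hd
    split_ifs at hd with hdW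
    · rw [weight_weights] at hdW
      have hdp := MvPolynomial.mem_support_iff.2 hd
      constructor
      · by_contra! hz
        rw [Finset.sum_eq_zero (fun i _ => hz i), mul_zero, zero_add] at hdW
        have := Nat.mul_le_mul_left k (hl1 d hdp)
        rw [hdW, mul_comm k] at this
        omega
      · by_contra! hz
        rw [Finset.sum_eq_zero (f := fun j => d (Sum.inr j)) (fun i _ => hz i), mul_zero, add_zero] at hdW
        have := Nat.mul_le_mul_left l (hk1 d hdp)
        rw [hdW] at this
        omega
    · exact absurd rfl hd
  · right
    have hexX : Finsupp.weight wt eX = W ∧ ∀ j, eX (Sum.inr j) = 0 := by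
      have h1 := hWge eX heX
      rw [weight_weights, ← hk, ← heq] at h1
      have h2 : k * ∑ j, eX (Sum.inr j) = 0 := by omega
      have h3 : ∑ j, eX (Sum.inr j) = 0 := (Nat.mul_eq_zero.1 h2).resolve_left hk0.ne'
      refine ⟨by rw [weight_weights, ← hk, h3, ← heq, mul_zero, add_zero], fun j => ?_⟩
      exact (Finset.sum_eq_zero_iff.1 h3) j (Finset.mem_univ j)
    have hexY : Finsupp.weight wt eY = W ∧ ∀ i, eY (Sum.inl i) = 0 := by
      have h1 := hWge eY heY
      rw [weight_weights, ← hl, ← heq, mul_comm k l] at h1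
      have h2 : l * ∑ j, eY (Sum.inl j) = 0 := by omega
      have h3 : ∑ j, eY (Sum.inl j) = 0 := (Nat.mul_eq_zero.1 h2).resolve_left hl0.ne'
      refine ⟨by rw [weight_weights, ← hl, h3, ← heq, mul_zero, zero_add, mul_comm], fun j => ?_⟩
      exact (Finset.sum_eq_zero_iff.1 h3) j (Finset.mem_univ j)
    set P := MvPolynomial.weightedHomogeneousComponent wt W p
    have hPX : restrictX K n m P ≠ 0 := by
      intro h0
      have h1 := coeff_restrictX P (eX.comapDomain Sum.inl Sum.inl_injective.injOn)
      rw [h0, MvPolynomial.coeff_zero, Finsupp.mapDomain_comapDomain _ Sum.inl_injective, hcoeff,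
        if_pos hexX.1] at h1
      · exact MvPolynomial.mem_support_iff.1 heX h1.symm
      · intro x hx
        rcases x with i | j
        · exact ⟨i, rfl⟩
        · exact absurd (hexX.2 j) (Finsupp.mem_support_iff.1 hx)
    have hPY : restrictY K n m P ≠ 0 := by
      intro h0
      have h1 := coeff_restrictY P (eY.comapDomain Sum.inr Sum.inr_injective.injOn)
      rw [h0, MvPolynomial.coeff_zero, Finsupp.mapDomain_comapDomain _ Sum.inr_injective, hcoeff,
        if_pos hexY.1] at h1
      · exact MvPolynomial.mem_support_iff.1 heY h1.symm
      · intro x hx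
        rcases x with i | j
        · exact absurd (hexY.2 i) (Finsupp.mem_support_iff.1 hx)
        · exact ⟨j, rfl⟩
    obtain ⟨v, hv⟩ := exists_aeval_ne_zero hPX
    obtain ⟨w, hw⟩ := exists_aeval_ne_zero hPY
    rw [aeval_restrictX] at hv
    rw [aeval_restrictY] at hw
    exact ⟨v, w, hl0, hk0, heq ▸ Nat.mul_pos hl0 hk0, htop, hv, hw⟩

end Weights

/-! ### A degree bound for generators. -/

section Generation

variable {K : Type*} [Field K] {n m : ℕ}

theorem totalDegree_aeval {σ : Type*} {t : MvPolynomial σ K} (ht : 0 < t.totalDegree) (φ : K[X]) :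
    (aeval t φ).totalDegree = φ.natDegree * t.totalDegree := by
  have ht0 : t ≠ 0 := by rintro rfl; simp at ht
  induction hk : φ.natDegree using Nat.strong_induction_on generalizing φ with
  | _ k ih =>
    rcases Nat.eq_zero_or_pos k with rfl | hk0
    · rw [eq_C_of_natDegree_eq_zero hk, aeval_C, MvPolynomial.algebraMap_eq,
        MvPolynomial.totalDegree_C, zero_mul]
    · have h1 := φ.eraseLead_add_C_mul_X_pow
      have h2 : φ.eraseLead.natDegree < k := by
        have := φ.eraseLead_natDegree_le
        omega
      have hφ : φ ≠ 0 := by rintro rfl; simp at hk; omega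
      have hlc : φ.leadingCoeff ≠ 0 := leadingCoeff_ne_zero.2 hφ
      have h3 : (aeval t (C φ.leadingCoeff * X ^ φ.natDegree)).totalDegree = k * t.totalDegree := by
        rw [map_mul, aeval_C, map_pow, aeval_X, MvPolynomial.algebraMap_eq,
          MvPolynomial.totalDegree_mul_of_isDomain
            (MvPolynomial.C_ne_zero.2 hlc) (pow_ne_zero _ ht0), MvPolynomial.totalDegree_C, zero_add,
          totalDegree_pow_of_isDomain ht0, hk]
      have h4 := ih _ h2 φ.eraseLead rfl
      nth_rewrite 1 [← h1]
      rw [map_add, MvPolynomial.totalDegree_add_eq_right_of_totalDegree_lt, h3]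
      rw [h3, h4]
      exact Nat.mul_lt_mul_of_pos_right h2 ht

theorem aeval_prodMk {R S : Type*} [CommRing R] [CommRing S] [Algebra K R] [Algebra K S] (t : R × S)
    (φ : K[X]) : aeval t φ = (aeval t.1 φ, aeval t.2 φ) := by
  have h1 : (AlgHom.fst K R S) (aeval t φ) = aeval (AlgHom.fst K R S t) φ :=
    (aeval_algHom_apply (AlgHom.fst K R S) t φ).symm
  have h2 : (AlgHom.snd K R S) (aeval t φ) = aeval (AlgHom.snd K R S t) φ :=
    (aeval_algHom_apply (AlgHom.snd K R S) t φ).symm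
  exact Prod.ext h1 h2

/-- A separated element whose first component multiplies `p` into `I` bounds the degrees of the
generators of the separated algebra of `I`. -/
theorem separatedAlgebra_le_of_totalDegree_le [CharZero K] {p : PolyXY K n m}
    (hX : p ∉ (inclX K n m).range) (hY : p ∉ (inclY K n m).range) {I : Ideal (PolyXY K n m)}
    (hI : I ≤ Ideal.span {p}) {F : MvPolynomial (Fin n) K} {G : MvPolynomial (Fin m) K}
    (hFG : (F, G) ∈ separatedAlgebra I) (hF : 0 < F.totalDegree) (hpF : p * inclX K n m F ∈ I)
    {B : Subalgebra K (MvPolynomial (Fin n) K × MvPolynomial (Fin m) K)}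
    (hB : ∀ f g, (f, g) ∈ separatedAlgebra I → f.totalDegree ≤ 2 * F.totalDegree →
      g.totalDegree ≤ 2 * G.totalDegree → (f, g) ∈ B) : separatedAlgebra I ≤ B := by
  obtain ⟨t, ht, hgen⟩ := separatedAlgebra_span_eq_adjoin hX hY
  have hrange : ∀ x ∈ separatedAlgebra I, ∃ φ : K[X], aeval t φ = x := by
    intro x hx
    have := separatedAlgebra_mono hI hx
    rw [hgen, Algebra.adjoin_singleton_eq_range_aeval] at this
    exact this
  obtain ⟨Φ, hΦ⟩ := hrange _ hFG
  -- `F f - G g = F (f - g) + g (F - G)`, where `f - g` is a multiple of `p` and `p F ∈ I`.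
  have hmul : ∀ x ∈ separatedAlgebra (Ideal.span {p}), (F, G) * x ∈ separatedAlgebra I := by
    rintro ⟨f, g⟩ hfg
    rw [mem_separatedAlgebra_span'] at hfg
    obtain ⟨k, hk⟩ := hfg
    have e : inclX K n m (F * f) - inclY K n m (G * g)
        = k * (p * inclX K n m F) + inclY K n m g * (inclX K n m F - inclY K n m G) := by
      rw [map_mul, map_mul]
      linear_combination (inclX K n m F) * hk
    change inclX K n m (F * f) - inclY K n m (G * g) ∈ I
    rw [e]
    exact I.add_mem (I.mul_mem_left _ hpF) (I.mul_mem_left _ hFG)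
  rw [aeval_prodMk] at hΦ
  have hΦ1 : aeval t.1 Φ = F := congrArg Prod.fst hΦ
  have hΦ2 : aeval t.2 Φ = G := congrArg Prod.snd hΦ
  obtain ⟨ht1, ht2⟩ : 0 < t.1.totalDegree ∧ 0 < t.2.totalDegree := by
    rcases totalDegree_pos_of_dvd hX hY (mem_separatedAlgebra_span.1 ht) with ⟨c, h1, -⟩ | h
    · exfalso
      have : F = MvPolynomial.C (Φ.eval c) := by
        rw [← hΦ1, h1, ← MvPolynomial.algebraMap_eq, aeval_algebraMap_apply_eq_algebraMap_eval]
      rw [this, MvPolynomial.totalDegree_C] at hF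
      exact absurd hF (lt_irrefl _)
    · exact h
  have hdF : F.totalDegree = Φ.natDegree * t.1.totalDegree := by rw [← hΦ1, totalDegree_aeval ht1]
  have hdG : G.totalDegree = Φ.natDegree * t.2.totalDegree := by rw [← hΦ2, totalDegree_aeval ht2]
  have hΦpos : 0 < Φ.natDegree := by
    rw [hdF] at hF
    exact Nat.pos_of_mul_pos_right hF
  have hΦt : aeval t Φ = (F, G) := by rw [aeval_prodMk, hΦ1, hΦ2]
  suffices hs : ∀ (k : ℕ) (φ : K[X]), φ.natDegree = k → aeval t φ ∈ separatedAlgebra I →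
      aeval t φ ∈ B by
    intro x hx
    obtain ⟨φ, rfl⟩ := hrange x hx
    exact hs _ φ rfl hx
  intro k
  induction k using Nat.strong_induction_on with
  | _ k ih =>
    intro φ hφk hφ
    by_cases hk : k ≤ 2 * Φ.natDegree
    · rw [aeval_prodMk] at hφ ⊢
      refine hB _ _ hφ ?_ ?_
      · rw [totalDegree_aeval ht1, hdF, hφk, ← mul_assoc]
        exact Nat.mul_le_mul_right _ hk
      · rw [totalDegree_aeval ht2, hdG, hφk, ← mul_assoc]
        exact Nat.mul_le_mul_right _ hk
    · push Not at hk
      have hφ0 : φ ≠ 0 := by rintro rfl; simp at hφk; omega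
      have hΦ0 : Φ ≠ 0 := by rintro h; rw [h] at hΦpos; simp at hΦpos
      -- Both `Φ` and `χ` have degree less than `k` and give elements of `A(I)`; their product has
      -- degree `k`. This is why twice the degree of `Φ` suffices as a bound.
      set χ := Φ * X ^ (k - 2 * Φ.natDegree) with hχ
      have hχd : χ.natDegree = k - Φ.natDegree := by
        rw [hχ, natDegree_mul_X_pow _ hΦ0]; omega
      have hχ0 : χ ≠ 0 := mul_ne_zero hΦ0 (pow_ne_zero _ X_ne_zero)
      have hχI : aeval t χ ∈ separatedAlgebra I := by
        rw [hχ, map_mul, hΦt]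
        refine hmul _ ?_
        rw [map_pow, aeval_X]
        exact pow_mem ht _
      have hχB : aeval t χ ∈ B := ih _ (by omega) χ hχd hχI
      have hΦB : aeval t Φ ∈ B := ih _ (by omega) Φ rfl (hΦt ▸ hFG)
      have hprodd : (Φ * χ).natDegree = k := by
        rw [natDegree_mul hΦ0 hχ0, hχd]; omega
      set c := φ.leadingCoeff / (Φ * χ).leadingCoeff with hc
      have hprod0 : (Φ * χ).leadingCoeff ≠ 0 := leadingCoeff_ne_zero.2 (mul_ne_zero hΦ0 hχ0)
      have hlt : (φ - C c * (Φ * χ)).natDegree < k := by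
        have hdeg : (φ - C c * (Φ * χ)).degree < φ.degree := by
          refine degree_sub_lt_left ?_ hφ0 ?_
          · have hc0 : c ≠ 0 := div_ne_zero (leadingCoeff_ne_zero.2 hφ0) hprod0
            rw [degree_C_mul hc0, degree_eq_natDegree hφ0, degree_eq_natDegree
              (mul_ne_zero hΦ0 hχ0), hprodd, hφk]
          · rw [leadingCoeff_mul, leadingCoeff_C, hc, div_mul_cancel₀ _ hprod0]
        by_cases h0 : φ - C c * (Φ * χ) = 0
        · rw [h0, natDegree_zero]; omega
        · rw [← hφk]; exact natDegree_lt_natDegree h0 hdeg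
      have e1 : aeval t φ = aeval t (φ - C c * (Φ * χ)) + c • (aeval t Φ * aeval t χ) := by
        rw [map_sub, map_mul, map_mul, aeval_C, Algebra.smul_def, sub_add_cancel]
      rw [e1]
      refine add_mem (ih _ hlt _ rfl ?_) (B.smul_mem (mul_mem hΦB hχB) c)
      rw [eq_sub_of_add_eq e1.symm]
      exact sub_mem hφ (Subalgebra.smul_mem _ (mul_mem (hΦt ▸ hFG) hχI) c)

theorem finite_quotient_of_ringKrullDim_le_zero {σ : Type*} [Finite σ] {I : Ideal (MvPolynomial σ K)}
    (h : ringKrullDim (MvPolynomial σ K ⧸ I) ≤ 0) : Module.Finite K (MvPolynomial σ K ⧸ I) := by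
  rw [Module.finite_iff_krullDimLE_zero]
  rwa [Ring.krullDimLE_iff]

theorem exists_monic_aeval_mem {A : Type*} [CommRing A] [Algebra K A] {I : Ideal A}
    [Module.Finite K (A ⧸ I)] (x : A) : ∃ u : K[X], u.Monic ∧ aeval x u ∈ I := by
  obtain ⟨u, hu, hx⟩ := Algebra.IsIntegral.isIntegral (R := K) (Ideal.Quotient.mk I x)
  refine ⟨u, hu, ?_⟩
  rw [← Ideal.Quotient.eq_zero_iff_mem, ← hx, ← aeval_def]
  exact (aeval_algHom_apply (Ideal.Quotient.mkₐ K I) x u).symm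

/-- Existence of a separated element as in `separatedAlgebra_le_of_totalDegree_le`. -/
theorem exists_multiplier {p : PolyXY K n m} {I₀ : Ideal (PolyXY K n m)}
    (h₀ : ringKrullDim (PolyXY K n m ⧸ I₀) ≤ 0)
    {f : MvPolynomial (Fin n) K} {g : MvPolynomial (Fin m) K}
    (hfg : p ∣ inclX K n m f - inclY K n m g) (hf : 0 < f.totalDegree) :
    ∃ F G, (F, G) ∈ separatedAlgebra (I₀ ⊓ Ideal.span {p}) ∧ 0 < F.totalDegree ∧
      p * inclX K n m F ∈ I₀ ⊓ Ideal.span {p} := by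
  have := finite_quotient_of_ringKrullDim_le_zero h₀
  obtain ⟨u, hu, hu0⟩ := exists_monic_aeval_mem (K := K) (I := I₀) (inclX K n m f)
  obtain ⟨u', hu', hu0'⟩ := exists_monic_aeval_mem (K := K) (I := I₀) (inclY K n m g)
  -- The product annihilates `f` and `g` modulo `I₀` simultaneously, so both components of the new
  -- pair lie in `I₀`; the factor `X` makes the degree positive even if `I₀` is the unit ideal.
  set y := X * (u * u') with hy
  have hymon : y.Monic := monic_X.mul (hu.mul hu')
  have hyd : 0 < y.natDegree := by
    rw [hy, monic_X.natDegree_mul (hu.mul hu'), natDegree_X]; omega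
  have hyf : aeval (inclX K n m f) y ∈ I₀ := by
    rw [hy, map_mul, map_mul]
    exact I₀.mul_mem_left _ (I₀.mul_mem_right _ hu0)
  have hyg : aeval (inclY K n m g) y ∈ I₀ := by
    rw [hy, map_mul, map_mul]
    exact I₀.mul_mem_left _ (I₀.mul_mem_left _ hu0')
  rw [aeval_algHom_apply] at hyf hyg
  refine ⟨aeval f y, aeval g y, ⟨I₀.sub_mem hyf hyg, ?_⟩, ?_, ?_, ?_⟩
  · change inclX K n m (aeval f y) - inclY K n m (aeval g y) ∈ Ideal.span {p}
    rw [Ideal.mem_span_singleton, ← aeval_algHom_apply, ← aeval_algHom_apply]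
    exact hfg.trans (by
      have := Polynomial.sub_dvd_eval_sub (inclX K n m f) (inclY K n m g) (y.map (algebraMap K _))
      rwa [eval_map_algebraMap, eval_map_algebraMap] at this)
  · rw [totalDegree_aeval hf]
    exact Nat.mul_pos hyd hf
  · exact I₀.mul_mem_left _ hyf
  · exact Ideal.mul_mem_right _ _ (Ideal.mem_span_singleton_self p)

end Generation

/-! ### Separation by ideals of finite codimension. -/

section ResidualFiniteness

variable {K : Type*} [Field K]

/-- Let `M` be a maximal ideal containing the annihilator of the class `y` of `x`. By Krull's
intersection theorem, if `y` were in all powers of `M`, then `1 - r` would annihilate `y` for some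
`r ∈ M`, so that `1 ∈ M`. Hence some power of `M` omits `y`, and its quotient is an affine algebra
with only one prime ideal, so finite-dimensional. -/
theorem exists_finite_quotient_notMem {σ : Type*} [Finite σ] {I : Ideal (MvPolynomial σ K)}
    {x : MvPolynomial σ K} (hx : x ∉ I) : ∃ C : Ideal (MvPolynomial σ K), I ≤ C ∧ x ∉ C ∧
      Module.Finite K (MvPolynomial σ K ⧸ C) := by
  set R := MvPolynomial σ K ⧸ I with hR
  set y := Ideal.Quotient.mk I x with hy
  have hy0 : y ≠ 0 := fun h => hx (Ideal.Quotient.eq_zero_iff_mem.1 h)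
  have hann : Ideal.span {y} ≠ ⊥ := by
    rw [Ne, Ideal.span_singleton_eq_bot]; exact hy0
  set A : Ideal R := (Submodule.annihilator (Ideal.span {y})) with hA
  have hAtop : A ≠ ⊤ := by
    intro h
    have h1 : (1 : R) ∈ A := h ▸ Submodule.mem_top
    rw [hA, Submodule.mem_annihilator] at h1
    exact hy0 (by simpa using h1 y (Ideal.mem_span_singleton_self y))
  obtain ⟨M, hM, hAM⟩ := Ideal.exists_le_maximal A hAtop
  have hk : ∃ k, y ∉ M ^ k := by
    by_contra! hall
    have : y ∈ (⨅ i : ℕ, M ^ i • ⊤ : Submodule R R) := by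
      rw [Submodule.mem_iInf]
      intro i
      simpa using hall i
    obtain ⟨r, hr⟩ := (Ideal.mem_iInf_smul_pow_eq_bot_iff M y).1 this
    refine hM.ne_top ((Ideal.eq_top_iff_one M).2 ?_)
    have h1 : 1 - (r : R) ∈ M := hAM (by
      rw [hA, Submodule.mem_annihilator]
      intro z hz
      obtain ⟨c, rfl⟩ := Ideal.mem_span_singleton'.1 hz
      rw [smul_eq_mul] at hr ⊢
      rw [mul_left_comm, sub_mul, hr, one_mul, sub_self, mul_zero])
    have := M.add_mem h1 r.2
    rwa [sub_add_cancel] at this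
  obtain ⟨k, hk⟩ := hk
  refine ⟨(M ^ k).comap (Ideal.Quotient.mk I), ?_, hk, ?_⟩
  · intro z hz
    rw [Ideal.mem_comap, Ideal.Quotient.eq_zero_iff_mem.2 hz]
    exact zero_mem _
  · rw [Module.finite_iff_krullDimLE_zero]
    set C := (M ^ k).comap (Ideal.Quotient.mk I)
    refine Ring.KrullDimLE.mk₀ fun (Q : Ideal (MvPolynomial σ K ⧸ C)) (hQ : Q.IsPrime) => ?_
    set Q' := Q.comap (Ideal.Quotient.mk C) with hQ'
    have hQ'p : Q'.IsPrime := Ideal.comap_isPrime _ _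
    have hM' : (M.comap (Ideal.Quotient.mk I)).IsMaximal :=
      Ideal.comap_isMaximal_of_surjective _ Ideal.Quotient.mk_surjective
    have hle : M.comap (Ideal.Quotient.mk I) ≤ Q' := by
      intro z hz
      refine hQ'p.mem_of_pow_mem k ?_
      have : z ^ k ∈ C := by
        change Ideal.Quotient.mk I (z ^ k) ∈ M ^ k
        rw [map_pow]
        exact Ideal.pow_mem_pow (Ideal.mem_comap.1 hz) k
      change Ideal.Quotient.mk C (z ^ k) ∈ Q
      rw [Ideal.Quotient.eq_zero_iff_mem.2 this]
      exact zero_mem _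
    have : Q' = M.comap (Ideal.Quotient.mk I) := (hM'.eq_of_le hQ'p.ne_top hle).symm
    have hQ'm : Q'.IsMaximal := this ▸ hM'
    have h1 := Ideal.map_comap_of_surjective (Ideal.Quotient.mk C) Ideal.Quotient.mk_surjective Q
    have h2 := Ideal.map_eq_top_or_isMaximal_of_surjective (Ideal.Quotient.mk C)
      Ideal.Quotient.mk_surjective hQ'm
    rw [hQ', h1] at h2
    exact h2.resolve_left hQ.ne_top

/-- Finite dimensional subspaces are separated by ideals of finite codimension. -/
theorem exists_finite_quotient_inf_le {σ : Type*} [Finite σ] (I : Ideal (MvPolynomial σ K))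
    (V : Submodule K (MvPolynomial σ K)) [FiniteDimensional K V] :
    ∃ C : Ideal (MvPolynomial σ K), I ≤ C ∧ (∀ x ∈ V, x ∈ C → x ∈ I) ∧
      Module.Finite K (MvPolynomial σ K ⧸ C) := by
  -- Induction on the dimension of `V ∩ C`: intersecting `C` with an ideal of finite codimension
  -- that omits a bad vector lowers it.
  suffices hs : ∀ (k : ℕ) (C : Ideal (MvPolynomial σ K)), I ≤ C →
      Module.Finite K (MvPolynomial σ K ⧸ C) →
      Module.finrank K (V ⊓ C.restrictScalars K : Submodule K _) = k →
      ∃ C : Ideal (MvPolynomial σ K), I ≤ C ∧ (∀ x ∈ V, x ∈ C → x ∈ I) ∧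
        Module.Finite K (MvPolynomial σ K ⧸ C) by
    refine hs _ ⊤ le_top ?_ rfl
    have : Subsingleton (MvPolynomial σ K ⧸ (⊤ : Ideal (MvPolynomial σ K))) :=
      Ideal.Quotient.subsingleton_iff.2 rfl
    infer_instance
  intro k
  induction k using Nat.strong_induction_on with
  | _ k ih =>
    intro C hIC hC hk
    by_cases hall : ∀ x ∈ V, x ∈ C → x ∈ I
    · exact ⟨C, hIC, hall, hC⟩
    push Not at hall
    obtain ⟨x, hxV, hxC, hxI⟩ := hall
    obtain ⟨C', hIC', hxC', hC'⟩ := exists_finite_quotient_notMem hxI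
    have hfin : Module.Finite K (MvPolynomial σ K ⧸ C ⊓ C') := by
      let ψ : MvPolynomial σ K →ₗ[K] (MvPolynomial σ K ⧸ C) × (MvPolynomial σ K ⧸ C') :=
        (Ideal.Quotient.mkₐ K C).toLinearMap.prod (Ideal.Quotient.mkₐ K C').toLinearMap
      have hker : LinearMap.ker ψ = (C ⊓ C').restrictScalars K := by
        ext z
        simp [ψ, LinearMap.mem_ker, Ideal.Quotient.eq_zero_iff_mem]
      have e := ψ.quotKerEquivRange
      have h1 : Module.Finite K (MvPolynomial σ K ⧸ LinearMap.ker ψ) := Module.Finite.equiv e.symm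
      rw [hker] at h1
      exact h1
    refine ih _ ?_ (C ⊓ C') (le_inf hIC hIC') hfin rfl
    rw [← hk]
    refine Submodule.finrank_lt_finrank_of_lt (lt_of_le_of_ne ?_ ?_)
    · exact inf_le_inf_left _ fun z hz => hz.1
    · intro heq
      have : x ∈ (V ⊓ (C ⊓ C').restrictScalars K : Submodule K _) := heq ▸ ⟨hxV, hxC⟩
      exact hxC' this.2.2

end ResidualFiniteness


/-! ### Decidable and semidecidable predicates. -/

section Computability

variable {α β γ σ : Type*} [Primcodable α] [Primcodable β] [Primcodable γ] [Primcodable σ]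

namespace Cmp

theorem id : Computable fun a : α => a := Computable.id

theorem const (s : σ) : Computable fun _ : α => s := Computable.const s

theorem fst {f : α → β × γ} (hf : Computable f) : Computable fun a => (f a).1 :=
  Computable.fst.comp hf

theorem snd {f : α → β × γ} (hf : Computable f) : Computable fun a => (f a).2 :=
  Computable.snd.comp hf

theorem pair {f : α → β} {g : α → γ} (hf : Computable f) (hg : Computable g) :
    Computable fun a => (f a, g a) := hf.pair hg

theorem append {f g : α → List β} (hf : Computable f) (hg : Computable g) :
    Computable fun a => f a ++ g a := Computable.list_append.comp hf hg

theorem cons {f : α → β} {g : α → List β} (hf : Computable f) (hg : Computable g) :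
    Computable fun a => f a :: g a := Computable.list_cons.comp hf hg

theorem length {f : α → List β} (hf : Computable f) : Computable fun a => (f a).length :=
  Computable.list_length.comp hf

theorem range {f : α → ℕ} (hf : Computable f) : Computable fun a => List.range (f a) :=
  Primrec.list_range.to_comp.comp hf

theorem add {f g : α → ℕ} (hf : Computable f) (hg : Computable g) :
    Computable fun a => f a + g a := Primrec.nat_add.to_comp.comp hf hg

theorem mul {f g : α → ℕ} (hf : Computable f) (hg : Computable g) :
    Computable fun a => f a * g a := Primrec.nat_mul.to_comp.comp hf hg

theorem getD {l : α → List β} {i : α → ℕ} (d : β) (hl : Computable l) (hi : Computable i) :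
    Computable fun a => (l a).getD (i a) d := (Primrec.list_getD d).to_comp.comp hl hi

/-- Recursion on the position in the list. The other list programs are obtained from this one. -/
theorem foldl {f : α → List β} {g : α → σ} {h : α → σ → β → σ} (hf : Computable f)
    (hg : Computable g) (hh : Computable fun p : α × σ × β => h p.1 p.2.1 p.2.2) :
    Computable fun a => (f a).foldl (h a) (g a) := by
  have step : Computable₂ fun (a : α) (p : ℕ × σ) =>
      Option.casesOn (motive := fun _ => σ) (f a)[p.1]? p.2 (fun b => h a p.2 b) := by
    refine Computable.option_casesOn (Computable.list_getElem?.comp (hf.comp Computable.fst)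
      (Computable.fst.comp Computable.snd)) (Computable.snd.comp Computable.snd) ?_
    exact hh.comp (((Computable.fst.comp Computable.fst).pair
      ((Computable.snd.comp (Computable.snd.comp Computable.fst)).pair Computable.snd)))
  refine (Computable.nat_rec (Computable.list_length.comp hf) hg step).of_eq fun a => ?_
  have key : ∀ k, k ≤ (f a).length → Nat.rec (motive := fun _ => σ) (g a) (fun y IH =>
      Option.casesOn (motive := fun _ => σ) (f a)[y]? IH (fun b => h a IH b)) k
      = ((f a).take k).foldl (h a) (g a) := by
    intro k
    induction k with
    | zero => intro _; simp
    | succ k ih =>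
      intro hk
      have hlt : k < (f a).length := hk
      rw [List.take_add_one, List.foldl_append, ← ih (Nat.le_of_succ_le hk)]
      simp [List.getElem?_eq_getElem hlt]
  have := key _ le_rfl
  rw [List.take_length] at this
  exact this

theorem flatMap {f : α → List β} {g : α → β → List γ} (hf : Computable f)
    (hg : Computable fun p : α × β => g p.1 p.2) : Computable fun a => (f a).flatMap (g a) := by
  refine (foldl (h := fun a s b => s ++ g a b) hf (const []) (append (fst (snd id))
    (hg.comp (pair (fst id) (snd (snd id)))))).of_eq fun a => ?_
  have : ∀ (l : List β) (s : List γ), l.foldl (fun s b => s ++ g a b) s = s ++ l.flatMap (g a) := by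
    intro l
    induction l with
    | nil => simp
    | cons b l ih => intro s; rw [List.foldl_cons, ih, List.flatMap_cons, List.append_assoc]
  rw [this, List.nil_append]

theorem map {f : α → List β} {g : α → β → γ} (hf : Computable f)
    (hg : Computable fun p : α × β => g p.1 p.2) : Computable fun a => (f a).map (g a) := by
  refine (flatMap (g := fun a b => [g a b]) hf (cons hg (const []))).of_eq fun a => ?_
  induction f a with
  | nil => rfl
  | cons b l ih => rw [List.flatMap_cons, ih, List.map_cons]; rfl

end Cmp

/-- Decidability by an algorithm. -/
def DecP (p : α → Prop) : Prop := ∃ f : α → Bool, Computable f ∧ ∀ a, p a ↔ f a = true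

namespace DecP

theorem of_computablePred {p : α → Prop} (h : ComputablePred p) : DecP p := by
  obtain ⟨f, hf, rfl⟩ := ComputablePred.computable_iff.1 h
  exact ⟨f, hf, fun _ => Iff.rfl⟩

theorem congr {p q : α → Prop} (h : DecP p) (H : ∀ a, q a ↔ p a) : DecP q := by
  obtain ⟨f, hf, h⟩ := h
  exact ⟨f, hf, fun a => (H a).trans (h a)⟩

theorem comp {p : β → Prop} {g : α → β} (h : DecP p) (hg : Computable g) :
    DecP fun a => p (g a) := by
  obtain ⟨f, hf, h⟩ := h
  exact ⟨_, hf.comp hg, fun a => h _⟩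

theorem eq {f g : α → β} (hf : Computable f) (hg : Computable g) : DecP fun a => f a = g a := by
  classical
  exact ⟨_, (Primrec.eq (α := β)).decide.to_comp.comp hf hg, fun a => by simp⟩

theorem le {f g : α → ℕ} (hf : Computable f) (hg : Computable g) : DecP fun a => f a ≤ g a :=
  ⟨_, Primrec.nat_le.decide.to_comp.comp hf hg, fun a => by simp⟩

theorem lt {f g : α → ℕ} (hf : Computable f) (hg : Computable g) : DecP fun a => f a < g a :=
  ⟨_, Primrec.nat_lt.decide.to_comp.comp hf hg, fun a => by simp⟩

theorem and {p q : α → Prop} (hp : DecP p) (hq : DecP q) : DecP fun a => p a ∧ q a := by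
  obtain ⟨f, hf, hp⟩ := hp
  obtain ⟨g, hg, hq⟩ := hq
  exact ⟨_, Primrec.and.to_comp.comp hf hg, fun a => by simp only [hp, hq, Bool.and_eq_true]⟩

theorem not {p : α → Prop} (hp : DecP p) : DecP fun a => ¬ p a := by
  obtain ⟨f, hf, hp⟩ := hp
  exact ⟨_, Primrec.not.to_comp.comp hf, fun a => by simp [hp]⟩

theorem ball {l : α → List β} {p : α → β → Prop} (hl : Computable l)
    (hp : DecP fun q : α × β => p q.1 q.2) : DecP fun a => ∀ b ∈ l a, p a b := by
  obtain ⟨f, hf, hp⟩ := hp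
  refine ⟨fun a => (l a).foldl (fun s b => s && f (a, b)) true, ?_, fun a => ?_⟩
  · exact Cmp.foldl hl (Cmp.const true) (Primrec.and.to_comp.comp (Cmp.fst (Cmp.snd Cmp.id))
      (hf.comp (Cmp.pair (Cmp.fst Cmp.id) (Cmp.snd (Cmp.snd Cmp.id)))))
  · have : ∀ (l : List β) (s : Bool), l.foldl (fun s b => s && f (a, b)) s = true
        ↔ s = true ∧ ∀ b ∈ l, p a b := by
      intro l
      induction l with
      | nil => simp
      | cons b l ih =>
        intro s
        rw [List.foldl_cons, ih, Bool.and_eq_true, List.forall_mem_cons, ← hp (a, b), and_assoc]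
    rw [this]
    simp

theorem ite {p : α → Prop} [DecidablePred p] {f g : α → σ} (hp : DecP p) (hf : Computable f)
    (hg : Computable g) : Computable fun a => if p a then f a else g a := by
  obtain ⟨c, hc, hp⟩ := hp
  refine (Computable.cond hc hf hg).of_eq fun a => ?_
  by_cases h : p a
  · rw [if_pos h, (hp a).1 h]; rfl
  · rw [if_neg h, Bool.eq_false_iff.2 (fun e => h ((hp a).2 e))]; rfl

end DecP

/-- Semidecidability. -/
def Sigma1 (p : α → Prop) : Prop :=
  ∃ r : α → ℕ → Prop, DecP (fun q : α × ℕ => r q.1 q.2) ∧ ∀ a, p a ↔ ∃ k, r a k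

namespace Sigma1

theorem of_decP {p : α → Prop} (h : DecP p) : Sigma1 p :=
  ⟨fun a _ => p a, h.comp (Cmp.fst Cmp.id), fun _ => by simp⟩

theorem congr {p q : α → Prop} (h : Sigma1 p) (H : ∀ a, q a ↔ p a) : Sigma1 q := by
  obtain ⟨r, hr, h⟩ := h
  exact ⟨r, hr, fun a => (H a).trans (h a)⟩

theorem unpair_fst : Computable fun q : α × ℕ => q.2.unpair.1 :=
  Cmp.fst (Computable.unpair.comp (Cmp.snd Cmp.id))

theorem unpair_snd : Computable fun q : α × ℕ => q.2.unpair.2 :=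
  Cmp.snd (Computable.unpair.comp (Cmp.snd Cmp.id))

theorem and {p q : α → Prop} (hp : Sigma1 p) (hq : Sigma1 q) : Sigma1 fun a => p a ∧ q a := by
  obtain ⟨r, hr, hp⟩ := hp
  obtain ⟨s, hs, hq⟩ := hq
  refine ⟨fun a k => r a k.unpair.1 ∧ s a k.unpair.2,
    (hr.comp (Cmp.pair (Cmp.fst Cmp.id) unpair_fst)).and
      (hs.comp (Cmp.pair (Cmp.fst Cmp.id) unpair_snd)), fun a => ?_⟩
  simp only [hp, hq]
  constructor
  · rintro ⟨⟨i, hi⟩, j, hj⟩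
    exact ⟨Nat.pair i j, by simpa using ⟨hi, hj⟩⟩
  · rintro ⟨k, h1, h2⟩
    exact ⟨⟨_, h1⟩, _, h2⟩

theorem or {p q : α → Prop} (hp : Sigma1 p) (hq : Sigma1 q) : Sigma1 fun a => p a ∨ q a := by
  obtain ⟨r, hr, hp⟩ := hp
  obtain ⟨s, hs, hq⟩ := hq
  refine ⟨fun a k => ¬ (¬ r a k ∧ ¬ s a k), (hr.not.and hs.not).not, fun a => ?_⟩
  simp only [hp, hq, ← exists_or, not_and_or, not_not]

/-- A natural number encodes a candidate together with a stage of its verification. -/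
theorem ex {p : α → β → Prop} (hp : Sigma1 fun q : α × β => p q.1 q.2) :
    Sigma1 fun a => ∃ b, p a b := by
  obtain ⟨r, ⟨f, hf, hr⟩, hp⟩ := hp
  refine ⟨fun a k => ∃ b, Encodable.decode (α := β) k.unpair.1 = some b ∧ r (a, b) k.unpair.2,
    ⟨fun q => Option.casesOn (motive := fun _ => Bool) (Encodable.decode (α := β) q.2.unpair.1)
      false (fun b => f ((q.1, b), q.2.unpair.2)), ?_, ?_⟩, fun a => ?_⟩
  · refine Computable.option_casesOn (Computable.decode.comp unpair_fst) (Cmp.const false) ?_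
    exact hf.comp (Cmp.pair (Cmp.pair (Cmp.fst (Cmp.fst Cmp.id)) (Cmp.snd Cmp.id))
      (unpair_snd.comp (Cmp.fst Cmp.id)))
  · rintro ⟨a, k⟩
    rcases h : Encodable.decode (α := β) k.unpair.1 with _ | b
    · simp [h]
    · simp [h, ← hr]
  · constructor
    · rintro ⟨b, hb⟩
      obtain ⟨k, hk⟩ := (hp (a, b)).1 hb
      exact ⟨Nat.pair (Encodable.encode b) k, b, by simp, by simpa using hk⟩
    · rintro ⟨k, b, -, hb⟩
      exact ⟨b, (hp (a, b)).2 ⟨_, hb⟩⟩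

/-- Finitely many verifications are collected in one list of elements with their stages. -/
theorem ball {l : α → List β} {p : α → β → Prop} (hl : Computable l)
    (hp : Sigma1 fun q : α × β => p q.1 q.2) : Sigma1 fun a => ∀ b ∈ l a, p a b := by
  obtain ⟨r, hr, hp⟩ := hp
  have h1 : DecP fun q : α × List (β × ℕ) => q.2.map Prod.fst = l q.1 ∧
      ∀ z ∈ q.2, r (q.1, z.1) z.2 := by
    refine (DecP.eq (Cmp.map (Cmp.snd Cmp.id) (Cmp.fst (Cmp.snd Cmp.id)))
      (hl.comp (Cmp.fst Cmp.id))).and (DecP.ball (Cmp.snd Cmp.id) (hr.comp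
        (g := fun q : (α × List (β × ℕ)) × (β × ℕ) => ((q.1.1, q.2.1), q.2.2)) ?_))
    exact Cmp.pair (Cmp.pair (Cmp.fst (Cmp.fst Cmp.id)) (Cmp.fst (Cmp.snd Cmp.id)))
      (Cmp.snd (Cmp.snd Cmp.id))
  refine (ex (p := fun a (zs : List (β × ℕ)) => zs.map Prod.fst = l a ∧
    ∀ z ∈ zs, r (a, z.1) z.2) (of_decP h1)).congr fun a => ?_
  constructor
  · intro h
    have h' : ∀ b ∈ l a, ∃ k, r (a, b) k := fun b hb => (hp (a, b)).1 (h b hb)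
    choose! k hk using h'
    refine ⟨(l a).map fun b => (b, k b), ?_, ?_⟩
    · rw [List.map_map]
      exact List.map_id _
    · intro z hz
      obtain ⟨b, hb, rfl⟩ := List.mem_map.1 hz
      exact hk b hb
  · rintro ⟨zs, hz1, hz2⟩ b hb
    have hb : b ∈ zs.map Prod.fst := by rw [hz1]; exact hb
    obtain ⟨z, hz, rfl⟩ := List.mem_map.1 hb
    exact (hp (a, z.1)).2 ⟨_, hz2 z hz⟩

/-- Unbounded search. -/
theorem exists_partrec {R : α → β → Prop} (h : Sigma1 fun q : α × β => R q.1 q.2) :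
    ∃ f : α →. β, Partrec f ∧ ∀ a, (∃ b, R a b) → ∃ b ∈ f a, R a b := by
  obtain ⟨r, ⟨f, hf, hr⟩, h⟩ := h
  -- Stage `k` decodes a candidate and a verification stage, and returns the candidate if the check
  -- succeeds.
  set g : α → ℕ → Option β := fun a k => Option.casesOn (motive := fun _ => Option β)
    (Encodable.decode (α := β) k.unpair.1) none
    (fun b => bif f ((a, b), k.unpair.2) then some b else none) with hg
  have hspec : ∀ a k b, b ∈ g a k → R a b := by
    intro a k b hb
    rcases hd : Encodable.decode (α := β) k.unpair.1 with _ | b'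
    · simp [hg, hd] at hb
    · simp only [hg, hd] at hb
      rcases hc : f ((a, b'), k.unpair.2) with _ | _
      · simp [hc] at hb
      · simp only [hc, cond_true, Option.mem_def, Option.some.injEq] at hb
        subst hb
        exact (h (a, b')).2 ⟨_, (hr ((a, b'), k.unpair.2)).2 hc⟩
  refine ⟨fun a => Nat.rfindOpt (g a), Partrec.rfindOpt ?_, ?_⟩
  · refine Computable.option_casesOn (Computable.decode.comp unpair_fst) (Cmp.const none) ?_
    exact Computable.cond (hf.comp (Cmp.pair (Cmp.pair (Cmp.fst (Cmp.fst Cmp.id)) (Cmp.snd Cmp.id))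
      (unpair_snd.comp (Cmp.fst Cmp.id)))) (Computable.option_some.comp (Cmp.snd Cmp.id))
      (Cmp.const none)
  · rintro a ⟨b, hb⟩
    obtain ⟨k, hk⟩ := (h (a, b)).1 hb
    have hdom : (Nat.rfindOpt (g a)).Dom := by
      rw [Nat.rfindOpt_dom]
      refine ⟨Nat.pair (Encodable.encode b) k, b, ?_⟩
      simp [hg, (hr ((a, b), k)).1 hk]
    refine ⟨_, Part.get_mem hdom, ?_⟩
    obtain ⟨k', hk'⟩ := Nat.rfindOpt_spec (Part.get_mem hdom)
    exact hspec a k' _ hk'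

end Sigma1

end Computability


/-! ### Codes for polynomials in countably many variables. -/

section WordCode

variable {K : Type*} [Field K]

/-- Data for a polynomial in the variables `x₀, x₁, …`: a list of terms, each given by its
coefficient and by a word in the indices of the variables. -/
abbrev WordCode (K : Type*) : Type _ := List (K × List ℕ)

/-- The monomial given by a word. -/
noncomputable def wordMonomial (K : Type*) [Field K] (w : List ℕ) : MvPolynomial ℕ K :=
  (w.map MvPolynomial.X).prod

/-- The polynomial given by a word code. -/
noncomputable def WordCode.eval (c : WordCode K) : MvPolynomial ℕ K :=
  (c.map fun t => MvPolynomial.C t.1 * wordMonomial K t.2).sum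

theorem wordMonomial_eq (w : List ℕ) :
    wordMonomial K w = MvPolynomial.monomial (Multiset.toFinsupp (w : Multiset ℕ)) 1 := by
  induction w with
  | nil => simp [wordMonomial]
  | cons k w ih =>
    rw [wordMonomial, List.map_cons, List.prod_cons, ← wordMonomial, ih, ← Multiset.cons_coe,
      ← Multiset.singleton_add, map_add, Multiset.toFinsupp_singleton, MvPolynomial.X,
      MvPolynomial.monomial_mul, one_mul]

theorem WordCode.eval_nil : WordCode.eval ([] : WordCode K) = 0 := rfl

theorem WordCode.eval_cons (t : K × List ℕ) (c : WordCode K) :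
    WordCode.eval (t :: c) = MvPolynomial.C t.1 * wordMonomial K t.2 + WordCode.eval c := by
  rw [WordCode.eval, List.map_cons, List.sum_cons]; rfl

theorem WordCode.eval_append (c d : WordCode K) :
    WordCode.eval (c ++ d) = WordCode.eval c + WordCode.eval d := by
  rw [WordCode.eval, List.map_append, List.sum_append]; rfl

theorem WordCode.eval_flatMap {β : Type*} (l : List β) (f : β → WordCode K) :
    WordCode.eval (l.flatMap f) = (l.map fun b => WordCode.eval (f b)).sum := by
  induction l with
  | nil => rfl
  | cons b l ih => rw [List.flatMap_cons, WordCode.eval_append, ih, List.map_cons, List.sum_cons]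

open Classical in
/-- The coefficient at the monomial of the word `w`. -/
noncomputable def WordCode.coeff (c : WordCode K) (w : List ℕ) : K :=
  (c.map fun t => if t.2.Perm w then t.1 else 0).sum

theorem WordCode.coeff_eval (c : WordCode K) (w : List ℕ) :
    (WordCode.eval c).coeff (Multiset.toFinsupp (w : Multiset ℕ)) = WordCode.coeff c w := by
  induction c with
  | nil => simp [WordCode.eval_nil, WordCode.coeff]
  | cons t c ih =>
    rw [WordCode.eval_cons, MvPolynomial.coeff_add, ih, MvPolynomial.coeff_C_mul, wordMonomial_eq,
      MvPolynomial.coeff_monomial, WordCode.coeff, WordCode.coeff, List.map_cons, List.sum_cons]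
    congr 1
    by_cases h : t.2.Perm w
    · rw [if_pos h, if_pos (by rw [Multiset.coe_eq_coe.2 h]), mul_one]
    · rw [if_neg h, if_neg, mul_zero]
      intro e
      exact h (Multiset.coe_eq_coe.1 (Multiset.toFinsupp.injective e))

/-- Only monomials listed in the code can have nonzero coefficients, so finitely many tests decide
equality of polynomials. -/
theorem WordCode.eval_eq_zero_iff (c : WordCode K) :
    WordCode.eval c = 0 ↔ ∀ t ∈ c, WordCode.coeff c t.2 = 0 := by
  constructor
  · intro h t _
    rw [← WordCode.coeff_eval, h, MvPolynomial.coeff_zero]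
  · intro h
    ext e
    rw [MvPolynomial.coeff_zero]
    by_cases he : ∃ t ∈ c, Multiset.toFinsupp (t.2 : Multiset ℕ) = e
    · obtain ⟨t, ht, rfl⟩ := he
      rw [WordCode.coeff_eval, h t ht]
    · obtain ⟨w, rfl⟩ : ∃ w : List ℕ, Multiset.toFinsupp (w : Multiset ℕ) = e := by
        refine ⟨(Multiset.toFinsupp.symm e).toList, ?_⟩
        rw [Multiset.coe_toList, AddEquiv.apply_symm_apply]
      rw [WordCode.coeff_eval, WordCode.coeff]
      refine List.sum_eq_zero fun x hx => ?_
      obtain ⟨t, ht, rfl⟩ := List.mem_map.1 hx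
      rw [if_neg]
      exact fun hp => he ⟨t, ht, by rw [Multiset.coe_eq_coe.2 hp]⟩

theorem WordCode.eval_surjective : Function.Surjective (WordCode.eval (K := K)) := by
  intro q
  induction q using MvPolynomial.induction_on' with
  | monomial e c =>
    refine ⟨[(c, (Multiset.toFinsupp.symm e).toList)], ?_⟩
    rw [WordCode.eval_cons, WordCode.eval_nil, add_zero, wordMonomial_eq, Multiset.coe_toList,
      AddEquiv.apply_symm_apply, MvPolynomial.C_mul_monomial, mul_one]
  | add p q hp hq =>
    obtain ⟨c, rfl⟩ := hp
    obtain ⟨d, rfl⟩ := hq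
    exact ⟨c ++ d, WordCode.eval_append c d⟩

/-- Product of word codes. -/
def WordCode.mul (c d : WordCode K) : WordCode K :=
  c.flatMap fun s => d.map fun t => (s.1 * t.1, s.2 ++ t.2)

theorem wordMonomial_append (u w : List ℕ) :
    wordMonomial K (u ++ w) = wordMonomial K u * wordMonomial K w := by
  rw [wordMonomial, List.map_append, List.prod_append]; rfl

theorem WordCode.eval_mul (c d : WordCode K) :
    WordCode.eval (c.mul d) = WordCode.eval c * WordCode.eval d := by
  have h : ∀ s : K × List ℕ, WordCode.eval (d.map fun t => (s.1 * t.1, s.2 ++ t.2))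
      = MvPolynomial.C s.1 * wordMonomial K s.2 * WordCode.eval d := by
    intro s
    induction d with
    | nil => simp [WordCode.eval_nil]
    | cons t d ih =>
      rw [List.map_cons, WordCode.eval_cons, ih, WordCode.eval_cons, wordMonomial_append,
        MvPolynomial.C_mul]
      ring
  rw [WordCode.mul, WordCode.eval_flatMap]
  simp only [h]
  rw [List.sum_map_mul_right]
  rfl

/-- Negation of word codes. -/
def WordCode.neg (c : WordCode K) : WordCode K := c.map fun t => (-t.1, t.2)

theorem WordCode.eval_neg (c : WordCode K) : WordCode.eval c.neg = - WordCode.eval c := by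
  induction c with
  | nil => simp [WordCode.neg, WordCode.eval_nil]
  | cons t c ih =>
    rw [WordCode.neg, List.map_cons, WordCode.eval_cons, ← WordCode.neg, ih, WordCode.eval_cons,
      map_neg]
    ring

/-- Product of the codes in a list at the letters of a word. -/
def WordCode.prod (gs : List (WordCode K)) (w : List ℕ) : WordCode K :=
  w.foldl (fun acc k => acc.mul (gs.getD k [])) [(1, [])]

theorem WordCode.eval_const (r : K) : WordCode.eval [(r, [])] = MvPolynomial.C r := by
  rw [WordCode.eval_cons, WordCode.eval_nil]
  simp [wordMonomial]

theorem WordCode.eval_prod (gs : List (WordCode K)) (w : List ℕ) :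
    WordCode.eval (WordCode.prod gs w) = (w.map fun k => WordCode.eval (gs.getD k [])).prod := by
  have : ∀ (w : List ℕ) (acc : WordCode K),
      WordCode.eval (w.foldl (fun acc k => acc.mul (gs.getD k [])) acc)
        = WordCode.eval acc * (w.map fun k => WordCode.eval (gs.getD k [])).prod := by
    intro w
    induction w with
    | nil => intro acc; simp
    | cons k w ih =>
      intro acc
      rw [List.foldl_cons, ih, WordCode.eval_mul, List.map_cons, List.prod_cons, mul_assoc]
  rw [WordCode.prod, this, WordCode.eval_const, MvPolynomial.C_1, one_mul]

/-- Substitution of word codes for the variables. -/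
def WordCode.subst (gs : List (WordCode K)) (c : WordCode K) : WordCode K :=
  c.flatMap fun t => WordCode.mul [(t.1, [])] (WordCode.prod gs t.2)

theorem WordCode.aeval_eval {B : Type*} [CommRing B] [Algebra K B] (y : ℕ → B) (c : WordCode K) :
    MvPolynomial.aeval y (WordCode.eval c)
      = (c.map fun t => algebraMap K B t.1 * (t.2.map y).prod).sum := by
  induction c with
  | nil => simp [WordCode.eval_nil]
  | cons t c ih =>
    rw [WordCode.eval_cons, map_add, ih, List.map_cons, List.sum_cons, map_mul,
      MvPolynomial.aeval_C, wordMonomial, map_list_prod, List.map_map]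
    congr 4
    funext k
    simp

theorem WordCode.eval_subst (gs : List (WordCode K)) (c : WordCode K) :
    WordCode.eval (WordCode.subst gs c)
      = MvPolynomial.aeval (fun k => WordCode.eval (gs.getD k [])) (WordCode.eval c) := by
  rw [WordCode.subst, WordCode.eval_flatMap, WordCode.aeval_eval]
  congr 1
  refine List.map_congr_left fun t _ => ?_
  rw [WordCode.eval_mul, WordCode.eval_const, WordCode.eval_prod]
  rfl

/-- Value of a word code at a point. -/
def WordCode.value (vs : List K) (c : WordCode K) : K :=
  (c.map fun t => t.1 * (t.2.map fun k => vs.getD k 0).prod).sum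

theorem WordCode.value_eq (vs : List K) (c : WordCode K) :
    c.value vs = MvPolynomial.aeval (fun k => vs.getD k 0) (WordCode.eval c) := by
  rw [WordCode.aeval_eval]; rfl

/-- Linear combination of word codes. -/
def WordCode.comb (cs L : List (WordCode K)) : WordCode K :=
  (List.range L.length).flatMap fun i => (cs.getD i []).mul (L.getD i [])

theorem WordCode.eval_comb (cs L : List (WordCode K)) : WordCode.eval (WordCode.comb cs L)
    = ∑ i ∈ Finset.range L.length, WordCode.eval (cs.getD i []) * WordCode.eval (L.getD i []) := by
  rw [WordCode.comb, WordCode.eval_flatMap, Finset.sum_range, ← List.sum_ofFn]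
  congr 1
  rw [List.ofFn_eq_map, ← List.map_coe_finRange_eq_range, List.map_map]
  exact List.map_congr_left fun i _ => WordCode.eval_mul _ _

/-- The word code of a univariate polynomial in the variable `k`. -/
def univariateWord (k : ℕ) (τ : List K) : WordCode K :=
  (List.range τ.length).map fun i => (τ.getD i 0, (List.range i).map fun _ => k)

theorem univariate_eq_sum (τ : List K) :
    univariate τ = ∑ i ∈ Finset.range τ.length, C (τ.getD i 0) * X ^ i := by
  induction τ with
  | nil => rfl
  | cons a τ ih =>
    rw [univariate, ih, List.length_cons, Finset.sum_range_succ']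
    simp only [List.getD_cons_zero, List.getD_cons_succ, pow_zero, mul_one, Finset.mul_sum]
    rw [add_comm]
    congr 1
    refine Finset.sum_congr rfl fun i _ => ?_
    ring

theorem eval_univariateWord (k : ℕ) (τ : List K) :
    WordCode.eval (univariateWord k τ) = aeval (MvPolynomial.X k) (univariate τ) := by
  have h : ∀ l : List ℕ, WordCode.eval (l.map fun i => (τ.getD i 0, (List.range i).map fun _ => k))
      = (l.map fun i => MvPolynomial.C (τ.getD i 0) * MvPolynomial.X k ^ i).sum := by
    intro l
    induction l with
    | nil => rfl
    | cons i l ih =>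
      rw [List.map_cons, WordCode.eval_cons, ih, List.map_cons, List.sum_cons]
      congr 2
      simp [wordMonomial]
  rw [univariateWord, h, univariate_eq_sum, map_sum, Finset.sum_range, ← List.sum_ofFn]
  congr 1
  rw [List.ofFn_eq_map, ← List.map_coe_finRange_eq_range, List.map_map]
  refine List.map_congr_left fun i _ => ?_
  simp

theorem univariate_surjective : Function.Surjective (univariate (K := K)) := by
  intro q
  refine ⟨(List.range (q.natDegree + 1)).map q.coeff, ?_⟩
  rw [univariate_eq_sum, List.length_map, List.length_range]
  conv_rhs => rw [q.as_sum_range_C_mul_X_pow]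
  refine Finset.sum_congr rfl fun i hi => ?_
  rw [List.getD_eq_getElem _ _ (by simpa using hi)]
  simp

end WordCode

/-! ### Codes for polynomials in two groups of variables. -/

section Conversion

variable {K : Type*} [Field K]

/-- The word of an exponent list, in the letters `o, …, o + n - 1`. -/
def expWord (o n : ℕ) (e : List ℕ) : List ℕ :=
  (List.range n).flatMap fun i => (List.range (e.getD i 0)).map fun _ => o + i

theorem wordMonomial_expWord (o n : ℕ) (e : List ℕ) :
    wordMonomial K (expWord o n e) = ∏ i : Fin n, MvPolynomial.X (o + i) ^ e.getD i 0 := by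
  have h : ∀ l : List ℕ, wordMonomial K (l.flatMap fun i => (List.range (e.getD i 0)).map fun _ => o + i)
      = (l.map fun i => MvPolynomial.X (o + i) ^ e.getD i 0).prod := by
    intro l
    induction l with
    | nil => rfl
    | cons i l ih =>
      rw [List.flatMap_cons, wordMonomial_append, ih, List.map_cons, List.prod_cons]
      congr 1
      simp [wordMonomial]
  rw [expWord, h, ← List.prod_ofFn, List.ofFn_eq_map, ← List.map_coe_finRange_eq_range, List.map_map]
  rfl

/-- Word code of a polynomial in `n` variables, which become the letters `o, …, o + n - 1`. -/
def codeX (o n : ℕ) (c : PolyCode K) : WordCode K := c.map fun t => (t.1, expWord o n t.2)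

theorem PolyCode.toPoly_cons (n : ℕ) (t : K × List ℕ) (c : PolyCode K) :
    PolyCode.toPoly n (t :: c) = MvPolynomial.monomial
      (Finsupp.equivFunOnFinite.symm fun i : Fin n => t.2.getD i 0) t.1 + PolyCode.toPoly n c := by
  rw [PolyCode.toPoly, List.map_cons, List.sum_cons]; rfl

theorem PolyXYCode.toPoly_cons (n m : ℕ) (t : K × List ℕ × List ℕ) (c : PolyXYCode K) :
    PolyXYCode.toPoly n m (t :: c) = MvPolynomial.monomial (Finsupp.equivFunOnFinite.symm
      (Sum.elim (fun i : Fin n => t.2.1.getD i 0) (fun j : Fin m => t.2.2.getD j 0))) t.1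
      + PolyXYCode.toPoly n m c := by
  rw [PolyXYCode.toPoly, List.map_cons, List.sum_cons]; rfl

theorem eval_codeX (o n : ℕ) (c : PolyCode K) :
    WordCode.eval (codeX o n c)
      = MvPolynomial.rename (fun i : Fin n => o + (i : ℕ)) (PolyCode.toPoly n c) := by
  induction c with
  | nil => simp [codeX, PolyCode.toPoly, WordCode.eval_nil]
  | cons t c ih =>
    rw [codeX, List.map_cons, WordCode.eval_cons, ← codeX, ih, PolyCode.toPoly_cons,
      map_add]
    congr 1
    rw [wordMonomial_expWord, MvPolynomial.monomial_eq, map_mul, MvPolynomial.rename_C,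
      Finsupp.prod_fintype _ _ (by simp), map_prod]
    simp

/-- Word code of a polynomial in two groups of variables. -/
def codeXY (n m : ℕ) (c : PolyXYCode K) : WordCode K :=
  c.map fun t => (t.1, expWord 0 n t.2.1 ++ expWord n m t.2.2)

/-- Numbering of the variables. -/
def varIndex (n m : ℕ) : Fin n ⊕ Fin m → ℕ := Sum.elim (fun i => (i : ℕ)) (fun j => n + (j : ℕ))

theorem varIndex_injective (n m : ℕ) : Function.Injective (varIndex n m) := by
  rintro (i | i) (j | j) h <;> simp only [varIndex, Sum.elim_inl, Sum.elim_inr] at h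
  · exact congrArg _ (Fin.ext h)
  · omega
  · omega
  · exact congrArg _ (Fin.ext (by omega))

theorem eval_codeXY (n m : ℕ) (c : PolyXYCode K) :
    WordCode.eval (codeXY n m c)
      = MvPolynomial.rename (varIndex n m) (PolyXYCode.toPoly n m c) := by
  induction c with
  | nil => simp [codeXY, PolyXYCode.toPoly, WordCode.eval_nil]
  | cons t c ih =>
    rw [codeXY, List.map_cons, WordCode.eval_cons, ← codeXY, ih,
      PolyXYCode.toPoly_cons, map_add]
    congr 1
    rw [wordMonomial_append, wordMonomial_expWord, wordMonomial_expWord, MvPolynomial.monomial_eq,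
      map_mul, MvPolynomial.rename_C, Finsupp.prod_fintype _ _ (by simp), map_prod,
      Fintype.prod_sum_type]
    simp [varIndex]

theorem rename_inclX (n m : ℕ) (f : MvPolynomial (Fin n) K) :
    MvPolynomial.rename (varIndex n m) (inclX K n m f)
      = MvPolynomial.rename (fun i : Fin n => 0 + (i : ℕ)) f := by
  rw [inclX, MvPolynomial.rename_rename]
  congr 2
  funext i
  simp [varIndex]

theorem rename_inclY (n m : ℕ) (f : MvPolynomial (Fin m) K) :
    MvPolynomial.rename (varIndex n m) (inclY K n m f)
      = MvPolynomial.rename (fun i : Fin m => n + (i : ℕ)) f := by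
  rw [inclY, MvPolynomial.rename_rename]
  rfl

theorem PolyCode.toPoly_append (n : ℕ) (c d : PolyCode K) :
    PolyCode.toPoly n (c ++ d) = PolyCode.toPoly n c + PolyCode.toPoly n d := by
  rw [PolyCode.toPoly, List.map_append, List.sum_append]; rfl

theorem PolyCode.toPoly_singleton_ofFn {n : ℕ} (e : Fin n →₀ ℕ) (c : K) :
    PolyCode.toPoly n [(c, List.ofFn e)] = MvPolynomial.monomial e c := by
  rw [PolyCode.toPoly, List.map_singleton, List.sum_singleton]
  congr 1
  congr 1
  ext i
  simp

theorem PolyCode.toPoly_surjective (n : ℕ) : Function.Surjective (PolyCode.toPoly (K := K) n) := by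
  intro q
  induction q using MvPolynomial.induction_on' with
  | monomial e c => exact ⟨_, PolyCode.toPoly_singleton_ofFn e c⟩
  | add p q hp hq =>
    obtain ⟨c, rfl⟩ := hp
    obtain ⟨d, rfl⟩ := hq
    exact ⟨c ++ d, PolyCode.toPoly_append n c d⟩

open Classical in
/-- The retraction of `rename (varIndex n m)`. -/
noncomputable def unrename (K : Type*) [Field K] (n m : ℕ) : MvPolynomial ℕ K →ₐ[K] PolyXY K n m :=
  MvPolynomial.killCompl (varIndex_injective n m)

theorem unrename_rename (n m : ℕ) (p : PolyXY K n m) :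
    unrename K n m (MvPolynomial.rename (varIndex n m) p) = p :=
  MvPolynomial.killCompl_rename_app _ _

end Conversion


/-! ### Computability of the polynomial operations. -/

section Programs

variable {K : Type*} [Field K] [Primcodable K] {α β : Type*} [Primcodable α] [Primcodable β]

namespace Cmp

theorem kadd (hK : IsComputableField K) {f g : α → K} (hf : Computable f) (hg : Computable g) :
    Computable fun a => f a + g a := hK.add.comp hf hg

theorem kmul (hK : IsComputableField K) {f g : α → K} (hf : Computable f) (hg : Computable g) :
    Computable fun a => f a * g a := hK.mul.comp hf hg

theorem kneg (hK : IsComputableField K) {f : α → K} (hf : Computable f) :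
    Computable fun a => - f a := hK.neg.comp hf

theorem ksum (hK : IsComputableField K) {l : α → List K} (hl : Computable l) :
    Computable fun a => (l a).sum := by
  refine (foldl (h := fun _ s b => s + b) hl (const 0)
    (kadd hK (fst (snd id)) (snd (snd id)))).of_eq fun a => ?_
  rw [List.sum_eq_foldl]

theorem kprod (hK : IsComputableField K) {l : α → List K} (hl : Computable l) :
    Computable fun a => (l a).prod := by
  refine (foldl (h := fun _ s b => s * b) hl (const 1)
    (kmul hK (fst (snd id)) (snd (snd id)))).of_eq fun a => ?_
  rw [List.prod_eq_foldl]

theorem count {a : α → ℕ} {l : α → List ℕ} (ha : Computable a) (hl : Computable l) :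
    Computable fun x => (l x).count (a x) := by
  refine (foldl (h := fun x s b => if b = a x then s + 1 else s) hl (const 0)
    (DecP.ite (DecP.eq (snd (snd id)) (ha.comp (fst id))) (add (fst (snd id)) (const 1))
      (fst (snd id)))).of_eq fun x => ?_
  have : ∀ (l : List ℕ) (s : ℕ), l.foldl (fun s b => if b = a x then s + 1 else s) s
      = s + l.count (a x) := by
    intro l
    induction l with
    | nil => simp
    | cons b l ih =>
      intro s
      rw [List.foldl_cons, ih, List.count_cons]
      by_cases h : b = a x
      · simp [h]; omega
      · simp [h]
  rw [this, zero_add]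

end Cmp

/-- Counts need to be compared only at letters that occur in one of the words. -/
theorem DecP.perm {f g : α → List ℕ} (hf : Computable f) (hg : Computable g) :
    DecP fun a => (f a).Perm (g a) := by
  refine (DecP.ball (l := fun a => f a ++ g a)
    (p := fun a k => (f a).count k = (g a).count k) (Cmp.append hf hg)
    (DecP.eq (Cmp.count (Cmp.snd Cmp.id) (hf.comp (Cmp.fst Cmp.id)))
      (Cmp.count (Cmp.snd Cmp.id) (hg.comp (Cmp.fst Cmp.id))))).congr fun a => ?_
  rw [List.perm_iff_count]
  constructor
  · exact fun h k _ => h k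
  · intro h k
    by_cases hk : k ∈ f a ++ g a
    · exact h k hk
    · rw [List.mem_append, not_or] at hk
      rw [List.count_eq_zero.2 hk.1, List.count_eq_zero.2 hk.2]

namespace Cmp

theorem wcoeff (hK : IsComputableField K) {c : α → WordCode K} {w : α → List ℕ} (hc : Computable c)
    (hw : Computable w) : Computable fun a => WordCode.coeff (c a) (w a) := by
  classical
  refine ksum hK (map hc (DecP.ite (p := fun p : α × (K × List ℕ) => p.2.2.Perm (w p.1))
    (DecP.perm (snd (snd id)) (hw.comp (fst id))) (fst (snd id)) (const 0)))

theorem wmul (hK : IsComputableField K) {c d : α → WordCode K} (hc : Computable c)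
    (hd : Computable d) : Computable fun a => WordCode.mul (c a) (d a) :=
  flatMap hc (map (hd.comp (fst id)) (pair (kmul hK (fst (snd (fst id))) (fst (snd id)))
    (append (snd (snd (fst id))) (snd (snd id)))))

theorem wneg (hK : IsComputableField K) {c : α → WordCode K} (hc : Computable c) :
    Computable fun a => WordCode.neg (c a) :=
  map hc (pair (kneg hK (fst (snd id))) (snd (snd id)))

theorem wprod (hK : IsComputableField K) {gs : α → List (WordCode K)} {w : α → List ℕ}
    (hg : Computable gs) (hw : Computable w) : Computable fun a => WordCode.prod (gs a) (w a) :=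
  foldl hw (const _) (wmul hK (fst (snd id)) (getD [] (hg.comp (fst id)) (snd (snd id))))

theorem wsubst (hK : IsComputableField K) {gs : α → List (WordCode K)} {c : α → WordCode K}
    (hg : Computable gs) (hc : Computable c) : Computable fun a => WordCode.subst (gs a) (c a) :=
  flatMap hc (wmul hK (cons (pair (fst (snd id)) (const [])) (const []))
    (wprod hK (hg.comp (fst id)) (snd (snd id))))

theorem wvalue (hK : IsComputableField K) {vs : α → List K} {c : α → WordCode K}
    (hv : Computable vs) (hc : Computable c) : Computable fun a => WordCode.value (vs a) (c a) :=
  ksum hK (map hc (kmul hK (fst (snd id)) (kprod hK (map (snd (snd id))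
    (getD 0 (hv.comp (fst (fst id))) (snd id))))))

theorem wcomb (hK : IsComputableField K) {cs L : α → List (WordCode K)} (hc : Computable cs)
    (hL : Computable L) : Computable fun a => WordCode.comb (cs a) (L a) :=
  flatMap (range (length hL)) (wmul hK (getD [] (hc.comp (fst id)) (snd id))
    (getD [] (hL.comp (fst id)) (snd id)))

theorem univariateWord {k : α → ℕ} {τ : α → List K} (hk : Computable k) (hτ : Computable τ) :
    Computable fun a => univariateWord (k a) (τ a) :=
  map (range (length hτ)) (pair (getD 0 (hτ.comp (fst id)) (snd id))
    (map (range (snd id)) (hk.comp (fst (fst id)))))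

theorem expWord {o n : α → ℕ} {e : α → List ℕ} (ho : Computable o) (hn : Computable n)
    (he : Computable e) : Computable fun a => expWord (o a) (n a) (e a) :=
  flatMap (range hn) (map (range (getD 0 (he.comp (fst id)) (snd id)))
    (add (ho.comp (fst (fst id))) (snd (fst id))))

theorem codeX {F : Type*} [Primcodable F] {o n : α → ℕ} {c : α → PolyCode F} (ho : Computable o) (hn : Computable n)
    (hc : Computable c) : Computable fun a => codeX (o a) (n a) (c a) :=
  map hc (pair (fst (snd id)) (expWord (ho.comp (fst id)) (hn.comp (fst id)) (snd (snd id))))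

theorem codeXY {F : Type*} [Primcodable F] {n m : α → ℕ} {c : α → PolyXYCode F} (hn : Computable n) (hm : Computable m)
    (hc : Computable c) : Computable fun a => codeXY (n a) (m a) (c a) :=
  map hc (pair (fst (snd id)) (append
    (expWord (const 0) (hn.comp (fst id)) (fst (snd (snd id))))
    (expWord (hn.comp (fst id)) (hm.comp (fst id)) (snd (snd (snd id))))))

end Cmp

theorem DecP.eval_eq_zero (hK : IsComputableField K) {c : α → WordCode K} (hc : Computable c) :
    DecP fun a => WordCode.eval (c a) = 0 :=
  (DecP.ball (p := fun a (t : K × List ℕ) => WordCode.coeff (c a) t.2 = 0) hc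
    (DecP.eq (Cmp.wcoeff hK (hc.comp (Cmp.fst Cmp.id)) (Cmp.snd (Cmp.snd Cmp.id)))
      (Cmp.const 0))).congr fun a => WordCode.eval_eq_zero_iff (c a)

theorem DecP.eval_eq (hK : IsComputableField K) {c d : α → WordCode K} (hc : Computable c)
    (hd : Computable d) : DecP fun a => WordCode.eval (c a) = WordCode.eval (d a) :=
  (DecP.eval_eq_zero hK (Cmp.append hc (Cmp.wneg hK hd))).congr fun a => by
    rw [WordCode.eval_append, WordCode.eval_neg, ← sub_eq_add_neg, sub_eq_zero]

end Programs

/-! ### Certificates for membership in ideals and algebras. -/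

section Membership

variable {K : Type*} [Field K]

/-- Membership in an ideal, by a representation as a linear combination of the generators. -/
def MemIdeal (n m : ℕ) (L : List (PolyXYCode K)) (c : WordCode K) : Prop :=
  ∃ cs : List (WordCode K), WordCode.eval c = WordCode.eval (WordCode.comb cs (L.map (codeXY n m)))

theorem Sigma1.memIdeal [Primcodable K] (hK : IsComputableField K) {α : Type*} [Primcodable α]
    {n m : α → ℕ} {L : α → List (PolyXYCode K)} {c : α → WordCode K} (hn : Computable n)
    (hm : Computable m) (hL : Computable L) (hc : Computable c) :
    Sigma1 fun a => MemIdeal (n a) (m a) (L a) (c a) := by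
  refine Sigma1.ex (Sigma1.of_decP (DecP.eval_eq hK (hc.comp (Cmp.fst Cmp.id))
    (Cmp.wcomb hK (Cmp.snd Cmp.id) (Cmp.map (hL.comp (Cmp.fst Cmp.id)) ?_))))
  exact Cmp.codeXY (hn.comp (Cmp.fst (Cmp.fst Cmp.id))) (hm.comp (Cmp.fst (Cmp.fst Cmp.id)))
    (Cmp.snd Cmp.id)

theorem eval_getD_map_codeXY (n m : ℕ) (L : List (PolyXYCode K)) (i : ℕ) :
    WordCode.eval ((L.map (codeXY n m)).getD i [])
      = MvPolynomial.rename (varIndex n m) (PolyXYCode.toPoly n m (L.getD i [])) := by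
  have : (L.map (codeXY n m)).getD i [] = codeXY n m (L.getD i []) := by
    simp only [List.getD_eq_getElem?_getD, List.getElem?_map]
    rcases L[i]? with _ | c <;> rfl
  rw [this, eval_codeXY]

/-- The coefficients in a certificate may involve any of the countably many variables; the
retraction `unrename` brings the representation back to `𝕂[X, Y]`. -/
theorem memIdeal_iff {n m : ℕ} {L : List (PolyXYCode K)} {c : WordCode K} {q : PolyXY K n m}
    (hc : WordCode.eval c = MvPolynomial.rename (varIndex n m) q) :
    MemIdeal n m L c ↔ q ∈ idealOf n m L := by
  constructor
  · rintro ⟨cs, h⟩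
    have := congrArg (unrename K n m) h
    rw [hc, unrename_rename, WordCode.eval_comb, map_sum] at this
    rw [this]
    refine Ideal.sum_mem _ fun i hi => ?_
    rw [map_mul, eval_getD_map_codeXY, unrename_rename]
    refine Ideal.mul_mem_left _ _ (Ideal.subset_span ⟨L.getD i [], ?_, rfl⟩)
    rw [Finset.mem_range, List.length_map] at hi
    rw [List.getD_eq_getElem _ _ hi]
    exact List.getElem_mem hi
  · intro h
    have key : ∃ a : ℕ → PolyXY K n m,
        q = ∑ i ∈ Finset.range L.length, a i * PolyXYCode.toPoly n m (L.getD i []) := by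
      refine Submodule.span_induction (p := fun q _ => ∃ a : ℕ → PolyXY K n m,
        q = ∑ i ∈ Finset.range L.length, a i * PolyXYCode.toPoly n m (L.getD i [])) ?_ ?_ ?_ ?_ h
      · rintro _ ⟨c, hcL, rfl⟩
        obtain ⟨j, hj, rfl⟩ := List.getElem_of_mem hcL
        refine ⟨fun i => if i = j then 1 else 0, ?_⟩
        rw [Finset.sum_eq_single j]
        · beta_reduce
          rw [if_pos rfl, one_mul, List.getD_eq_getElem _ _ hj]
        · intro i _ hij
          beta_reduce
          rw [if_neg hij, zero_mul]
        · intro hj'; exact absurd (Finset.mem_range.2 hj) hj'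
      · exact ⟨0, by simp⟩
      · rintro x y _ _ ⟨a, rfl⟩ ⟨b, rfl⟩
        exact ⟨a + b, by simp only [Pi.add_apply, add_mul, Finset.sum_add_distrib]⟩
      · rintro r x _ ⟨a, rfl⟩
        exact ⟨fun i => r * a i, by rw [smul_eq_mul, Finset.mul_sum]; simp only [mul_assoc]⟩
    obtain ⟨a, ha⟩ := key
    choose code hcode using WordCode.eval_surjective (K := K)
    refine ⟨(List.range L.length).map fun i => code (MvPolynomial.rename (varIndex n m) (a i)), ?_⟩
    rw [hc, WordCode.eval_comb, ha, map_sum, List.length_map]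
    refine Finset.sum_congr rfl fun i hi => ?_
    rw [Finset.mem_range] at hi
    rw [map_mul, eval_getD_map_codeXY]
    congr 1
    rw [List.getD_eq_getElem _ _ (by simpa using hi), List.getElem_map, hcode, List.getElem_range]

/-- The pair of polynomials given by a pair of codes. -/
noncomputable def pairOf (n m : ℕ) (c : PolyCode K × PolyCode K) :
    MvPolynomial (Fin n) K × MvPolynomial (Fin m) K :=
  (PolyCode.toPoly n c.1, PolyCode.toPoly m c.2)

/-- Certificate for membership of a pair in the sum of the algebra generated by `out` and the
space spanned by `ws`. -/
def SpanCert (n m : ℕ) (out ws : List (PolyCode K × PolyCode K)) (fg : PolyCode K × PolyCode K) :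
    Prop :=
  ∃ hl : WordCode K × WordCode K, (∀ t ∈ hl.2, t.2.length = 1) ∧
    WordCode.eval (WordCode.subst (out.map fun c => codeX 0 n c.1) hl.1
      ++ WordCode.subst (ws.map fun c => codeX 0 n c.1) hl.2) = WordCode.eval (codeX 0 n fg.1) ∧
    WordCode.eval (WordCode.subst (out.map fun c => codeX n m c.2) hl.1
      ++ WordCode.subst (ws.map fun c => codeX n m c.2) hl.2) = WordCode.eval (codeX n m fg.2)

theorem Sigma1.spanCert [Primcodable K] (hK : IsComputableField K) {α : Type*} [Primcodable α]
    {n m : α → ℕ} {out ws : α → List (PolyCode K × PolyCode K)} {fg : α → PolyCode K × PolyCode K}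
    (hn : Computable n) (hm : Computable m) (ho : Computable out) (hw : Computable ws)
    (hf : Computable fg) : Sigma1 fun a => SpanCert (n a) (m a) (out a) (ws a) (fg a) := by
  refine Sigma1.ex (Sigma1.of_decP (DecP.and ?_ (DecP.and ?_ ?_)))
  · exact DecP.ball (Cmp.snd (Cmp.snd Cmp.id))
      (DecP.eq (Cmp.length (Cmp.snd (Cmp.snd Cmp.id))) (Cmp.const 1))
  · refine DecP.eval_eq hK (Cmp.append (Cmp.wsubst hK (Cmp.map (ho.comp (Cmp.fst Cmp.id)) ?_)
      (Cmp.fst (Cmp.snd Cmp.id))) (Cmp.wsubst hK (Cmp.map (hw.comp (Cmp.fst Cmp.id)) ?_)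
      (Cmp.snd (Cmp.snd Cmp.id)))) (Cmp.codeX (Cmp.const 0) (hn.comp (Cmp.fst Cmp.id))
        (Cmp.fst (hf.comp (Cmp.fst Cmp.id)))) <;>
    exact Cmp.codeX (Cmp.const 0) (hn.comp (Cmp.fst (Cmp.fst Cmp.id))) (Cmp.fst (Cmp.snd Cmp.id))
  · refine DecP.eval_eq hK (Cmp.append (Cmp.wsubst hK (Cmp.map (ho.comp (Cmp.fst Cmp.id)) ?_)
      (Cmp.fst (Cmp.snd Cmp.id))) (Cmp.wsubst hK (Cmp.map (hw.comp (Cmp.fst Cmp.id)) ?_)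
      (Cmp.snd (Cmp.snd Cmp.id)))) (Cmp.codeX (hn.comp (Cmp.fst Cmp.id)) (hm.comp (Cmp.fst Cmp.id))
        (Cmp.snd (hf.comp (Cmp.fst Cmp.id)))) <;>
    exact Cmp.codeX (hn.comp (Cmp.fst (Cmp.fst Cmp.id))) (hm.comp (Cmp.fst (Cmp.fst Cmp.id)))
      (Cmp.snd (Cmp.snd Cmp.id))

/-- Letters beyond the end of the list stand for the default `d`, whose code is empty, so they
evaluate to zero in both descriptions. -/
theorem eval_subst_codeX {β : Type*} (o n : ℕ) (l : List β) (d : β) (φ : β → PolyCode K)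
    (hd : φ d = []) (h : WordCode K) :
    WordCode.eval (WordCode.subst (l.map fun b => codeX o n (φ b)) h)
      = MvPolynomial.rename (fun i : Fin n => o + (i : ℕ))
        (MvPolynomial.aeval (fun k => PolyCode.toPoly n (φ (l.getD k d))) (WordCode.eval h)) := by
  have : ∀ k, (l.map fun b => codeX o n (φ b)).getD k [] = codeX o n (φ (l.getD k d)) := by
    intro k
    simp only [List.getD_eq_getElem?_getD, List.getElem?_map]
    rcases l[k]? with _ | c
    · simp [hd, codeX]
    · rfl
  rw [WordCode.eval_subst]
  simp only [this, eval_codeX]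
  exact (MvPolynomial.comp_aeval_apply _ (MvPolynomial.rename _) _).symm

theorem aeval_prodMk_mv {σ R S : Type*} [CommRing R] [CommRing S] [Algebra K R] [Algebra K S]
    (y : σ → R) (z : σ → S) (q : MvPolynomial σ K) :
    MvPolynomial.aeval (fun k => (y k, z k)) q = (MvPolynomial.aeval y q, MvPolynomial.aeval z q) := by
  have h1 := MvPolynomial.comp_aeval_apply (fun k => (y k, z k)) (AlgHom.fst K R S) q
  have h2 := MvPolynomial.comp_aeval_apply (fun k => (y k, z k)) (AlgHom.snd K R S) q
  exact Prod.ext h1 h2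

theorem rename_shift_injective (o n : ℕ) : Function.Injective
    (MvPolynomial.rename (R := K) fun i : Fin n => o + (i : ℕ)) :=
  MvPolynomial.rename_injective _ fun _ _ h => Fin.ext (Nat.add_left_cancel h)

theorem pairOf_nil (n m : ℕ) : pairOf (K := K) n m ([], []) = 0 := rfl

theorem pairOf_getD_mem (n m : ℕ) (out : List (PolyCode K × PolyCode K)) (k : ℕ) :
    pairOf n m (out.getD k ([], [])) ∈ algebraOf n m out := by
  by_cases hk : k < out.length
  · rw [List.getD_eq_getElem _ _ hk]
    exact Algebra.subset_adjoin ⟨_, List.getElem_mem hk, rfl⟩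
  · rw [List.getD_eq_default _ _ (not_lt.1 hk), pairOf_nil]
    exact zero_mem _

theorem algebraOf_eq_range (n m : ℕ) (out : List (PolyCode K × PolyCode K)) : algebraOf n m out
    = (MvPolynomial.aeval (R := K) fun k => pairOf n m (out.getD k ([], []))).range := by
  refine le_antisymm (Algebra.adjoin_le ?_) ?_
  · rintro _ ⟨c, hc, rfl⟩
    obtain ⟨j, hj, rfl⟩ := List.getElem_of_mem hc
    refine ⟨MvPolynomial.X j, ?_⟩
    change MvPolynomial.aeval _ _ = _
    rw [MvPolynomial.aeval_X, List.getD_eq_getElem _ _ hj]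
    rfl
  · rw [← Algebra.adjoin_range_eq_range_aeval]
    refine Algebra.adjoin_le ?_
    rintro _ ⟨k, rfl⟩
    exact pairOf_getD_mem n m out k

/-- The first code of the certificate is an arbitrary polynomial expression in `out`. In the second
one all words have length one, so it is a linear combination of `ws`. -/
theorem spanCert_iff {n m : ℕ} {out ws : List (PolyCode K × PolyCode K)}
    {fg : PolyCode K × PolyCode K} : SpanCert n m out ws fg ↔
      ∃ a ∈ algebraOf n m out, ∃ s ∈ Submodule.span K (Set.range fun k : Fin ws.length =>
        pairOf n m (ws.get k)), a + s = pairOf n m fg := by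
  have hpair : ∀ (l : List (PolyCode K × PolyCode K)) (h : WordCode K),
      MvPolynomial.aeval (fun k => pairOf n m (l.getD k ([], []))) (WordCode.eval h)
      = (MvPolynomial.aeval (fun k => PolyCode.toPoly n (l.getD k ([], [])).1) (WordCode.eval h),
        MvPolynomial.aeval (fun k => PolyCode.toPoly m (l.getD k ([], [])).2) (WordCode.eval h)) :=
    fun l h => aeval_prodMk_mv _ _ _
  have hcert : ∀ h l : WordCode K,
      (WordCode.eval (WordCode.subst (out.map fun c => codeX 0 n c.1) h
        ++ WordCode.subst (ws.map fun c => codeX 0 n c.1) l) = WordCode.eval (codeX 0 n fg.1) ∧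
      WordCode.eval (WordCode.subst (out.map fun c => codeX n m c.2) h
        ++ WordCode.subst (ws.map fun c => codeX n m c.2) l) = WordCode.eval (codeX n m fg.2)) ↔
      MvPolynomial.aeval (fun k => pairOf n m (out.getD k ([], []))) (WordCode.eval h)
        + MvPolynomial.aeval (fun k => pairOf n m (ws.getD k ([], []))) (WordCode.eval l)
        = pairOf n m fg := by
    intro h l
    rw [WordCode.eval_append, WordCode.eval_append,
      eval_subst_codeX 0 n out ([], []) Prod.fst rfl, eval_subst_codeX 0 n ws ([], []) Prod.fst rfl,
      eval_subst_codeX n m out ([], []) Prod.snd rfl, eval_subst_codeX n m ws ([], []) Prod.snd rfl,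
      eval_codeX, eval_codeX, ← map_add, ← map_add, (rename_shift_injective 0 n).eq_iff,
      (rename_shift_injective n m).eq_iff, hpair, hpair, Prod.mk_add_mk, pairOf, Prod.mk.injEq]
  have hlin : ∀ l : WordCode K, (∀ t ∈ l, t.2.length = 1) →
      MvPolynomial.aeval (fun k => pairOf n m (ws.getD k ([], []))) (WordCode.eval l)
        ∈ Submodule.span K (Set.range fun k : Fin ws.length => pairOf n m (ws.get k)) := by
    intro l hl
    rw [WordCode.aeval_eval]
    refine list_sum_mem ?_
    intro x hx
    obtain ⟨t, ht, rfl⟩ := List.mem_map.1 hx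
    obtain ⟨k, hk⟩ := List.length_eq_one_iff.1 (hl t ht)
    rw [hk, List.map_singleton, List.prod_singleton, ← Algebra.smul_def]
    refine Submodule.smul_mem _ _ ?_
    by_cases hkl : k < ws.length
    · rw [List.getD_eq_getElem _ _ hkl]
      exact Submodule.subset_span ⟨⟨k, hkl⟩, rfl⟩
    · rw [List.getD_eq_default _ _ (not_lt.1 hkl), pairOf_nil]
      exact zero_mem _
  have hsurj : ∀ s ∈ Submodule.span K (Set.range fun k : Fin ws.length => pairOf n m (ws.get k)),
      ∃ l : WordCode K, (∀ t ∈ l, t.2.length = 1) ∧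
        MvPolynomial.aeval (fun k => pairOf n m (ws.getD k ([], []))) (WordCode.eval l) = s := by
    intro s hs
    obtain ⟨c, rfl⟩ := (Submodule.mem_span_range_iff_exists_fun K).1 hs
    refine ⟨List.ofFn fun k : Fin ws.length => (c k, [(k : ℕ)]), ?_, ?_⟩
    · intro t ht
      obtain ⟨k, rfl⟩ := (List.mem_ofFn' _ _).1 ht
      rfl
    · rw [WordCode.aeval_eval, List.map_ofFn, List.sum_ofFn]
      refine Finset.sum_congr rfl fun k _ => ?_
      simp only [Function.comp_apply, List.map_singleton, List.prod_singleton]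
      rw [← Algebra.smul_def, List.getD_eq_getElem _ _ k.2]
      rfl
  constructor
  · rintro ⟨⟨h, l⟩, hl, hc⟩
    refine ⟨_, ?_, _, hlin l hl, (hcert h l).1 hc⟩
    rw [algebraOf_eq_range]
    exact ⟨_, rfl⟩
  · rintro ⟨a, ha, s, hs, e⟩
    rw [algebraOf_eq_range] at ha
    obtain ⟨q, rfl⟩ := ha
    obtain ⟨h, rfl⟩ := WordCode.eval_surjective q
    obtain ⟨l, hl, rfl⟩ := hsurj s hs
    exact ⟨(h, l), hl, (hcert h l).2 e⟩

end Membership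


/-! ### Finite-dimensional representations by lists of matrices. -/

section Representations

variable {K : Type*} [Field K]

/-- Commuting elements generate a commutative subalgebra, in which evaluation is defined. -/
theorem exists_algHom_of_commute {ι R : Type*} [Ring R] [Algebra K R] (M : ι → R)
    (h : ∀ i j, M i * M j = M j * M i) :
    ∃ Φ : MvPolynomial ι K →ₐ[K] R, ∀ k, Φ (MvPolynomial.X k) = M k := by
  let _ : CommRing (Algebra.adjoin K (Set.range M)) :=
    { (Algebra.adjoin K (Set.range M)).toRing with
      mul_comm := fun a b => by
        have := Algebra.isMulCommutative_adjoin K (s := Set.range M) (by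
          rintro _ ⟨i, rfl⟩ _ ⟨j, rfl⟩
          exact h i j)
        exact this.is_comm.comm a b }
  refine ⟨(Algebra.adjoin K (Set.range M)).val.comp
    (MvPolynomial.aeval fun k => ⟨M k, Algebra.subset_adjoin ⟨k, rfl⟩⟩), fun k => ?_⟩
  rw [AlgHom.comp_apply, MvPolynomial.aeval_X]
  rfl

/-- The vector given by a list. -/
def listVec (D : ℕ) (u : List K) : Fin D → K := fun i => u.getD i 0

theorem listVec_ofFn {D : ℕ} (v : Fin D → K) : listVec D (List.ofFn v) = v := by
  funext i
  simp [listVec]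

theorem map_range_eq_ofFn {β : Type*} (D : ℕ) (g : ℕ → β) :
    (List.range D).map g = List.ofFn fun i : Fin D => g i := by
  rw [List.ofFn_eq_map, ← List.map_coe_finRange_eq_range, List.map_map]
  rfl

theorem sum_map_range {D : ℕ} (g : ℕ → K) : ((List.range D).map g).sum = ∑ i : Fin D, g i := by
  rw [map_range_eq_ofFn, List.sum_ofFn]

/-- The `k`-th matrix of the family of square matrices whose entries are listed in `A`. -/
def listMatrix (D : ℕ) (A : List K) (k : ℕ) : Matrix (Fin D) (Fin D) K :=
  Matrix.of fun i j => A.getD ((k * D + i) * D + j) 0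

/-- Action of the `k`-th matrix. -/
def repApply (D : ℕ) (A : List K) (k : ℕ) (u : List K) : List K :=
  (List.range D).map fun i =>
    ((List.range D).map fun j => A.getD ((k * D + i) * D + j) 0 * u.getD j 0).sum

theorem repApply_eq (D : ℕ) (A : List K) (k : ℕ) (u : List K) :
    repApply D A k u = List.ofFn ((listMatrix D A k).mulVec (listVec D u)) := by
  rw [repApply, map_range_eq_ofFn]
  congr 1
  funext i
  rw [sum_map_range]
  rfl

/-- Action of a word. -/
def repWord (D : ℕ) (A : List K) (w : List ℕ) (u : List K) : List K :=
  w.foldl (fun u k => repApply D A k u) u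

/-- Action of a polynomial. -/
def repEval (D : ℕ) (A : List K) (c : WordCode K) (u : List K) : List K :=
  (List.range D).map fun i => (c.map fun t => t.1 * (repWord D A t.2 u).getD i 0).sum

theorem listVec_repWord {D : ℕ} {A : List K} {Φ : MvPolynomial ℕ K →ₐ[K] Matrix (Fin D) (Fin D) K}
    (hΦ : ∀ k, Φ (MvPolynomial.X k) = listMatrix D A k) (w : List ℕ) (u : List K) :
    listVec D (repWord D A w u) = (Φ (wordMonomial K w)).mulVec (listVec D u) := by
  induction w generalizing u with
  | nil => simp [repWord, wordMonomial]
  | cons k w ih =>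
    rw [repWord, List.foldl_cons, ← repWord, ih, repApply_eq, listVec_ofFn, Matrix.mulVec_mulVec,
      ← hΦ, ← map_mul, mul_comm]
    rfl

theorem repEval_eq {D : ℕ} {A : List K} {Φ : MvPolynomial ℕ K →ₐ[K] Matrix (Fin D) (Fin D) K}
    (hΦ : ∀ k, Φ (MvPolynomial.X k) = listMatrix D A k) (c : WordCode K) (u : List K) :
    repEval D A c u = List.ofFn ((Φ (WordCode.eval c)).mulVec (listVec D u)) := by
  rw [repEval, map_range_eq_ofFn]
  congr 1
  funext i
  induction c with
  | nil => simp [WordCode.eval_nil]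
  | cons t c ih =>
    rw [List.map_cons, List.sum_cons, ih, WordCode.eval_cons, map_add, Matrix.add_mulVec,
      Pi.add_apply, map_mul, ← Matrix.mulVec_mulVec, ← listVec_repWord hΦ,
      ← MvPolynomial.algebraMap_eq, AlgHom.commutes, Algebra.algebraMap_eq_smul_one, Matrix.smul_mulVec,
      Matrix.one_mulVec]
    rfl

/-- A standard basis vector, as a list. -/
def basisVec (K : Type*) [Field K] (D k : ℕ) : List K :=
  (List.range D).map fun i => if i = k then 1 else 0

theorem basisVec_eq {D : ℕ} (k : Fin D) : basisVec K D k = List.ofFn (Pi.single k (1 : K)) := by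
  rw [basisVec, map_range_eq_ofFn]
  congr 1
  funext i
  simp [Pi.single_apply, Fin.ext_iff]

/-- `A` lists `N` pairwise commuting matrices. -/
def RepValid (N D : ℕ) (A : List K) : Prop :=
  A.length ≤ N * D * D ∧ ∀ i ∈ List.range N, ∀ j ∈ List.range N, ∀ k ∈ List.range D,
    repApply D A i (repApply D A j (basisVec K D k))
      = repApply D A j (repApply D A i (basisVec K D k))

/-- The length bound makes all matrices from index `N` on zero, so the checks for the first `N` give
commutativity of the whole family; equality of products is tested on basis vectors. -/
theorem RepValid.exists_algHom {N D : ℕ} {A : List K} (h : RepValid N D A) :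
    ∃ Φ : MvPolynomial ℕ K →ₐ[K] Matrix (Fin D) (Fin D) K,
      ∀ k, Φ (MvPolynomial.X k) = listMatrix D A k := by
  have hz : ∀ k, N ≤ k → listMatrix D A k = 0 := by
    intro k hk
    ext i j
    change A.getD _ 0 = 0
    refine List.getD_eq_default _ _ (h.1.trans ?_)
    refine le_trans ?_ (Nat.le_add_right _ _)
    gcongr
    exact le_trans (Nat.mul_le_mul_right D hk) (Nat.le_add_right _ _)
  refine exists_algHom_of_commute _ fun i j => ?_
  rcases le_or_gt N i with hi | hi
  · rw [hz i hi, zero_mul, mul_zero]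
  rcases le_or_gt N j with hj | hj
  · rw [hz j hj, zero_mul, mul_zero]
  refine Matrix.ext_of_mulVec_single fun k => ?_
  have := h.2 i (List.mem_range.2 hi) j (List.mem_range.2 hj) k (List.mem_range.2 k.2)
  simp only [repApply_eq, listVec_ofFn, basisVec_eq] at this
  rw [← Matrix.mulVec_mulVec, ← Matrix.mulVec_mulVec]
  exact List.ofFn_injective this

theorem exists_listMatrix_eq {N D : ℕ} (M : ℕ → Matrix (Fin D) (Fin D) K) (h0 : ∀ k, N ≤ k → M k = 0)
    (hc : ∀ i j, M i * M j = M j * M i) :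
    ∃ A : List K, RepValid N D A ∧ ∀ k, listMatrix D A k = M k := by
  classical
  -- Entry `(i, j)` of the `k`-th matrix is stored at position `(k * D + i) * D + j`; this recovers
  -- the three indices from the position.
  let g : ℕ → K := fun x => if h : x / D % D < D ∧ x % D < D then
    M (x / D / D) ⟨_, h.1⟩ ⟨_, h.2⟩ else 0
  have hA : ∀ k, listMatrix D ((List.range (N * D * D)).map g) k = M k := by
    intro k
    ext i j
    change List.getD _ ((k * D + i) * D + j) 0 = _
    have hD : 0 < D := i.pos
    have h1 : ((k * D + i) * D + j) / D = k * D + i := by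
      rw [mul_comm, Nat.mul_add_div hD, Nat.div_eq_of_lt j.2, add_zero]
    have h2 : ((k * D + i) * D + j) % D = j := by
      rw [mul_comm, Nat.mul_add_mod, Nat.mod_eq_of_lt j.2]
    have h3 : (k * D + i) / D = k := by
      rw [mul_comm, Nat.mul_add_div hD, Nat.div_eq_of_lt i.2, add_zero]
    have h4 : (k * D + i) % D = i := by
      rw [mul_comm, Nat.mul_add_mod, Nat.mod_eq_of_lt i.2]
    rcases le_or_gt N k with hk | hk
    · rw [h0 k hk, List.getD_eq_default]
      · rfl
      · rw [List.length_map, List.length_range]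
        refine le_trans ?_ (Nat.le_add_right _ _)
        gcongr
        exact le_trans (Nat.mul_le_mul_right D hk) (Nat.le_add_right _ _)
    · have hlt : (k * D + i) * D + j < N * D * D := by
        have a1 : k * D + i < N * D := by
          calc k * D + i < k * D + D := by omega
            _ = (k + 1) * D := by ring
            _ ≤ N * D := Nat.mul_le_mul_right D hk
        calc (k * D + i) * D + j < (k * D + i) * D + D := by omega
          _ = (k * D + i + 1) * D := by ring
          _ ≤ N * D * D := Nat.mul_le_mul_right D a1
      rw [List.getD_eq_getElem _ _ (by simpa using hlt), List.getElem_map, List.getElem_range]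
      simp only [g]
      rw [dif_pos]
      · congr 1
        · rw [h1, h3]
        · exact Fin.ext (by simp only [h1, h4])
        · exact Fin.ext h2
      · exact ⟨Nat.mod_lt _ hD, Nat.mod_lt _ hD⟩
  refine ⟨(List.range (N * D * D)).map g, ⟨by simp, ?_⟩, hA⟩
  intro i _ j _ k hk
  rw [List.mem_range] at hk
  have := basisVec_eq (K := K) ⟨k, hk⟩
  simp only at this
  rw [repApply_eq, repApply_eq, repApply_eq, repApply_eq, listVec_ofFn, listVec_ofFn, hA, hA,
    Matrix.mulVec_mulVec, Matrix.mulVec_mulVec, hc]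

end Representations


/-! ### Certificates for completeness up to a degree bound. -/

section Cover

variable {K : Type*} [Field K]

/-- All exponent lists of length `n` with entries at most `N`. -/
def expsUpTo (n N : ℕ) : List (List ℕ) :=
  (List.range n).foldl (fun acc _ => (List.range (N + 1)).flatMap fun x => acc.map (x :: ·)) [[]]

theorem ofFn_mem_expsUpTo {n N : ℕ} (e : Fin n → ℕ) (he : ∀ i, e i ≤ N) :
    List.ofFn e ∈ expsUpTo n N := by
  induction n with
  | zero => simp [expsUpTo]
  | succ n ih =>
    rw [expsUpTo, List.range_succ (n := n), List.foldl_append, List.foldl_cons, List.foldl_nil, ← expsUpTo,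
      List.ofFn_succ]
    exact List.mem_flatMap.2 ⟨e 0, List.mem_range.2 (Nat.lt_succ_of_le (he 0)),
      List.mem_map.2 ⟨_, ih (fun i => e i.succ) (fun i => he _), rfl⟩⟩

/-- The monomials in one of the two groups of variables, with exponents at most `N`. -/
def gensUpTo (K : Type*) [Field K] (n m N : ℕ) : List (PolyCode K × PolyCode K) :=
  ((expsUpTo n N).map fun e => ([(1, e)], [])) ++ (expsUpTo m N).map fun e => ([], [(1, e)])

theorem toPoly_mem_span {n N : ℕ} {f : MvPolynomial (Fin n) K} (hf : f.totalDegree ≤ N) :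
    f ∈ Submodule.span K {q | ∃ e ∈ expsUpTo n N, q = PolyCode.toPoly n [((1 : K), e)]} := by
  rw [f.as_sum]
  refine Submodule.sum_mem _ fun d hd => ?_
  rw [← mul_one (f.coeff d), ← smul_eq_mul, ← MvPolynomial.smul_monomial]
  refine Submodule.smul_mem _ _ (Submodule.subset_span ⟨List.ofFn d, ?_, ?_⟩)
  · refine ofFn_mem_expsUpTo _ fun i => le_trans ?_ hf
    refine le_trans ?_ (MvPolynomial.le_totalDegree hd)
    rw [Finsupp.sum_fintype _ _ (by simp)]
    exact Finset.single_le_sum (f := fun i => d i) (fun _ _ => Nat.zero_le _) (Finset.mem_univ i)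
  · rw [PolyCode.toPoly_singleton_ofFn]

/-- The space spanned by the monomials with exponents at most `N`. -/
noncomputable def boundedSpace (K : Type*) [Field K] (n m N : ℕ) :
    Submodule K (MvPolynomial (Fin n) K × MvPolynomial (Fin m) K) :=
  Submodule.span K {q | ∃ c ∈ gensUpTo K n m N, q = pairOf n m c}

theorem mem_boundedSpace {n m N : ℕ} {f : MvPolynomial (Fin n) K} {g : MvPolynomial (Fin m) K}
    (hf : f.totalDegree ≤ N) (hg : g.totalDegree ≤ N) : (f, g) ∈ boundedSpace K n m N := by
  have h1 : (f, 0) ∈ boundedSpace K n m N := by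
    have := Submodule.mem_map_of_mem (f := LinearMap.inl K _ (MvPolynomial (Fin m) K))
      (toPoly_mem_span hf)
    rw [Submodule.map_span] at this
    refine Submodule.span_mono ?_ this
    rintro _ ⟨_, ⟨e, he, rfl⟩, rfl⟩
    exact ⟨([(1, e)], []), List.mem_append_left _ (List.mem_map.2 ⟨e, he, rfl⟩), rfl⟩
  have h2 : (0, g) ∈ boundedSpace K n m N := by
    have := Submodule.mem_map_of_mem (f := LinearMap.inr K (MvPolynomial (Fin n) K) _)
      (toPoly_mem_span hg)
    rw [Submodule.map_span] at this
    refine Submodule.span_mono ?_ this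
    rintro _ ⟨_, ⟨e, he, rfl⟩, rfl⟩
    exact ⟨([], [(1, e)]), List.mem_append_right _ (List.mem_map.2 ⟨e, he, rfl⟩), rfl⟩
  have := add_mem h1 h2
  rwa [Prod.mk_add_mk, add_zero, zero_add] at this

theorem finiteDimensional_boundedSpace (n m N : ℕ) : FiniteDimensional K (boundedSpace K n m N) := by
  refine FiniteDimensional.span_of_finite K (Set.Finite.subset
    ((gensUpTo K n m N).finite_toSet.image (pairOf n m)) ?_)
  rintro _ ⟨c, hc, rfl⟩
  exact ⟨c, hc, rfl⟩

/-- The map `(f, g) ↦ f - g`. -/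
noncomputable def diffMap (K : Type*) [Field K] (n m : ℕ) :
    MvPolynomial (Fin n) K × MvPolynomial (Fin m) K →ₗ[K] PolyXY K n m :=
  (inclX K n m).toLinearMap ∘ₗ LinearMap.fst K _ _ - (inclY K n m).toLinearMap ∘ₗ LinearMap.snd K _ _

theorem mem_separatedAlgebra_iff {n m : ℕ} {I : Ideal (PolyXY K n m)}
    {fg : MvPolynomial (Fin n) K × MvPolynomial (Fin m) K} :
    fg ∈ separatedAlgebra I ↔ diffMap K n m fg ∈ I := Iff.rfl

/-- The word code of `f - g`. -/
def diffCode (n m : ℕ) (c : PolyCode K × PolyCode K) : WordCode K :=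
  codeX 0 n c.1 ++ (codeX n m c.2).neg

theorem eval_diffCode (n m : ℕ) (c : PolyCode K × PolyCode K) : WordCode.eval (diffCode n m c)
    = MvPolynomial.rename (varIndex n m) (diffMap K n m (pairOf n m c)) := by
  change _ = MvPolynomial.rename (varIndex n m) (inclX K n m _ - inclY K n m _)
  rw [diffCode, WordCode.eval_append, WordCode.eval_neg, eval_codeX, eval_codeX, map_sub,
    rename_inclX, rename_inclY, sub_eq_add_neg]
  rfl

/-- A finite-dimensional representation annihilating the ideal shows that the pairs `ws` have
linearly independent differences, and all pairs of bounded degree are in the sum of the algebra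
generated by `out` and the span of `ws`. -/
def Cover (n m : ℕ) (out : List (PolyCode K × PolyCode K)) (L : List (PolyXYCode K)) (N : ℕ) :
    Prop :=
  ∃ w : (List (PolyCode K × PolyCode K) × ℕ) × List K × List K,
    (RepValid (n + m) w.1.2 w.2.1 ∧ w.1.1.length ≤ w.1.2 ∧
    (∀ c ∈ L, repEval w.1.2 w.2.1 (codeXY n m c) w.2.2 = (List.range w.1.2).map fun _ => 0) ∧
    ∀ i ∈ List.range w.1.1.length,
      repEval w.1.2 w.2.1 (diffCode n m (w.1.1.getD i ([], []))) w.2.2 = basisVec K w.1.2 i) ∧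
    ∀ c ∈ gensUpTo K n m N, SpanCert n m out w.1.1 c

theorem Cover.mem {n m N : ℕ} {out : List (PolyCode K × PolyCode K)} {L : List (PolyXYCode K)}
    (h : Cover n m out L N) (hout : algebraOf n m out ≤ separatedAlgebra (idealOf n m L))
    {f : MvPolynomial (Fin n) K} {g : MvPolynomial (Fin m) K}
    (hfg : (f, g) ∈ separatedAlgebra (idealOf n m L)) (hf : f.totalDegree ≤ N)
    (hg : g.totalDegree ≤ N) : (f, g) ∈ algebraOf n m out := by
  obtain ⟨⟨⟨ws, D⟩, A, v⟩, ⟨hval, hlen, hL, hws⟩, hgen⟩ := h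
  simp only at hval hlen hL hws hgen
  obtain ⟨Φ, hΦ⟩ := hval.exists_algHom
  -- Action on the distinguished vector. It vanishes on the generators of the ideal, hence on the
  -- ideal, as the matrices commute.
  let T : PolyXY K n m →ₗ[K] (Fin D → K) :=
    (LinearMap.flip (Matrix.mulVecBilin K K) (listVec D v)) ∘ₗ Φ.toLinearMap ∘ₗ
      (MvPolynomial.rename (varIndex n m)).toLinearMap
  have hT : ∀ q, T q = (Φ (MvPolynomial.rename (varIndex n m) q)).mulVec (listVec D v) :=
    fun q => rfl
  have hTL : ∀ q ∈ idealOf n m L, T q = 0 := by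
    intro q hq
    refine Submodule.span_induction (p := fun q _ => T q = 0) ?_ (map_zero T) ?_ ?_ hq
    · rintro _ ⟨c, hc, rfl⟩
      have := hL c hc
      rw [repEval_eq hΦ, eval_codeXY, map_range_eq_ofFn, ← hT] at this
      exact List.ofFn_injective this
    · intro x y _ _ hx hy
      rw [map_add, hx, hy, add_zero]
    · intro r x _ hx
      rw [hT] at hx ⊢
      rw [smul_eq_mul, map_mul, map_mul, ← Matrix.mulVec_mulVec, hx, Matrix.mulVec_zero]
  have hTw : ∀ i : Fin ws.length, T (diffMap K n m (pairOf n m (ws.get i)))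
      = Pi.single (Fin.castLE hlen i) 1 := by
    intro i
    have := hws i (List.mem_range.2 i.2)
    have e := basisVec_eq (K := K) (Fin.castLE hlen i)
    rw [Fin.val_castLE] at e
    rw [repEval_eq hΦ, eval_diffCode, ← hT, e, List.getD_eq_getElem _ _ i.2] at this
    exact List.ofFn_injective this
  have hspan : ∀ fg ∈ boundedSpace K n m N, ∃ a ∈ algebraOf n m out,
      ∃ s ∈ Submodule.span K (Set.range fun k : Fin ws.length => pairOf n m (ws.get k)),
        a + s = fg := by
    intro fg hfg
    have : boundedSpace K n m N ≤ Subalgebra.toSubmodule (algebraOf n m out) ⊔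
        Submodule.span K (Set.range fun k : Fin ws.length => pairOf n m (ws.get k)) := by
      refine Submodule.span_le.2 ?_
      rintro _ ⟨c, hc, rfl⟩
      obtain ⟨a, ha, s, hs, e⟩ := spanCert_iff.1 (hgen c hc)
      exact Submodule.mem_sup.2 ⟨a, ha, s, hs, e⟩
    obtain ⟨a, ha, s, hs, e⟩ := Submodule.mem_sup.1 (this hfg)
    exact ⟨a, ha, s, hs, e⟩
  obtain ⟨a, ha, s, hs, e⟩ := hspan _ (mem_boundedSpace hf hg)
  suffices hs0 : s = 0 by
    rw [← e, hs0, add_zero]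
    exact ha
  obtain ⟨c, rfl⟩ := (Submodule.mem_span_range_iff_exists_fun K).1 hs
  have h0 : T (diffMap K n m (∑ k, c k • pairOf n m (ws.get k))) = 0 := by
    have h1 := hTL _ (mem_separatedAlgebra_iff.1 hfg)
    have h2 := hTL _ (mem_separatedAlgebra_iff.1 (hout ha))
    rwa [← e, map_add, map_add, h2, zero_add] at h1
  refine Finset.sum_eq_zero fun k _ => ?_
  have h1 := congrFun h0 (Fin.castLE hlen k)
  simp only [map_sum, map_smul, hTw, Finset.sum_apply, Pi.smul_apply, Pi.single_apply,
    Fin.castLE_inj, Pi.zero_apply] at h1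
  simp at h1
  rw [h1, zero_smul]

/-- Choose `ws` so that the differences are a basis, modulo the ideal, of all differences of bounded
pairs. An ideal of finite codimension that contains the given one, but no further differences of
bounded pairs, keeps them independent, and multiplication in its quotient is the representation. -/
theorem exists_cover {n m : ℕ} {out : List (PolyCode K × PolyCode K)} {L : List (PolyXYCode K)}
    (h : separatedAlgebra (idealOf n m L) ≤ algebraOf n m out) (N : ℕ) : Cover n m out L N := by
  classical
  have := finiteDimensional_boundedSpace (K := K) n m N
  -- pairs whose differences form a basis of the differences modulo the ideal
  let π : boundedSpace K n m N →ₗ[K] PolyXY K n m ⧸ idealOf n m L :=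
    (Ideal.Quotient.mkₐ K (idealOf n m L)).toLinearMap ∘ₗ diffMap K n m ∘ₗ
      (boundedSpace K n m N).subtype
  let s := Module.finrank K (LinearMap.range π)
  let b₀ : Module.Basis (Fin s) K (LinearMap.range π) := Module.finBasis K _
  have hlift : ∀ i, ∃ w : PolyCode K × PolyCode K, pairOf n m w ∈ boundedSpace K n m N ∧
      Ideal.Quotient.mk (idealOf n m L) (diffMap K n m (pairOf n m w)) = (b₀ i : _) := by
    intro i
    obtain ⟨⟨⟨f, g⟩, hx⟩, e⟩ := (b₀ i).2
    obtain ⟨c, rfl⟩ := PolyCode.toPoly_surjective n f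
    obtain ⟨d, rfl⟩ := PolyCode.toPoly_surjective m g
    exact ⟨(c, d), hx, e⟩
  choose w hw hwb using hlift
  let δ := (boundedSpace K n m N).map (diffMap K n m)
  obtain ⟨C, hIC, hC, hfin⟩ := exists_finite_quotient_inf_le (idealOf n m L) δ
  have hli : LinearIndependent K fun i =>
      Ideal.Quotient.mk C (diffMap K n m (pairOf n m (w i))) := by
    rw [Fintype.linearIndependent_iff]
    intro c hc
    have h1 : diffMap K n m (∑ i, c i • pairOf n m (w i)) ∈ C := by
      rw [← Ideal.Quotient.eq_zero_iff_mem, ← hc, map_sum, map_sum]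
      refine Finset.sum_congr rfl fun i _ => ?_
      rw [map_smul]
      rfl
    have h2 := hC _ (Submodule.mem_map_of_mem (Submodule.sum_mem _ fun i _ =>
      Submodule.smul_mem _ _ (hw i))) h1
    rw [← Ideal.Quotient.eq_zero_iff_mem, map_sum, map_sum] at h2
    have h3 : ∑ i, c i • b₀ i = 0 := by
      refine Subtype.ext ?_
      refine Eq.trans ?_ h2
      rw [AddSubmonoidClass.coe_finsetSum]
      refine Finset.sum_congr rfl fun i _ => ?_
      rw [Submodule.coe_smul, ← hwb i, map_smul]
      rfl
    exact Fintype.linearIndependent_iff.1 b₀.linearIndependent c h3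
  -- a basis of the finite quotient which extends these differences
  have hex : ∃ (D : ℕ) (hs : s ≤ D) (b : Module.Basis (Fin D) K (PolyXY K n m ⧸ C)),
      ∀ i : Fin s, b (Fin.castLE hs i) = Ideal.Quotient.mk C (diffMap K n m (pairOf n m (w i))) := by
    let b := Module.Basis.sumExtend hli
    have hbi : ∀ i, b (Sum.inl i) = Ideal.Quotient.mk C (diffMap K n m (pairOf n m (w i))) := by
      intro i
      rw [show b = Module.Basis.sumExtend hli from rfl, Module.Basis.sumExtend,
        Module.Basis.reindex_apply, Module.Basis.coe_extend]
      rfl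
    have : Finite (Fin s ⊕ Module.Basis.sumExtendIndex hli) := Module.Finite.finite_basis b
    have : Finite (Module.Basis.sumExtendIndex hli) :=
      Finite.of_injective (Sum.inr : _ → Fin s ⊕ Module.Basis.sumExtendIndex hli)
        Sum.inr_injective
    let e := (Equiv.sumCongr (Equiv.refl (Fin s)) (Finite.equivFin _)).trans
      (finSumFinEquiv (m := s) (n := Nat.card (Module.Basis.sumExtendIndex hli)))
    refine ⟨_, Nat.le_add_right _ _, b.reindex e, fun i => ?_⟩
    rw [Module.Basis.reindex_apply, ← hbi]
    congr 1
    rw [Equiv.symm_apply_eq]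
    rfl
  obtain ⟨D, hsD, b, hb⟩ := hex
  -- Multiplication on the quotient by `C`. Applied to the coordinates of `1`, it returns the
  -- coordinates of the class of a polynomial.
  let Φ : MvPolynomial ℕ K →ₐ[K] Matrix (Fin D) (Fin D) K :=
    (Algebra.leftMulMatrix b).comp ((Ideal.Quotient.mkₐ K C).comp (unrename K n m))
  obtain ⟨A, hA, hAM⟩ := exists_listMatrix_eq (N := n + m) (fun k => Φ (MvPolynomial.X k)) (by
    intro k hk
    have : unrename K n m (MvPolynomial.X k) = 0 := by
      rw [unrename, MvPolynomial.killCompl, MvPolynomial.aeval_X, dif_neg]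
      rintro ⟨i | i, hi⟩ <;> simp only [varIndex, Sum.elim_inl, Sum.elim_inr] at hi <;> omega
    simp only [Φ, AlgHom.comp_apply, this, map_zero]) (fun i j => by
      rw [← map_mul, mul_comm, map_mul])
  have hΦ : ∀ q, (Φ (MvPolynomial.rename (varIndex n m) q)).mulVec (b.repr 1)
      = b.repr (Ideal.Quotient.mk C q) := by
    intro q
    simp only [Φ, AlgHom.comp_apply, unrename_rename]
    rw [Algebra.leftMulMatrix_mulVec_repr, mul_one]
    rfl
  refine ⟨((List.ofFn w, D), A, List.ofFn (b.repr 1)), ⟨hA, ?_, ?_, ?_⟩, ?_⟩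
  · simpa using hsD
  · intro c hc
    rw [repEval_eq (fun k => (hAM k).symm), listVec_ofFn, eval_codeXY, hΦ, map_range_eq_ofFn,
      Ideal.Quotient.eq_zero_iff_mem.2 (hIC (Ideal.subset_span ⟨c, hc, rfl⟩)), map_zero]
    rfl
  · intro i hi
    simp only [List.length_ofFn, List.mem_range] at hi
    have e := basisVec_eq (K := K) (Fin.castLE hsD ⟨i, hi⟩)
    rw [Fin.val_castLE] at e
    simp only at e ⊢
    rw [repEval_eq (fun k => (hAM k).symm), listVec_ofFn, eval_diffCode, hΦ, e,
      List.getD_eq_getElem _ _ (by simpa using hi), List.getElem_ofFn, ← hb, b.repr_self]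
    congr 1
    exact Finsupp.single_eq_pi_single _ _
  · intro c hc
    rw [spanCert_iff]
    have hcb : pairOf n m c ∈ boundedSpace K n m N := Submodule.subset_span ⟨c, hc, rfl⟩
    -- Subtracting the combination of the chosen pairs with these coordinates makes the difference
    -- vanish modulo the ideal, so the rest is separated and lies in the algebra of `out`.
    let r := b₀.repr ⟨π ⟨_, hcb⟩, ⟨_, rfl⟩⟩
    refine ⟨pairOf n m c - ∑ i, r i • pairOf n m (w i), h ?_, ∑ i, r i • pairOf n m (w i), ?_,
      sub_add_cancel _ _⟩
    · rw [mem_separatedAlgebra_iff, ← Ideal.Quotient.eq_zero_iff_mem, map_sub, map_sub, sub_eq_zero]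
      have h1 := congrArg Subtype.val (b₀.sum_repr ⟨π ⟨_, hcb⟩, ⟨_, rfl⟩⟩)
      rw [AddSubmonoidClass.coe_finsetSum] at h1
      refine h1.symm.trans ?_
      rw [map_sum, map_sum]
      refine Finset.sum_congr rfl fun i _ => ?_
      rw [Submodule.coe_smul, ← hwb i, map_smul]
      rfl
    · refine Submodule.sum_mem _ fun i _ => Submodule.smul_mem _ _ (Submodule.subset_span
        ⟨Fin.cast (by simp) i, ?_⟩)
      simp

end Cover


/-! ### Semidecidability of completeness. -/

section CoverSigma

variable {K : Type*} [Field K] [Primcodable K] {α : Type*} [Primcodable α]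

namespace Cmp

theorem repApply (hK : IsComputableField K) {D k : α → ℕ} {A u : α → List K} (hD : Computable D)
    (hA : Computable A) (hk : Computable k) (hu : Computable u) :
    Computable fun a => repApply (D a) (A a) (k a) (u a) :=
  map (range hD) (ksum hK (map (range (hD.comp (fst id)))
    (kmul hK (getD 0 (hA.comp (fst (fst id))) (add (mul (add (mul (hk.comp (fst (fst id)))
      (hD.comp (fst (fst id)))) (snd (fst id))) (hD.comp (fst (fst id)))) (snd id)))
      (getD 0 (hu.comp (fst (fst id))) (snd id)))))

theorem repWord (hK : IsComputableField K) {D : α → ℕ} {A u : α → List K} {w : α → List ℕ}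
    (hD : Computable D) (hA : Computable A) (hw : Computable w) (hu : Computable u) :
    Computable fun a => repWord (D a) (A a) (w a) (u a) :=
  foldl hw hu (repApply hK (hD.comp (fst id)) (hA.comp (fst id)) (snd (snd id)) (fst (snd id)))

theorem repEval (hK : IsComputableField K) {D : α → ℕ} {A u : α → List K} {c : α → WordCode K}
    (hD : Computable D) (hA : Computable A) (hc : Computable c) (hu : Computable u) :
    Computable fun a => repEval (D a) (A a) (c a) (u a) :=
  map (range hD) (ksum hK (map (hc.comp (fst id)) (kmul hK (fst (snd id))
    (getD 0 (repWord hK (hD.comp (fst (fst id))) (hA.comp (fst (fst id))) (snd (snd id))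
      (hu.comp (fst (fst id)))) (snd (fst id))))))

theorem basisVec {D k : α → ℕ} (hD : Computable D) (hk : Computable k) :
    Computable fun a => basisVec K (D a) (k a) :=
  map (range hD) (DecP.ite (DecP.eq (snd id) (hk.comp (fst id))) (const 1) (const 0))

theorem expsUpTo {n N : α → ℕ} (hn : Computable n) (hN : Computable N) :
    Computable fun a => expsUpTo (n a) (N a) :=
  foldl (range hn) (const [[]]) (flatMap (range (add (hN.comp (fst id)) (const 1)))
    (map (fst (snd (fst id))) (cons (snd (fst id)) (snd id))))

theorem gensUpTo {n m N : α → ℕ} (hn : Computable n) (hm : Computable m) (hN : Computable N) :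
    Computable fun a => gensUpTo K (n a) (m a) (N a) :=
  append (map (expsUpTo hn hN) (pair (cons (pair (const 1) (snd id)) (const [])) (const [])))
    (map (expsUpTo hm hN) (pair (const []) (cons (pair (const 1) (snd id)) (const []))))

theorem diffCode (hK : IsComputableField K) {n m : α → ℕ} {c : α → PolyCode K × PolyCode K}
    (hn : Computable n) (hm : Computable m) (hc : Computable c) :
    Computable fun a => diffCode (n a) (m a) (c a) :=
  append (codeX (const 0) hn (fst hc)) (wneg hK (codeX hn hm (snd hc)))

end Cmp

theorem DecP.repValid (hK : IsComputableField K) {N D : α → ℕ} {A : α → List K} (hN : Computable N)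
    (hD : Computable D) (hA : Computable A) : DecP fun a => RepValid (N a) (D a) (A a) := by
  refine DecP.and (DecP.le (Cmp.length hA) (Cmp.mul (Cmp.mul hN hD) hD)) ?_
  refine DecP.ball (p := fun a i => ∀ j ∈ List.range (N a), ∀ k ∈ List.range (D a),
    SeparatedVariables.repApply (D a) (A a) i
      (SeparatedVariables.repApply (D a) (A a) j (SeparatedVariables.basisVec K (D a) k))
      = SeparatedVariables.repApply (D a) (A a) j
        (SeparatedVariables.repApply (D a) (A a) i (SeparatedVariables.basisVec K (D a) k)))
    (Cmp.range hN) ?_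
  refine DecP.ball (Cmp.range (hN.comp (Cmp.fst Cmp.id))) ?_
  refine DecP.ball (Cmp.range (hD.comp (Cmp.fst (Cmp.fst Cmp.id)))) ?_
  have hD' := hD.comp (Cmp.fst (Cmp.fst (Cmp.fst (Cmp.id (α := ((α × ℕ) × ℕ) × ℕ)))))
  have hA' := hA.comp (Cmp.fst (Cmp.fst (Cmp.fst (Cmp.id (α := ((α × ℕ) × ℕ) × ℕ)))))
  have hi := Cmp.snd (Cmp.fst (Cmp.fst (Cmp.id (α := ((α × ℕ) × ℕ) × ℕ))))
  have hj := Cmp.snd (Cmp.fst (Cmp.id (α := ((α × ℕ) × ℕ) × ℕ)))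
  have hk := Cmp.snd (Cmp.id (α := ((α × ℕ) × ℕ) × ℕ))
  exact DecP.eq (Cmp.repApply hK hD' hA' hi (Cmp.repApply hK hD' hA' hj (Cmp.basisVec hD' hk)))
    (Cmp.repApply hK hD' hA' hj (Cmp.repApply hK hD' hA' hi (Cmp.basisVec hD' hk)))

theorem Sigma1.cover (hK : IsComputableField K) {n m N : α → ℕ}
    {out : α → List (PolyCode K × PolyCode K)} {L : α → List (PolyXYCode K)} (hn : Computable n)
    (hm : Computable m) (ho : Computable out) (hL : Computable L) (hN : Computable N) :
    Sigma1 fun a => Cover (n a) (m a) (out a) (L a) (N a) := by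
  refine Sigma1.ex (Sigma1.and (Sigma1.of_decP (DecP.and ?_ (DecP.and ?_ (DecP.and ?_ ?_)))) ?_)
  · exact DecP.repValid hK (Cmp.add (hn.comp (Cmp.fst Cmp.id)) (hm.comp (Cmp.fst Cmp.id)))
      (Cmp.snd (Cmp.fst (Cmp.snd Cmp.id))) (Cmp.fst (Cmp.snd (Cmp.snd Cmp.id)))
  · exact DecP.le (Cmp.length (Cmp.fst (Cmp.fst (Cmp.snd Cmp.id))))
      (Cmp.snd (Cmp.fst (Cmp.snd Cmp.id)))
  · refine DecP.ball (hL.comp (Cmp.fst Cmp.id)) (DecP.eq (Cmp.repEval hK ?_ ?_ ?_ ?_)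
      (Cmp.map (Cmp.range ?_) (Cmp.const 0)))
    · exact Cmp.snd (Cmp.fst (Cmp.snd (Cmp.fst Cmp.id)))
    · exact Cmp.fst (Cmp.snd (Cmp.snd (Cmp.fst Cmp.id)))
    · exact Cmp.codeXY (hn.comp (Cmp.fst (Cmp.fst Cmp.id))) (hm.comp (Cmp.fst (Cmp.fst Cmp.id)))
        (Cmp.snd Cmp.id)
    · exact Cmp.snd (Cmp.snd (Cmp.snd (Cmp.fst Cmp.id)))
    · exact Cmp.snd (Cmp.fst (Cmp.snd (Cmp.fst Cmp.id)))
  · refine DecP.ball (Cmp.range (Cmp.length (Cmp.fst (Cmp.fst (Cmp.snd Cmp.id)))))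
      (DecP.eq (Cmp.repEval hK ?_ ?_ ?_ ?_) (Cmp.basisVec ?_ (Cmp.snd Cmp.id)))
    · exact Cmp.snd (Cmp.fst (Cmp.snd (Cmp.fst Cmp.id)))
    · exact Cmp.fst (Cmp.snd (Cmp.snd (Cmp.fst Cmp.id)))
    · exact Cmp.diffCode hK (hn.comp (Cmp.fst (Cmp.fst Cmp.id)))
        (hm.comp (Cmp.fst (Cmp.fst Cmp.id)))
        (Cmp.getD _ (Cmp.fst (Cmp.fst (Cmp.snd (Cmp.fst Cmp.id)))) (Cmp.snd Cmp.id))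
    · exact Cmp.snd (Cmp.snd (Cmp.snd (Cmp.fst Cmp.id)))
    · exact Cmp.snd (Cmp.fst (Cmp.snd (Cmp.fst Cmp.id)))
  · refine Sigma1.ball (Cmp.gensUpTo (hn.comp (Cmp.fst Cmp.id)) (hm.comp (Cmp.fst Cmp.id))
      (hN.comp (Cmp.fst Cmp.id))) ?_
    exact Sigma1.spanCert hK (hn.comp (Cmp.fst (Cmp.fst Cmp.id)))
      (hm.comp (Cmp.fst (Cmp.fst Cmp.id))) (ho.comp (Cmp.fst (Cmp.fst Cmp.id)))
      (Cmp.fst (Cmp.fst (Cmp.snd (Cmp.fst Cmp.id)))) (Cmp.snd Cmp.id)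

end CoverSigma


/-! ### Certificates for univariate polynomials. -/

section UnivariateCertificates

variable {K : Type*} [Field K]

/-- The homomorphism `x₀ ↦ X`, `x₁ ↦ z`, all other variables to `0`. -/
noncomputable def lineEval {L : Type*} [Field L] [Algebra K L] (z : L) : MvPolynomial ℕ K →ₐ[K] L[X] :=
  MvPolynomial.aeval fun k => if k = 0 then X else if k = 1 then C z else 0

theorem lineEval_aeval_X {L : Type*} [Field L] [Algebra K L] (z : L) (U : K[X]) :
    lineEval z (aeval (MvPolynomial.X 0 : MvPolynomial ℕ K) U) = U.map (algebraMap K L) := by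
  rw [← aeval_algHom_apply, lineEval, MvPolynomial.aeval_X, if_pos rfl, aeval_X_left_eq_map]

theorem lineEval_aeval_X_one {L : Type*} [Field L] [Algebra K L] (z : L) (τ : K[X]) :
    lineEval z (aeval (MvPolynomial.X 1 : MvPolynomial ℕ K) τ) = C (aeval z τ) := by
  rw [← aeval_algHom_apply, lineEval, MvPolynomial.aeval_X, if_neg one_ne_zero, if_pos rfl]
  exact aeval_algHom_apply (CAlgHom (R := K) (A := L)) z τ

theorem lineEval_aeval_X_mul {L : Type*} [Field L] [Algebra K L] (z x : L) (U : K[X]) :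
    (lineEval z (aeval (MvPolynomial.X 1 * MvPolynomial.X 0 : MvPolynomial ℕ K) U)).eval x
      = aeval (z * x) U := by
  rw [← aeval_algHom_apply, map_mul, lineEval, MvPolynomial.aeval_X, MvPolynomial.aeval_X,
    if_pos rfl, if_neg one_ne_zero, if_pos rfl]
  have := aeval_algHom_apply ((aeval x : L[X] →ₐ[L] L).restrictScalars K) (C z * X) U
  simp only [AlgHom.restrictScalars_apply, map_mul, aeval_C, aeval_X, Algebra.algebraMap_self_apply,
    coe_aeval_eq_eval] at this
  exact this.symm

/-- The code `x₀ ^ (r + 1) + h`. -/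
def monicCode (r : ℕ) (h : WordCode K) : WordCode K := (1, List.replicate (r + 1) 0) :: h

theorem natDegree_lineEval_wordMonomial {L : Type*} [Field L] [Algebra K L] (z : L) (w : List ℕ) :
    (lineEval z (wordMonomial K w)).natDegree ≤ w.count 0 := by
  induction w with
  | nil => simp [wordMonomial]
  | cons k w ih =>
    rw [wordMonomial, List.map_cons, List.prod_cons, map_mul, ← wordMonomial]
    refine natDegree_mul_le.trans ?_
    rw [List.count_cons, add_comm]
    refine add_le_add ih ?_
    rw [lineEval, MvPolynomial.aeval_X]
    by_cases h0 : k = 0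
    · simp [h0]
    · rw [if_neg h0]
      split_ifs <;> simp

/-- The remaining terms have degree at most `r` in `x₀`, so the code is monic in `x₀` and its degree
survives every specialization of `x₁`. -/
theorem lineEval_monicCode {L : Type*} [Field L] [Algebra K L] (z : L) {r : ℕ} {h : WordCode K}
    (hh : ∀ t ∈ h, t.2.count 0 ≤ r) :
    (lineEval z (WordCode.eval (monicCode r h))).natDegree = r + 1 := by
  have hlow : (lineEval z (WordCode.eval h)).natDegree ≤ r := by
    induction h with
    | nil => simp [WordCode.eval_nil]
    | cons t h ih =>
      rw [WordCode.eval_cons, map_add, map_mul]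
      refine natDegree_add_le_of_degree_le ?_ (ih fun s hs => hh s (List.mem_cons_of_mem _ hs))
      refine natDegree_mul_le.trans ?_
      rw [← MvPolynomial.algebraMap_eq, AlgHom.commutes, IsScalarTower.algebraMap_apply K L L[X],
        ← C_eq_algebraMap, natDegree_C, zero_add]
      exact (natDegree_lineEval_wordMonomial z _).trans (hh t List.mem_cons_self)
  have htop : lineEval z (wordMonomial K (List.replicate (r + 1) 0)) = X ^ (r + 1) := by
    simp [wordMonomial, lineEval]
  rw [monicCode, WordCode.eval_cons, MvPolynomial.C_1, one_mul, map_add, htop,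
    natDegree_add_eq_left_of_natDegree_lt] <;> rw [natDegree_X_pow]
  omega

/-- The embedding of bivariate polynomials. -/
noncomputable def bivariate (K : Type*) [Field K] : K[X][X] →+* MvPolynomial ℕ K :=
  eval₂RingHom (aeval (MvPolynomial.X 1) : K[X] →ₐ[K] MvPolynomial ℕ K).toRingHom (MvPolynomial.X 0)

theorem bivariate_C (τ : K[X]) : bivariate K (C τ) = aeval (MvPolynomial.X 1) τ := by
  simp [bivariate]

theorem bivariate_X : bivariate K X = MvPolynomial.X 0 := by
  simp [bivariate]

theorem bivariate_map_C (U : K[X]) : bivariate K (U.map C) = aeval (MvPolynomial.X 0) U := by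
  rw [bivariate, coe_eval₂RingHom, eval₂_map, aeval_def]
  congr 1
  ext r
  simp

theorem bivariate_comp (U : K[X]) : bivariate K ((U.map C).comp (C X * X))
    = aeval (MvPolynomial.X 1 * MvPolynomial.X 0) U := by
  rw [comp, eval₂_map, hom_eval₂, map_mul, bivariate_C, bivariate_X, aeval_X, aeval_def]
  congr 1
  ext r
  simp [bivariate]

/-- The leading term is written separately, and the other coefficients become polynomials in `x₁`
multiplied by powers of `x₀` of exponent at most `r`. -/
theorem exists_monicCode {h : K[X][X]} (hm : h.Monic) (hd : 0 < h.natDegree) :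
    ∃ (r : ℕ) (c : WordCode K), (∀ t ∈ c, t.2.count 0 ≤ r) ∧
      WordCode.eval (monicCode r c) = bivariate K h := by
  choose l hl using univariate_surjective (K := K)
  obtain ⟨r, hr⟩ : ∃ r, h.natDegree = r + 1 := ⟨_, (Nat.succ_pred_eq_of_pos hd).symm⟩
  refine ⟨r, (List.range (r + 1)).flatMap fun i =>
    (univariateWord 1 (l (h.coeff i))).mul [(1, List.replicate i 0)], ?_, ?_⟩
  · intro t ht
    obtain ⟨i, hi, ht⟩ := List.mem_flatMap.1 ht
    obtain ⟨s, hs, ht⟩ := List.mem_flatMap.1 ht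
    rw [List.map_singleton, List.mem_singleton] at ht
    obtain ⟨j, -, rfl⟩ := List.mem_map.1 hs
    rw [ht, List.count_append, List.count_replicate_self, List.map_const', List.count_replicate,
      if_neg (by simp), zero_add]
    exact Nat.lt_succ_iff.1 (List.mem_range.1 hi)
  · have hs : ∀ i : ℕ, WordCode.eval [((1 : K), List.replicate i 0)] = MvPolynomial.X 0 ^ i := by
      intro i
      rw [WordCode.eval_cons, WordCode.eval_nil]
      simp [wordMonomial]
    have e : h = X ^ (r + 1) + ∑ i ∈ Finset.range (r + 1), C (h.coeff i) * X ^ i := by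
      conv_lhs => rw [hm.as_sum, hr]
    conv_rhs => rw [e]
    rw [monicCode, WordCode.eval_cons, MvPolynomial.C_1, one_mul, map_add, map_pow, bivariate_X,
      map_sum, WordCode.eval_flatMap]
    congr 1
    · simp [wordMonomial]
    · rw [Finset.sum_range, ← List.sum_ofFn, ← map_range_eq_ofFn
        (r + 1) fun i => bivariate K (C (h.coeff i) * X ^ i)]
      congr 1
      refine List.map_congr_left fun i _ => ?_
      rw [WordCode.eval_mul, hs, eval_univariateWord, hl, map_mul, map_pow, bivariate_X, bivariate_C]

/-- Certificate that a univariate polynomial has a multiple factor. -/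
def SquareCert (c : WordCode K) : Prop :=
  ∃ w : ℕ × WordCode K × WordCode K, (∀ t ∈ w.2.1, t.2.count 0 ≤ w.1) ∧
    WordCode.eval c
      = WordCode.eval (((monicCode w.1 w.2.1).mul (monicCode w.1 w.2.1)).mul w.2.2)

/-- Certificate that a univariate polynomial has two roots whose quotient is not a root of unity. -/
def RatioCert (c c' : WordCode K) : Prop :=
  ∃ w : (ℕ × WordCode K × List K) × (WordCode K × WordCode K) × WordCode K × WordCode K,
    ((∀ t ∈ w.1.2.1, t.2.count 0 ≤ w.1.1) ∧
    ¬ (∀ z : AlgebraicClosure K, aeval z (univariate w.1.2.2) = 0 → ∃ N : ℕ, 0 < N ∧ z ^ N = 1)) ∧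
    WordCode.eval c = WordCode.eval ((monicCode w.1.1 w.1.2.1).mul w.2.1.1
      ++ (univariateWord 1 w.1.2.2).mul w.2.1.2) ∧
    WordCode.eval c' = WordCode.eval ((monicCode w.1.1 w.1.2.1).mul w.2.2.1
      ++ (univariateWord 1 w.1.2.2).mul w.2.2.2)

/-- Certificate that a univariate polynomial divides a binomial `1 - θ X ^ (E + 1)`. -/
def BinomialCert (c : WordCode K) (E : ℕ) : Prop :=
  ∃ w : K × WordCode K, WordCode.eval (c.mul w.2)
    = WordCode.eval [(1, []), (-w.1, (List.range (E + 1)).map fun _ => 0)]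

variable {c c' : WordCode K} {U : K[X]}

/-- Specializing all variables except `x₀` to zero gives a factorization over `K`; the factor keeps
its positive degree because it is monic. -/
theorem SquareCert.exists_dvd (h : SquareCert c) (hc : WordCode.eval c = aeval (MvPolynomial.X 0) U) :
    ∃ q : K[X], 0 < q.natDegree ∧ q * q ∣ U := by
  obtain ⟨⟨r, h, k⟩, h1, h2⟩ := h
  have := congrArg (lineEval (0 : K)) h2
  rw [hc, lineEval_aeval_X, Algebra.algebraMap_self, map_id, WordCode.eval_mul, WordCode.eval_mul,
    map_mul, map_mul] at this
  exact ⟨_, by rw [lineEval_monicCode _ h1]; omega, Dvd.intro _ this.symm⟩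

theorem squareCert_of_dvd (hc : WordCode.eval c = aeval (MvPolynomial.X 0) U) {q : K[X]}
    (hq : q.Monic) (hd : 0 < q.natDegree) (h : q * q ∣ U) : SquareCert c := by
  obtain ⟨k, hk⟩ := h
  obtain ⟨r, c₁, h1, h2⟩ := exists_monicCode (hq.map C) (by rwa [hq.natDegree_map])
  obtain ⟨c₂, h3⟩ := WordCode.eval_surjective (aeval (MvPolynomial.X 0 : MvPolynomial ℕ K) k)
  refine ⟨(r, c₁, c₂), h1, ?_⟩
  rw [WordCode.eval_mul, WordCode.eval_mul, h2, h3, hc, hk, bivariate_map_C, map_mul, map_mul]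

/-- Specialize `x₁` to a root `z` of `τ` that is not a root of unity. The terms with `τ` disappear,
the monic factor has a root `x`, and the two identities give `U(x) = 0` and `U(z x) = 0`. -/
theorem RatioCert.exists_ratio (h : RatioCert c c')
    (hc : WordCode.eval c = aeval (MvPolynomial.X 0) U)
    (hc' : WordCode.eval c' = aeval (MvPolynomial.X 1 * MvPolynomial.X 0) U) :
    ∃ x ζ : AlgebraicClosure K, aeval x U = 0 ∧ aeval (ζ * x) U = 0 ∧
      ∀ N : ℕ, 0 < N → ζ ^ N ≠ 1 := by
  obtain ⟨⟨⟨r, h, τ⟩, ⟨u, u'⟩, s, s'⟩, ⟨h1, h2⟩, h3, h4⟩ := h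
  simp only at h1 h2 h3 h4
  push Not at h2
  obtain ⟨z, hz, hz1⟩ := h2
  have hd := lineEval_monicCode z h1
  obtain ⟨x, hx⟩ := IsAlgClosed.exists_root (lineEval z (WordCode.eval (monicCode r h)))
    (degree_ne_of_natDegree_ne (by rw [hd]; exact Nat.succ_ne_zero r))
  have hτ : lineEval z (WordCode.eval (univariateWord 1 τ)) = 0 := by
    rw [eval_univariateWord, lineEval_aeval_X_one, hz, C_0]
  refine ⟨x, z, ?_, ?_, hz1⟩
  · have := congrArg (fun q => (lineEval z q).eval x) h3
    simp only [WordCode.eval_append, WordCode.eval_mul, map_add, map_mul, hτ, zero_mul, add_zero,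
      eval_mul, hx.eq_zero, hc, lineEval_aeval_X, eval_map_algebraMap] at this
    exact this
  · have := congrArg (fun q => (lineEval z q).eval x) h4
    simp only [WordCode.eval_append, WordCode.eval_mul, map_add, map_mul, hτ, zero_mul, add_zero,
      eval_mul, hx.eq_zero, hc', lineEval_aeval_X_mul] at this
    exact this

theorem ratioCert_of_ratio (hc : WordCode.eval c = aeval (MvPolynomial.X 0) U)
    (hc' : WordCode.eval c' = aeval (MvPolynomial.X 1 * MvPolynomial.X 0) U)
    {x ζ : AlgebraicClosure K} (hx : aeval x U = 0) (hζ : aeval (ζ * x) U = 0)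
    (h1 : ∀ N : ℕ, 0 < N → ζ ^ N ≠ 1) : RatioCert c c' := by
  obtain ⟨τ, h, u, u', s, s', hτ, hm, hd, e, e'⟩ := exists_bivariate_of_ratio hx hζ
  obtain ⟨l, rfl⟩ := univariate_surjective τ
  obtain ⟨r, c₁, hc₁, hh⟩ := exists_monicCode hm hd
  choose code hcode using WordCode.eval_surjective (K := K)
  refine ⟨((r, c₁, l), (code (bivariate K u), code (bivariate K u')), code (bivariate K s),
    code (bivariate K s')), ⟨hc₁, fun hall => ?_⟩, ?_, ?_⟩
  · obtain ⟨N, hN, hN1⟩ := hall ζ hτ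
    exact h1 N hN hN1
  · rw [WordCode.eval_append, WordCode.eval_mul, WordCode.eval_mul, hh, hcode, hcode, hc,
      eval_univariateWord, ← bivariate_C, ← bivariate_map_C, e, map_add, map_mul, map_mul]
  · rw [WordCode.eval_append, WordCode.eval_mul, WordCode.eval_mul, hh, hcode, hcode, hc',
      eval_univariateWord, ← bivariate_C, ← bivariate_comp, e', map_add, map_mul, map_mul]

theorem eval_binomial (θ : K) (E : ℕ) :
    WordCode.eval [(1, []), (-θ, (List.range E).map fun _ => 0)]
      = aeval (MvPolynomial.X 0) (1 - C θ * X ^ E) := by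
  rw [WordCode.eval_cons, WordCode.eval_cons, WordCode.eval_nil]
  simp [wordMonomial, sub_eq_add_neg, MvPolynomial.algebraMap_eq]

theorem binomialCert_iff (hc : WordCode.eval c = aeval (MvPolynomial.X 0) U) {E : ℕ} :
    BinomialCert c E ↔ ∃ θ, U ∣ 1 - C θ * X ^ (E + 1) := by
  constructor
  · rintro ⟨⟨θ, k⟩, h⟩
    have := congrArg (lineEval (0 : K)) h
    rw [WordCode.eval_mul, hc, map_mul, lineEval_aeval_X, Algebra.algebraMap_self, map_id,
      eval_binomial, lineEval_aeval_X, Algebra.algebraMap_self, map_id] at this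
    exact ⟨θ, Dvd.intro _ this⟩
  · rintro ⟨θ, k, hk⟩
    obtain ⟨c₂, h3⟩ := WordCode.eval_surjective (aeval (MvPolynomial.X 0 : MvPolynomial ℕ K) k)
    exact ⟨(θ, c₂), by rw [WordCode.eval_mul, hc, h3, eval_binomial, hk, map_mul]⟩

end UnivariateCertificates

/-! ### Semidecidability of the univariate certificates. -/

section UnivariateSigma

variable {K : Type*} [Field K] [Primcodable K] {α : Type*} [Primcodable α]

theorem Cmp.monicCode {r : α → ℕ} {h : α → WordCode K} (hr : Computable r) (hh : Computable h) :
    Computable fun a => monicCode (r a) (h a) := by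
  refine (Cmp.cons (Cmp.pair (Cmp.const (1 : K)) (Cmp.map (g := fun _ _ => 0)
    (Cmp.range (Cmp.add hr (Cmp.const 1))) (Cmp.const 0))) hh).of_eq fun a => ?_
  rw [SeparatedVariables.monicCode, List.map_const', List.length_range]

theorem Sigma1.squareCert (hK : IsComputableField K) {c : α → WordCode K} (hc : Computable c) :
    Sigma1 fun a => SquareCert (c a) := by
  refine Sigma1.ex (Sigma1.of_decP (DecP.and (DecP.ball (Cmp.fst (Cmp.snd (Cmp.snd Cmp.id)))
    (DecP.le (Cmp.count (Cmp.const 0) (Cmp.snd (Cmp.snd Cmp.id)))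
      (Cmp.fst (Cmp.snd (Cmp.fst Cmp.id))))) ?_))
  have hm := Cmp.monicCode (Cmp.fst (Cmp.snd (Cmp.id (α := α × ℕ × WordCode K × WordCode K))))
    (Cmp.fst (Cmp.snd (Cmp.snd Cmp.id)))
  exact DecP.eval_eq hK (hc.comp (Cmp.fst Cmp.id)) (Cmp.wmul hK (Cmp.wmul hK hm hm)
    (Cmp.snd (Cmp.snd (Cmp.snd Cmp.id))))

theorem Sigma1.ratioCert (hK : IsComputableField K) (hU : DecidesRootsOfUnity K)
    {c c' : α → WordCode K} (hc : Computable c) (hc' : Computable c') :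
    Sigma1 fun a => RatioCert (c a) (c' a) := by
  refine Sigma1.ex (Sigma1.of_decP (DecP.and (DecP.and
    (DecP.ball (Cmp.fst (Cmp.snd (Cmp.fst (Cmp.snd Cmp.id))))
      (DecP.le (Cmp.count (Cmp.const 0) (Cmp.snd (Cmp.snd Cmp.id)))
        (Cmp.fst (Cmp.fst (Cmp.snd (Cmp.fst Cmp.id)))))) ?_) (DecP.and ?_ ?_)))
  -- Here the test for roots of unity enters: its negation has to be verified for `τ`.
  · exact ((DecP.of_computablePred hU).comp
      (Cmp.snd (Cmp.snd (Cmp.fst (Cmp.snd Cmp.id))))).not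
  · exact DecP.eval_eq hK (hc.comp (Cmp.fst Cmp.id)) (Cmp.append
      (Cmp.wmul hK (Cmp.monicCode (Cmp.fst (Cmp.fst (Cmp.snd Cmp.id)))
        (Cmp.fst (Cmp.snd (Cmp.fst (Cmp.snd Cmp.id)))))
        (Cmp.fst (Cmp.fst (Cmp.snd (Cmp.snd Cmp.id)))))
      (Cmp.wmul hK (Cmp.univariateWord (Cmp.const 1) (Cmp.snd (Cmp.snd (Cmp.fst (Cmp.snd Cmp.id)))))
        (Cmp.snd (Cmp.fst (Cmp.snd (Cmp.snd Cmp.id))))))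
  · exact DecP.eval_eq hK (hc'.comp (Cmp.fst Cmp.id)) (Cmp.append
      (Cmp.wmul hK (Cmp.monicCode (Cmp.fst (Cmp.fst (Cmp.snd Cmp.id)))
        (Cmp.fst (Cmp.snd (Cmp.fst (Cmp.snd Cmp.id)))))
        (Cmp.fst (Cmp.snd (Cmp.snd (Cmp.snd Cmp.id)))))
      (Cmp.wmul hK (Cmp.univariateWord (Cmp.const 1) (Cmp.snd (Cmp.snd (Cmp.fst (Cmp.snd Cmp.id)))))
        (Cmp.snd (Cmp.snd (Cmp.snd (Cmp.snd Cmp.id))))))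

theorem Sigma1.binomialCert (hK : IsComputableField K) {c : α → WordCode K} {E : α → ℕ}
    (hc : Computable c) (hE : Computable E) : Sigma1 fun a => BinomialCert (c a) (E a) :=
  Sigma1.ex (Sigma1.of_decP (DecP.eval_eq hK (Cmp.wmul hK (hc.comp (Cmp.fst Cmp.id))
    (Cmp.snd (Cmp.snd Cmp.id))) (Cmp.cons (Cmp.const _) (Cmp.cons (Cmp.pair
      (Cmp.kneg hK (Cmp.fst (Cmp.snd Cmp.id)))
      (Cmp.map (Cmp.range (Cmp.add (hE.comp (Cmp.fst Cmp.id)) (Cmp.const 1))) (Cmp.const 0)))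
      (Cmp.const [])))))

end UnivariateSigma


/-! ### Certificates that all separated multiples are constant. -/

section TrivialCertificates

variable {K : Type*} [Field K] {n m : ℕ}

theorem PolyXYCode.toPoly_append (n m : ℕ) (c d : PolyXYCode K) :
    PolyXYCode.toPoly n m (c ++ d) = PolyXYCode.toPoly n m c + PolyXYCode.toPoly n m d := by
  rw [PolyXYCode.toPoly, List.map_append, List.sum_append]; rfl

/-- The exponent vector of a term. -/
noncomputable def termExp (n m : ℕ) (t : List ℕ × List ℕ) : Fin n ⊕ Fin m →₀ ℕ :=
  Finsupp.equivFunOnFinite.symm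
    (Sum.elim (fun i : Fin n => t.1.getD i 0) (fun j : Fin m => t.2.getD j 0))

theorem termExp_ofFn (d : Fin n ⊕ Fin m →₀ ℕ) :
    termExp n m (List.ofFn fun i => d (Sum.inl i), List.ofFn fun j => d (Sum.inr j)) = d := by
  ext x
  rcases x with i | j <;> simp [termExp]

theorem PolyXYCode.exists_of_mem_support {c : PolyXYCode K} {d : Fin n ⊕ Fin m →₀ ℕ}
    (hd : d ∈ (PolyXYCode.toPoly n m c).support) : ∃ t ∈ c, termExp n m t.2 = d := by
  classical
  induction c with
  | nil => simp [PolyXYCode.toPoly] at hd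
  | cons t c ih =>
    rw [PolyXYCode.toPoly_cons] at hd
    rcases Finset.mem_union.1 (MvPolynomial.support_add hd) with h | h
    · refine ⟨t, List.mem_cons_self, ?_⟩
      exact (Finset.mem_singleton.1 (MvPolynomial.support_monomial_subset h)).symm
    · obtain ⟨s, hs, e⟩ := ih h
      exact ⟨s, List.mem_cons_of_mem _ hs, e⟩

theorem PolyXYCode.exists_toPoly_eq (q : PolyXY K n m) :
    ∃ c : PolyXYCode K, PolyXYCode.toPoly n m c = q ∧ ∀ t ∈ c, termExp n m t.2 ∈ q.support := by
  classical
  refine ⟨q.support.toList.map fun d => (q.coeff d, List.ofFn fun i => d (Sum.inl i),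
    List.ofFn fun j => d (Sum.inr j)), ?_, ?_⟩
  · rw [PolyXYCode.toPoly, List.map_map]
    conv_rhs => rw [q.as_sum]
    rw [← Finset.sum_map_toList]
    congr 1
    refine List.map_congr_left fun d _ => ?_
    have := termExp_ofFn d
    rw [termExp] at this
    simp only [Function.comp_apply]
    rw [this]
  · intro t ht
    obtain ⟨d, hd, rfl⟩ := List.mem_map.1 ht
    rw [termExp_ofFn]
    exact Finset.mem_toList.1 hd

theorem length_expWord (o n : ℕ) (e : List ℕ) :
    (expWord o n e).length = ∑ i : Fin n, e.getD i 0 := by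
  rw [expWord, List.length_flatMap, ← List.sum_ofFn, ← map_range_eq_ofFn n fun i => e.getD i 0]
  simp

/-- The weight of a term. -/
def termWeight (n m a b : ℕ) (t : List ℕ × List ℕ) : ℕ :=
  a * (expWord 0 n t.1).length + b * (expWord 0 m t.2).length

theorem termWeight_eq (a b : ℕ) (t : List ℕ × List ℕ) :
    termWeight n m a b t = Finsupp.weight (weights n m a b) (termExp n m t) := by
  rw [termWeight, weight_weights, length_expWord, length_expWord]
  rfl

/-- `P` is the code of the part of highest weight of `P ++ Q`. -/
def TopCert (n m : ℕ) (P Q : PolyXYCode K) (w : ℕ × ℕ × ℕ) : Prop :=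
  (0 < w.1 ∧ 0 < w.2.1) ∧ (∀ t ∈ P, termWeight n m w.1 w.2.1 t.2 = w.2.2) ∧
    ∀ t ∈ Q, termWeight n m w.1 w.2.1 t.2 < w.2.2

theorem TopCert.isTopForm {P Q : PolyXYCode K} {w : ℕ × ℕ × ℕ} (h : TopCert n m P Q w) :
    IsTopForm (weights n m w.1 w.2.1) (PolyXYCode.toPoly n m (P ++ Q)) (PolyXYCode.toPoly n m P)
      w.2.2 := by
  obtain ⟨-, h1, h2⟩ := h
  constructor
  · intro d hd
    obtain ⟨t, ht, rfl⟩ := PolyXYCode.exists_of_mem_support (MvPolynomial.mem_support_iff.2 hd)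
    rw [← termWeight_eq, h1 t ht]
  · intro d hd
    rw [PolyXYCode.toPoly_append, add_sub_cancel_left] at hd
    obtain ⟨t, ht, rfl⟩ := PolyXYCode.exists_of_mem_support hd
    rw [← termWeight_eq]
    exact h2 t ht

theorem exists_topCert {a b W : ℕ} {p P : PolyXY K n m} (ha : 0 < a) (hb : 0 < b)
    (h : IsTopForm (weights n m a b) p P W) : ∃ c d : PolyXYCode K, TopCert n m c d (a, b, W) ∧
      PolyXYCode.toPoly n m c = P ∧ PolyXYCode.toPoly n m (c ++ d) = p ∧
      ∀ t ∈ c, termExp n m t.2 ∈ P.support := by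
  obtain ⟨c, hc, hcs⟩ := PolyXYCode.exists_toPoly_eq P
  obtain ⟨d, hd, hds⟩ := PolyXYCode.exists_toPoly_eq (p - P)
  refine ⟨c, d, ⟨⟨ha, hb⟩, fun t ht => ?_, fun t ht => ?_⟩, hc, ?_, hcs⟩
  · rw [termWeight_eq]
    exact h.homogeneous (MvPolynomial.mem_support_iff.1 (hcs t ht))
  · rw [termWeight_eq]
    exact h.lower _ (hds t ht)
  · rw [PolyXYCode.toPoly_append, hc, hd, add_sub_cancel]

/-- All terms involve both groups of variables. -/
def MixedCert (n m : ℕ) (P : PolyXYCode K) : Prop :=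
  (∀ t ∈ P, 0 < (expWord 0 n t.2.1).length ∧ 0 < (expWord 0 m t.2.2).length) ∧
    ¬ WordCode.eval (codeXY n m P) = 0

theorem eval_codeXY_eq_zero_iff {P : PolyXYCode K} :
    WordCode.eval (codeXY n m P) = 0 ↔ PolyXYCode.toPoly n m P = 0 := by
  rw [eval_codeXY, map_eq_zero_iff _ (MvPolynomial.rename_injective _ (varIndex_injective n m))]

theorem MixedCert.restrict_eq_zero {P : PolyXYCode K} (h : MixedCert n m P) :
    restrictX K n m (PolyXYCode.toPoly n m P) = 0 ∧
      restrictY K n m (PolyXYCode.toPoly n m P) = 0 := by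
  have key : ∀ d ∈ (PolyXYCode.toPoly n m P).support,
      0 < ∑ i, d (Sum.inl i) ∧ 0 < ∑ j, d (Sum.inr j) := by
    intro d hd
    obtain ⟨t, ht, rfl⟩ := PolyXYCode.exists_of_mem_support hd
    have := h.1 t ht
    rwa [length_expWord, length_expWord] at this
  constructor
  · ext e
    rw [coeff_restrictX, MvPolynomial.coeff_zero]
    by_contra h0
    have := (key _ (MvPolynomial.mem_support_iff.2 h0)).2
    refine this.ne' (Finset.sum_eq_zero fun j _ => ?_)
    exact Finsupp.mapDomain_of_notMem_range _ _ (by simp)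
  · ext e
    rw [coeff_restrictY, MvPolynomial.coeff_zero]
    by_contra h0
    have := (key _ (MvPolynomial.mem_support_iff.2 h0)).1
    refine this.ne' (Finset.sum_eq_zero fun j _ => ?_)
    exact Finsupp.mapDomain_of_notMem_range _ _ (by simp)

theorem getD_append_varIndex {β : Type*} (f g : ℕ → β) (d : β) (x : Fin n ⊕ Fin m) :
    ((List.range n).map f ++ (List.range m).map g).getD (varIndex n m x) d
      = Sum.elim (fun i : Fin n => f i) (fun j : Fin m => g j) x := by
  rcases x with i | j
  · have h : varIndex n m (Sum.inl i) < ((List.range n).map f).length := by simp [varIndex]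
    rw [List.getD_append _ _ _ _ h, List.getD_eq_getElem _ _ h]
    simp [varIndex]
  · have h : ((List.range n).map f).length ≤ varIndex n m (Sum.inr j) := by simp [varIndex]
    rw [List.getD_append_right _ _ _ _ h, List.getD_eq_getElem _ _ (by simp [varIndex])]
    simp [varIndex]

/-- The list of values of all variables. -/
def pointXY (n m : ℕ) (v w : List K) : List K :=
  ((List.range n).map fun i => v.getD i 0) ++ (List.range m).map fun j => w.getD j 0

theorem value_pointXY (v w : List K) {c : WordCode K} {q : PolyXY K n m}
    (hc : WordCode.eval c = MvPolynomial.rename (varIndex n m) q) :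
    WordCode.value (pointXY n m v w) c
      = MvPolynomial.aeval (Sum.elim (listVec n v) (listVec m w)) q := by
  rw [WordCode.value_eq, hc, MvPolynomial.aeval_rename]
  congr 2
  funext x
  rw [Function.comp_apply, pointXY, getD_append_varIndex]
  rfl

/-- Values of the variables on a line. -/
def lineCodes (n m : ℕ) (v w : List K) (u : List ℕ) : List (WordCode K) :=
  ((List.range n).map fun i => [(v.getD i 0, [])]) ++ (List.range m).map fun j => [(w.getD j 0, u)]

theorem eval_subst_lineCodes (v w : List K) (u : List ℕ) (P : PolyXYCode K) :
    WordCode.eval (WordCode.subst (lineCodes n m v w u) (codeXY n m P))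
      = aeval (wordMonomial K u) (lineU (listVec n v) (listVec m w) (PolyXYCode.toPoly n m P)) := by
  rw [WordCode.eval_subst, eval_codeXY, MvPolynomial.aeval_rename, lineU]
  refine Eq.trans ?_ (MvPolynomial.comp_aeval_apply _
    (aeval (wordMonomial K u) : K[X] →ₐ[K] MvPolynomial ℕ K) _).symm
  congr 2
  funext x
  rw [Function.comp_apply, lineCodes, getD_append_varIndex]
  rcases x with i | j <;> simp [listVec, WordCode.eval_cons, WordCode.eval_nil, wordMonomial,
    MvPolynomial.algebraMap_eq]

/-- The part of highest weight has pure parts of both kinds. -/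
def ShapeCert (n m W : ℕ) (P : PolyXYCode K) (vw : List K × List K) : Prop :=
  0 < W ∧ ¬ WordCode.value (pointXY n m vw.1 []) (codeXY n m P) = 0 ∧
    ¬ WordCode.value (pointXY n m [] vw.2) (codeXY n m P) = 0

theorem listVec_nil (n : ℕ) : listVec n ([] : List K) = 0 := rfl

theorem hasShape_iff {P Q : PolyXYCode K} {w : ℕ × ℕ × ℕ} (h : TopCert n m P Q w)
    (vw : List K × List K) : ShapeCert n m w.2.2 P vw ↔
      HasShape (PolyXYCode.toPoly n m (P ++ Q)) (PolyXYCode.toPoly n m P) w.1 w.2.1 w.2.2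
        (listVec n vw.1) (listVec m vw.2) := by
  rw [ShapeCert, value_pointXY _ _ (eval_codeXY n m P), value_pointXY _ _ (eval_codeXY n m P),
    listVec_nil, listVec_nil]
  exact ⟨fun ⟨h1, h2, h3⟩ => ⟨h.1.1, h.1.2, h1, h.isTopForm, h2, h3⟩,
    fun h' => ⟨h'.W_pos, h'.pureX, h'.pureY⟩⟩

/-- Certificate that `P ++ Q` codes a polynomial `p` for which the separated algebra of `(p)`
consists of constants. -/
def TrivCert (n m : ℕ) (P Q : PolyXYCode K) : Prop :=
  ∃ w : ℕ × ℕ × ℕ, TopCert n m P Q w ∧ (MixedCert n m P ∨ ∃ vw : List K × List K,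
    ShapeCert n m w.2.2 P vw ∧
      (SquareCert (WordCode.subst (lineCodes n m vw.1 vw.2 [0]) (codeXY n m P)) ∨
      RatioCert (WordCode.subst (lineCodes n m vw.1 vw.2 [0]) (codeXY n m P))
        (WordCode.subst (lineCodes n m vw.1 vw.2 [1, 0]) (codeXY n m P)) ∨
      ∃ E : ℕ, BinomialCert (WordCode.subst (lineCodes n m vw.1 vw.2 [0]) (codeXY n m P)) E ∧
        Cover n m [] [P ++ Q] ((w.1 + w.2.1) * (E + 1))))

theorem eval_subst_lineCodes_zero (v w : List K) (P : PolyXYCode K) :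
    WordCode.eval (WordCode.subst (lineCodes n m v w [0]) (codeXY n m P))
      = aeval (MvPolynomial.X 0)
        (lineU (listVec n v) (listVec m w) (PolyXYCode.toPoly n m P)) := by
  rw [eval_subst_lineCodes, wordMonomial, List.map_singleton, List.prod_singleton]

theorem eval_subst_lineCodes_one_zero (v w : List K) (P : PolyXYCode K) :
    WordCode.eval (WordCode.subst (lineCodes n m v w [1, 0]) (codeXY n m P))
      = aeval (MvPolynomial.X 1 * MvPolynomial.X 0)
        (lineU (listVec n v) (listVec m w) (PolyXYCode.toPoly n m P)) := by
  rw [eval_subst_lineCodes, wordMonomial, List.map_cons, List.map_singleton, List.prod_cons,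
    List.prod_singleton]

theorem idealOf_singleton (c : PolyXYCode K) :
    idealOf n m [c] = Ideal.span {PolyXYCode.toPoly n m c} := by
  rw [idealOf]
  congr 1
  ext q
  simp

theorem algebraOf_nil : algebraOf (K := K) n m [] = ⊥ := by
  rw [algebraOf]
  simp

/-- In the case with pure terms, a nonconstant pair makes `U` divide a binomial. This contradicts a
multiple factor and a quotient of roots that is not a root of unity. If `U` divides a binomial with
exponent `E + 1`, then some nonconstant pair has degrees `b (E + 1)` and `a (E + 1)`, and the check
up to that degree excludes it. -/
theorem TrivCert.separatedAlgebra_eq_bot [CharZero K] {P Q : PolyXYCode K}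
    (h : TrivCert n m P Q) :
    separatedAlgebra (Ideal.span {PolyXYCode.toPoly n m (P ++ Q)}) = ⊥ := by
  obtain ⟨w, hw, hmix | ⟨vw, hs, h⟩⟩ := h
  · exact separatedAlgebra_eq_bot_of_mixed hw.1.1 hw.1.2 hw.isTopForm
      (fun h0 => hmix.2 (eval_codeXY_eq_zero_iff.2 h0)) hmix.restrict_eq_zero.1
      hmix.restrict_eq_zero.2
  · by_contra hA
    have hshape := (hasShape_iff hw vw).1 hs
    obtain ⟨-, -, M, γ, -, -, hM, -, hU⟩ := hshape.exists_lineU_dvd hA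
    rcases h with h | h | ⟨E, h, hcov⟩
    · obtain ⟨q, hq, hqq⟩ := h.exists_dvd (eval_subst_lineCodes_zero _ _ _)
      exact not_mul_self_dvd_of_dvd hM hU hq hqq
    · obtain ⟨x, ζ, hx, hζ, h1⟩ := h.exists_ratio (eval_subst_lineCodes_zero _ _ _)
        (eval_subst_lineCodes_one_zero _ _ _)
      exact h1 M hM (pow_eq_one_of_dvd hU hx hζ)
    · obtain ⟨θ, hθ⟩ := (binomialCert_iff (eval_subst_lineCodes_zero _ _ _)).1 h
      -- Both degrees are below the bound `(a + b) * (E + 1)` used in the certificate.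
      obtain ⟨f, g, hfg, hf, hg⟩ := hshape.exists_totalDegree_eq (Nat.succ_pos E) hθ hA
      have hmem : (f, g) ∈ algebraOf (K := K) n m [] := by
        refine hcov.mem ?_ ?_ ?_ ?_
        · rw [algebraOf_nil]; exact bot_le
        · rw [idealOf_singleton, mem_separatedAlgebra_span']; exact hfg
        · rw [hf]; gcongr; exact Nat.le_add_left _ _
        · rw [hg]; gcongr; exact Nat.le_add_right _ _
      rw [algebraOf_nil] at hmem
      obtain ⟨r, hr⟩ := Algebra.mem_bot.1 hmem
      have : f = MvPolynomial.C r := (congrArg Prod.fst hr).symm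
      rw [this, MvPolynomial.totalDegree_C] at hf
      have := Nat.mul_pos hw.1.2 (Nat.succ_pos E)
      omega

/-- The trichotomy for `U` is exhaustive, and in the binomial case `exists_cover` applies with the
empty output because the algebra is trivial. -/
theorem exists_trivCert [CharZero K] {p : PolyXY K n m} (hX : p ∉ (inclX K n m).range)
    (hY : p ∉ (inclY K n m).range) (hA : separatedAlgebra (Ideal.span {p}) = ⊥) :
    ∃ P Q : PolyXYCode K, PolyXYCode.toPoly n m (P ++ Q) = p ∧ TrivCert n m P Q := by
  obtain ⟨a, b, W, P', ha, hb, htop, hP, h⟩ := exists_weights hX hY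
  obtain ⟨P, Q, hw, rfl, rfl, hsupp⟩ := exists_topCert ha hb htop
  refine ⟨P, Q, rfl, (a, b, W), hw, ?_⟩
  rcases h with h | ⟨v, w, h⟩
  · refine Or.inl ⟨fun t ht => ?_, fun h0 => hP (eval_codeXY_eq_zero_iff.1 h0)⟩
    obtain ⟨⟨i, hi⟩, j, hj⟩ := h _ (hsupp t ht)
    rw [length_expWord, length_expWord]
    exact ⟨Finset.sum_pos' (fun _ _ => Nat.zero_le _) ⟨i, Finset.mem_univ i, Nat.pos_of_ne_zero hi⟩,
      Finset.sum_pos' (fun _ _ => Nat.zero_le _) ⟨j, Finset.mem_univ j, Nat.pos_of_ne_zero hj⟩⟩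
  · rw [← listVec_ofFn v, ← listVec_ofFn w] at h
    refine Or.inr ⟨(List.ofFn v, List.ofFn w), (hasShape_iff hw _).2 h, ?_⟩
    rcases multiple_factor_or_ratio_or_dvd_binomial (AlgebraicClosure K) h.lineU_eval_zero with
      ⟨q, hq, hd, hqq⟩ | ⟨x, ζ, hx, hζ, h1⟩ | ⟨θ, E, hE, hθ⟩
    · exact Or.inl (squareCert_of_dvd (eval_subst_lineCodes_zero _ _ _) hq hd hqq)
    · exact Or.inr (Or.inl (ratioCert_of_ratio (eval_subst_lineCodes_zero _ _ _)
        (eval_subst_lineCodes_one_zero _ _ _) hx hζ h1))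
    · obtain ⟨E, rfl⟩ : ∃ E', E = E' + 1 := ⟨_, (Nat.succ_pred_eq_of_pos hE).symm⟩
      refine Or.inr (Or.inr ⟨E, (binomialCert_iff (eval_subst_lineCodes_zero _ _ _)).2 ⟨θ, hθ⟩,
        exists_cover ?_ _⟩)
      rw [idealOf_singleton, hA]
      exact bot_le

end TrivialCertificates

/-! ### Semidecidability of triviality. -/

section TrivialSigma

variable {K : Type*} [Field K] [Primcodable K] {α : Type*} [Primcodable α]

theorem Cmp.pointXY {n m : α → ℕ} {v w : α → List K} (hn : Computable n) (hm : Computable m)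
    (hv : Computable v) (hw : Computable w) :
    Computable fun a => pointXY (n a) (m a) (v a) (w a) :=
  Cmp.append (Cmp.map (Cmp.range hn) (Cmp.getD 0 (hv.comp (Cmp.fst Cmp.id)) (Cmp.snd Cmp.id)))
    (Cmp.map (Cmp.range hm) (Cmp.getD 0 (hw.comp (Cmp.fst Cmp.id)) (Cmp.snd Cmp.id)))

theorem Cmp.lineCodes {n m : α → ℕ} {v w : α → List K} {u : α → List ℕ} (hn : Computable n)
    (hm : Computable m) (hv : Computable v) (hw : Computable w) (hu : Computable u) :
    Computable fun a => lineCodes (n a) (m a) (v a) (w a) (u a) :=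
  Cmp.append (Cmp.map (Cmp.range hn) (Cmp.cons (Cmp.pair (Cmp.getD 0 (hv.comp (Cmp.fst Cmp.id))
      (Cmp.snd Cmp.id)) (Cmp.const [])) (Cmp.const [])))
    (Cmp.map (Cmp.range hm) (Cmp.cons (Cmp.pair (Cmp.getD 0 (hw.comp (Cmp.fst Cmp.id))
      (Cmp.snd Cmp.id)) (hu.comp (Cmp.fst Cmp.id))) (Cmp.const [])))

theorem Cmp.termWeight {n m a b : α → ℕ} {t : α → List ℕ × List ℕ} (hn : Computable n)
    (hm : Computable m) (ha : Computable a) (hb : Computable b) (ht : Computable t) :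
    Computable fun x => termWeight (n x) (m x) (a x) (b x) (t x) :=
  Cmp.add (Cmp.mul ha (Cmp.length (Cmp.expWord (Cmp.const 0) hn (Cmp.fst ht))))
    (Cmp.mul hb (Cmp.length (Cmp.expWord (Cmp.const 0) hm (Cmp.snd ht))))

theorem DecP.topCert {F : Type*} [Primcodable F] {n m : α → ℕ} {P Q : α → PolyXYCode F}
    {w : α → ℕ × ℕ × ℕ}
    (hn : Computable n) (hm : Computable m) (hP : Computable P) (hQ : Computable Q)
    (hw : Computable w) : DecP fun a => TopCert (n a) (m a) (P a) (Q a) (w a) := by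
  refine DecP.and (DecP.and (DecP.lt (Cmp.const 0) (Cmp.fst hw))
    (DecP.lt (Cmp.const 0) (Cmp.fst (Cmp.snd hw)))) (DecP.and (DecP.ball hP ?_) (DecP.ball hQ ?_))
  · have hw' := hw.comp (Cmp.fst (Cmp.id (α := α × F × List ℕ × List ℕ)))
    exact DecP.eq (Cmp.termWeight (hn.comp (Cmp.fst Cmp.id)) (hm.comp (Cmp.fst Cmp.id))
      (Cmp.fst hw') (Cmp.fst (Cmp.snd hw')) (Cmp.snd (Cmp.snd Cmp.id))) (Cmp.snd (Cmp.snd hw'))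
  · have hw' := hw.comp (Cmp.fst (Cmp.id (α := α × F × List ℕ × List ℕ)))
    exact DecP.lt (Cmp.termWeight (hn.comp (Cmp.fst Cmp.id)) (hm.comp (Cmp.fst Cmp.id))
      (Cmp.fst hw') (Cmp.fst (Cmp.snd hw')) (Cmp.snd (Cmp.snd Cmp.id))) (Cmp.snd (Cmp.snd hw'))

theorem DecP.mixedCert (hK : IsComputableField K) {n m : α → ℕ} {P : α → PolyXYCode K}
    (hn : Computable n) (hm : Computable m) (hP : Computable P) :
    DecP fun a => MixedCert (n a) (m a) (P a) := by
  refine DecP.and (DecP.ball hP (DecP.and ?_ ?_)) (DecP.eval_eq_zero hK (Cmp.codeXY hn hm hP)).not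
  · exact DecP.lt (Cmp.const 0) (Cmp.length (Cmp.expWord (Cmp.const 0) (hn.comp (Cmp.fst Cmp.id))
      (Cmp.fst (Cmp.snd (Cmp.snd Cmp.id)))))
  · exact DecP.lt (Cmp.const 0) (Cmp.length (Cmp.expWord (Cmp.const 0) (hm.comp (Cmp.fst Cmp.id))
      (Cmp.snd (Cmp.snd (Cmp.snd Cmp.id)))))

theorem DecP.shapeCert (hK : IsComputableField K) {n m W : α → ℕ} {P : α → PolyXYCode K}
    {vw : α → List K × List K} (hn : Computable n) (hm : Computable m) (hW : Computable W)
    (hP : Computable P) (hvw : Computable vw) :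
    DecP fun a => ShapeCert (n a) (m a) (W a) (P a) (vw a) := by
  refine DecP.and (DecP.lt (Cmp.const 0) hW) (DecP.and (DecP.not ?_) (DecP.not ?_))
  · exact DecP.eq (Cmp.wvalue hK (Cmp.pointXY hn hm (Cmp.fst hvw) (Cmp.const []))
      (Cmp.codeXY hn hm hP)) (Cmp.const 0)
  · exact DecP.eq (Cmp.wvalue hK (Cmp.pointXY hn hm (Cmp.const []) (Cmp.snd hvw))
      (Cmp.codeXY hn hm hP)) (Cmp.const 0)

theorem Sigma1.trivCert (hK : IsComputableField K) (hU : DecidesRootsOfUnity K) {n m : α → ℕ}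
    {P Q : α → PolyXYCode K} (hn : Computable n) (hm : Computable m) (hP : Computable P)
    (hQ : Computable Q) : Sigma1 fun a => TrivCert (n a) (m a) (P a) (Q a) := by
  have f1 := Cmp.fst (Cmp.id (α := α × ℕ × ℕ × ℕ))
  refine Sigma1.ex (Sigma1.and (Sigma1.of_decP (DecP.topCert (hn.comp f1) (hm.comp f1) (hP.comp f1)
    (hQ.comp f1) (Cmp.snd Cmp.id))) (Sigma1.or (Sigma1.of_decP (DecP.mixedCert hK (hn.comp f1)
    (hm.comp f1) (hP.comp f1))) ?_))
  have f2 := Cmp.fst (Cmp.id (α := (α × ℕ × ℕ × ℕ) × List K × List K))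
  have g2 := Cmp.snd (Cmp.id (α := (α × ℕ × ℕ × ℕ) × List K × List K))
  have f3 := Cmp.fst f2
  have hc : ∀ u : List ℕ, Computable fun q : (α × ℕ × ℕ × ℕ) × List K × List K =>
      WordCode.subst (lineCodes (n q.1.1) (m q.1.1) q.2.1 q.2.2 u)
        (codeXY (n q.1.1) (m q.1.1) (P q.1.1)) := fun u =>
    Cmp.wsubst hK (Cmp.lineCodes (hn.comp f3) (hm.comp f3) (Cmp.fst g2) (Cmp.snd g2) (Cmp.const u))
      (Cmp.codeXY (hn.comp f3) (hm.comp f3) (hP.comp f3))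
  refine Sigma1.ex (Sigma1.and (Sigma1.of_decP (DecP.shapeCert hK (hn.comp f3) (hm.comp f3)
    (Cmp.snd (Cmp.snd (Cmp.snd f2))) (hP.comp f3) g2)) (Sigma1.or (Sigma1.squareCert hK (hc [0]))
    (Sigma1.or (Sigma1.ratioCert hK hU (hc [0]) (hc [1, 0])) (Sigma1.ex (Sigma1.and ?_ ?_)))))
  · exact Sigma1.binomialCert hK ((hc [0]).comp (Cmp.fst Cmp.id)) (Cmp.snd Cmp.id)
  · have f4 := Cmp.fst (Cmp.id (α := ((α × ℕ × ℕ × ℕ) × List K × List K) × ℕ))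
    have f5 := Cmp.fst (Cmp.fst f4)
    have f6 := Cmp.snd (Cmp.fst f4)
    exact Sigma1.cover hK (hn.comp f5) (hm.comp f5) (Cmp.const [])
      (Cmp.cons (Cmp.append (hP.comp f5) (hQ.comp f5)) (Cmp.const []))
      (Cmp.mul (Cmp.add (Cmp.fst f6) (Cmp.fst (Cmp.snd f6)))
        (Cmp.add (Cmp.snd Cmp.id) (Cmp.const 1)))

end TrivialSigma


/-! ### Certificates for generators. -/

section Certificates

variable {K : Type*} [Field K] {n m : ℕ}

theorem aeval_inclX {B : Type*} [CommRing B] [Algebra K B] (v : Fin n → B) (w : Fin m → B)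
    (f : MvPolynomial (Fin n) K) :
    MvPolynomial.aeval (Sum.elim v w) (inclX K n m f) = MvPolynomial.aeval v f := by
  rw [inclX, MvPolynomial.aeval_rename, Sum.elim_comp_inl]

theorem aeval_inclY {B : Type*} [CommRing B] [Algebra K B] (v : Fin n → B) (w : Fin m → B)
    (f : MvPolynomial (Fin m) K) :
    MvPolynomial.aeval (Sum.elim v w) (inclY K n m f) = MvPolynomial.aeval w f := by
  rw [inclY, MvPolynomial.aeval_rename, Sum.elim_comp_inr]

/-- Over an infinite field polynomials are determined by their values, so genuine dependence on `Y`
is witnessed by two points. This makes the condition verifiable by a search. -/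
theorem notMem_range_inclX_iff [Infinite K] {p : PolyXY K n m} : p ∉ (inclX K n m).range ↔
    ∃ (v : Fin n → K) (w w' : Fin m → K), MvPolynomial.aeval (Sum.elim v w : _ → K) p
      ≠ MvPolynomial.aeval (Sum.elim v w' : _ → K) p := by
  constructor
  · contrapose!
    intro h
    refine ⟨restrictX K n m p, ?_⟩
    refine MvPolynomial.funext fun x => ?_
    change MvPolynomial.eval x (inclX K n m _) = _
    rw [← Sum.elim_comp_inl_inr x]
    have := h (x ∘ Sum.inl) 0 (x ∘ Sum.inr)
    rw [← aeval_restrictX, ← aeval_inclX (m := m) (x ∘ Sum.inl) (x ∘ Sum.inr)] at this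
    simpa only [MvPolynomial.aeval_eq_eval] using this
  · rintro ⟨v, w, w', h⟩ ⟨f, rfl⟩
    exact h ((aeval_inclX v w f).trans (aeval_inclX v w' f).symm)

theorem notMem_range_inclY_iff [Infinite K] {p : PolyXY K n m} : p ∉ (inclY K n m).range ↔
    ∃ (v v' : Fin n → K) (w : Fin m → K), MvPolynomial.aeval (Sum.elim v w : _ → K) p
      ≠ MvPolynomial.aeval (Sum.elim v' w : _ → K) p := by
  constructor
  · contrapose!
    intro h
    refine ⟨restrictY K n m p, ?_⟩
    refine MvPolynomial.funext fun x => ?_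
    change MvPolynomial.eval x (inclY K n m _) = _
    rw [← Sum.elim_comp_inl_inr x]
    have := h 0 (x ∘ Sum.inl) (x ∘ Sum.inr)
    rw [← aeval_restrictY, ← aeval_inclY (n := n) (x ∘ Sum.inl) (x ∘ Sum.inr)] at this
    simpa only [MvPolynomial.aeval_eq_eval] using this
  · rintro ⟨v, v', w, h⟩ ⟨f, rfl⟩
    exact h ((aeval_inclY v w f).trans (aeval_inclY v' w f).symm)

theorem totalDegree_pos_iff [Infinite K] {f : MvPolynomial (Fin n) K} : 0 < f.totalDegree ↔
    ∃ v v' : Fin n → K, MvPolynomial.aeval v f ≠ MvPolynomial.aeval v' f := by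
  constructor
  · contrapose!
    intro h
    have : f = MvPolynomial.C (MvPolynomial.aeval (0 : Fin n → K) f) := by
      refine MvPolynomial.funext fun x => ?_
      rw [MvPolynomial.eval_C, ← h x 0, MvPolynomial.aeval_eq_eval]
    rw [this, MvPolynomial.totalDegree_C]
  · rintro ⟨v, v', h⟩
    by_contra h0
    rw [not_lt, Nat.le_zero, MvPolynomial.totalDegree_eq_zero_iff_eq_C] at h0
    refine h ?_
    rw [h0, MvPolynomial.aeval_C, MvPolynomial.aeval_C]

theorem two_mul_totalDegree_le {N : ℕ} {c : PolyCode K}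
    (h : ∀ t ∈ c, 2 * (expWord 0 n t.2).length ≤ N) : 2 * (PolyCode.toPoly n c).totalDegree ≤ N := by
  induction c with
  | nil => simp [PolyCode.toPoly]
  | cons t c ih =>
    have h1 := ih fun s hs => h s (List.mem_cons_of_mem _ hs)
    have h2 := h t List.mem_cons_self
    have h3 : (MvPolynomial.monomial (Finsupp.equivFunOnFinite.symm fun i : Fin n => t.2.getD i 0)
        t.1).totalDegree ≤ (expWord 0 n t.2).length := by
      refine (MvPolynomial.totalDegree_monomial_le _ _).trans ?_
      rw [length_expWord, Finsupp.sum_fintype _ _ (by simp)]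
      simp
    rw [PolyCode.toPoly_cons]
    have h4 := MvPolynomial.totalDegree_add (MvPolynomial.monomial
      (Finsupp.equivFunOnFinite.symm fun i : Fin n => t.2.getD i 0) t.1) (PolyCode.toPoly n c)
    rcases le_max_iff.1 h4 with h5 | h5 <;> omega

/-- Certificate that the algebra generated by `out` is the separated algebra of the ideal given by
`L`, which is contained in the principal ideal given by `p`. -/
def GenCert (n m : ℕ) (L : List (PolyXYCode K)) (out : List (PolyCode K × PolyCode K))
    (p : PolyXYCode K) : Prop :=
  ∃ w : ((List K × List K × List K) × List K × List K × List K) × (List K × List K) ×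
      (PolyCode K × PolyCode K) × ℕ,
    (¬ WordCode.value (pointXY n m w.1.1.1 w.1.1.2.1) (codeXY n m p)
        = WordCode.value (pointXY n m w.1.1.1 w.1.1.2.2) (codeXY n m p) ∧
      ¬ WordCode.value (pointXY n m w.1.2.1 w.1.2.2.2) (codeXY n m p)
        = WordCode.value (pointXY n m w.1.2.2.1 w.1.2.2.2) (codeXY n m p) ∧
      ¬ WordCode.value (pointXY n m w.2.1.1 []) (codeX 0 n w.2.2.1.1)
        = WordCode.value (pointXY n m w.2.1.2 []) (codeX 0 n w.2.2.1.1) ∧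
      (∀ t ∈ w.2.2.1.1, 2 * (expWord 0 n t.2).length ≤ w.2.2.2) ∧
      ∀ t ∈ w.2.2.1.2, 2 * (expWord 0 m t.2).length ≤ w.2.2.2) ∧
    MemIdeal n m L ((codeXY n m p).mul (codeX 0 n w.2.2.1.1)) ∧
    MemIdeal n m L (diffCode n m w.2.2.1) ∧
    (∀ c ∈ out, MemIdeal n m L (diffCode n m c)) ∧ Cover n m out L w.2.2.2

/-- Certificate that the algebra generated by `out` is the separated algebra of the ideal given by
`L`. -/
def Cert (n m : ℕ) (L : List (PolyXYCode K)) (out : List (PolyCode K × PolyCode K)) : Prop :=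
  ∃ w : PolyXYCode K × PolyXYCode K, (∀ c ∈ L, MemIdeal n m [w.1 ++ w.2] (codeXY n m c)) ∧
    ((TrivCert n m w.1 w.2 ∧ out = []) ∨ GenCert n m L out (w.1 ++ w.2))

variable {L : List (PolyXYCode K)} {out : List (PolyCode K × PolyCode K)}

theorem memIdeal_diffCode_iff {c : PolyCode K × PolyCode K} :
    MemIdeal n m L (diffCode n m c) ↔ pairOf n m c ∈ separatedAlgebra (idealOf n m L) :=
  memIdeal_iff (eval_diffCode n m c)

theorem memIdeal_mul_iff {p : PolyXYCode K} {F : PolyCode K} :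
    MemIdeal n m L ((codeXY n m p).mul (codeX 0 n F)) ↔
      PolyXYCode.toPoly n m p * inclX K n m (PolyCode.toPoly n F) ∈ idealOf n m L :=
  memIdeal_iff (by rw [WordCode.eval_mul, eval_codeXY, eval_codeX, map_mul, rename_inclX])

theorem idealOf_le_iff {p : PolyXYCode K} : (∀ c ∈ L, MemIdeal n m [p] (codeXY n m c)) ↔
    idealOf n m L ≤ Ideal.span {PolyXYCode.toPoly n m p} := by
  rw [idealOf, Ideal.span_le, ← idealOf_singleton]
  constructor
  · rintro h _ ⟨c, hc, rfl⟩
    exact (memIdeal_iff (eval_codeXY n m c)).1 (h c hc)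
  · intro h c hc
    exact (memIdeal_iff (eval_codeXY n m c)).2 (h ⟨c, hc, rfl⟩)

theorem value_pointXY_codeX (v w : List K) (F : PolyCode K) :
    WordCode.value (pointXY n m v w) (codeX 0 n F)
      = MvPolynomial.aeval (listVec n v) (PolyCode.toPoly n F) := by
  rw [value_pointXY v w (q := inclX K n m (PolyCode.toPoly n F)) (by rw [eval_codeX, rename_inclX]),
    aeval_inclX]

/-- The pair `(F, G)` in the certificate bounds the degrees of generators of `A(I)`, and `Cover.mem`
puts every element up to the bound into the algebra of `out`. -/
theorem GenCert.algebraOf_eq [CharZero K] {p : PolyXYCode K} (h : GenCert n m L out p)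
    (hp : idealOf n m L ≤ Ideal.span {PolyXYCode.toPoly n m p}) :
    algebraOf n m out = separatedAlgebra (idealOf n m L) := by
  obtain ⟨w, ⟨hX, hY, hF, hdF, hdG⟩, hpF, hFG, hout, hcov⟩ := h
  rw [value_pointXY _ _ (eval_codeXY n m p), value_pointXY _ _ (eval_codeXY n m p)] at hX hY
  rw [value_pointXY_codeX, value_pointXY_codeX] at hF
  have hle : algebraOf n m out ≤ separatedAlgebra (idealOf n m L) := by
    refine Algebra.adjoin_le ?_
    rintro _ ⟨c, hc, rfl⟩
    exact memIdeal_diffCode_iff.1 (hout c hc)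
  refine le_antisymm hle (separatedAlgebra_le_of_totalDegree_le (notMem_range_inclX_iff.2
    ⟨_, _, _, hX⟩) (notMem_range_inclY_iff.2 ⟨_, _, _, hY⟩) hp (memIdeal_diffCode_iff.1 hFG)
    (totalDegree_pos_iff.2 ⟨_, _, hF⟩) (memIdeal_mul_iff.1 hpF) fun f g hfg hf hg => ?_)
  exact hcov.mem hle hfg (hf.trans (two_mul_totalDegree_le hdF))
    (hg.trans (two_mul_totalDegree_le hdG))

/-- Soundness. In the trivial case `A(I)` is squeezed between the constants and `A((p))`. -/
theorem Cert.algebraOf_eq [CharZero K] (h : Cert n m L out) :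
    algebraOf n m out = separatedAlgebra (idealOf n m L) := by
  obtain ⟨⟨P, Q⟩, hp, ⟨ht, rfl⟩ | h⟩ := h
  · rw [algebraOf_nil, eq_comm, eq_bot_iff, ← ht.separatedAlgebra_eq_bot]
    exact separatedAlgebra_mono (idealOf_le_iff.1 hp)
  · exact h.algebraOf_eq (idealOf_le_iff.1 hp)

theorem exists_algebraOf_eq {B : Subalgebra K (MvPolynomial (Fin n) K × MvPolynomial (Fin m) K)}
    (hB : B.FG) : ∃ out : List (PolyCode K × PolyCode K), algebraOf n m out = B := by
  obtain ⟨s, rfl⟩ := hB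
  choose c hc using PolyCode.toPoly_surjective (K := K) n
  choose d hd using PolyCode.toPoly_surjective (K := K) m
  refine ⟨s.toList.map fun fg => (c fg.1, d fg.2), ?_⟩
  rw [algebraOf]
  congr 1
  ext fg
  constructor
  · rintro ⟨_, h, rfl⟩
    obtain ⟨fg', h', rfl⟩ := List.mem_map.1 h
    rw [hc, hd]
    exact Finset.mem_toList.1 h'
  · intro h
    exact ⟨_, List.mem_map.2 ⟨fg, Finset.mem_toList.2 h, rfl⟩, by rw [hc, hd]⟩

theorem exists_le_of_mem_map {β : Type*} (l : List β) (f : β → ℕ) : ∃ N, ∀ b ∈ l, f b ≤ N :=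
  ⟨(l.map f).sum, fun _ hb => List.le_sum_of_mem (List.mem_map_of_mem hb)⟩

/-- `exists_multiplier` provides `(F, G)`, the conditions on `p` and `F` are witnessed by points,
and completeness of a true generating list is certified by `exists_cover`. -/
theorem exists_genCert [CharZero K] {p : PolyXYCode K} {I₀ : Ideal (PolyXY K n m)}
    (hX : PolyXYCode.toPoly n m p ∉ (inclX K n m).range)
    (hY : PolyXYCode.toPoly n m p ∉ (inclY K n m).range)
    (h₀ : ringKrullDim (PolyXY K n m ⧸ I₀) ≤ 0)
    (hL : idealOf n m L = I₀ ⊓ Ideal.span {PolyXYCode.toPoly n m p})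
    (hA : ∃ f g, PolyXYCode.toPoly n m p ∣ inclX K n m f - inclY K n m g ∧ 0 < f.totalDegree)
    (hout : algebraOf n m out = separatedAlgebra (idealOf n m L)) : GenCert n m L out p := by
  obtain ⟨f, g, hfg, hf⟩ := hA
  obtain ⟨F, G, hFG, hF, hpF⟩ := exists_multiplier h₀ hfg hf
  rw [← hL] at hFG hpF
  obtain ⟨F, rfl⟩ := PolyCode.toPoly_surjective n F
  obtain ⟨G, rfl⟩ := PolyCode.toPoly_surjective m G
  obtain ⟨v₁, w₁, w₁', h1⟩ := notMem_range_inclX_iff.1 hX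
  obtain ⟨v₂, v₂', w₂, h2⟩ := notMem_range_inclY_iff.1 hY
  obtain ⟨v₃, v₃', h3⟩ := totalDegree_pos_iff.1 hF
  obtain ⟨N₁, hN₁⟩ := exists_le_of_mem_map F fun t => 2 * (expWord 0 n t.2).length
  obtain ⟨N₂, hN₂⟩ := exists_le_of_mem_map G fun t => 2 * (expWord 0 m t.2).length
  refine ⟨(((List.ofFn v₁, List.ofFn w₁, List.ofFn w₁'), List.ofFn v₂, List.ofFn v₂', List.ofFn w₂),
    (List.ofFn v₃, List.ofFn v₃'), (F, G), max N₁ N₂), ⟨?_, ?_, ?_, fun t ht => ?_, fun t ht => ?_⟩,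
    memIdeal_mul_iff.2 hpF, memIdeal_diffCode_iff.2 hFG, fun c hc => ?_, exists_cover hout.ge _⟩
  · simpa only [value_pointXY _ _ (eval_codeXY n m p), listVec_ofFn] using h1
  · simpa only [value_pointXY _ _ (eval_codeXY n m p), listVec_ofFn] using h2
  · simpa only [value_pointXY_codeX, listVec_ofFn] using h3
  · exact (hN₁ t ht).trans (le_max_left _ _)
  · exact (hN₂ t ht).trans (le_max_right _ _)
  · rw [memIdeal_diffCode_iff, ← hout]
    exact Algebra.subset_adjoin ⟨c, hc, rfl⟩

/-- Finite generation supplies a correct output in advance; it only remains to certify it, or the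
empty one if `A((p))` is trivial. -/
theorem exists_cert [CharZero K] (h : IsZeroDimInfPrincipal (idealOf n m L)) :
    ∃ out, Cert n m L out := by
  obtain ⟨out, hout⟩ := exists_algebraOf_eq h.fg_separatedAlgebra
  obtain ⟨I₀, p, h₀, hX, hY, hL⟩ := h
  by_cases hA : separatedAlgebra (Ideal.span {p}) = ⊥
  · obtain ⟨P, Q, rfl, ht⟩ := exists_trivCert hX hY hA
    exact ⟨[], (P, Q), idealOf_le_iff.2 (hL.trans_le inf_le_right), Or.inl ⟨ht, rfl⟩⟩
  · obtain ⟨c, rfl, -⟩ := PolyXYCode.exists_toPoly_eq p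
    -- The splitting of `p` into top form and rest plays no role here, so all of `p` goes into the
    -- second part.
    refine ⟨out, ([], c), idealOf_le_iff.2 (hL.trans_le inf_le_right),
      Or.inr (exists_genCert hX hY h₀ hL ?_ hout)⟩
    by_contra! hall
    refine hA (eq_bot_iff.2 ?_)
    rintro ⟨f, g⟩ hfg
    rw [mem_separatedAlgebra_span'] at hfg
    rcases totalDegree_pos_of_dvd hX hY hfg with ⟨r, rfl, rfl⟩ | ⟨h1, -⟩
    · exact Subalgebra.algebraMap_mem _ r
    · exact absurd h1 (by have := hall f g hfg; omega)

end Certificates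

/-! ### Semidecidability of the certificates. -/

section CertSigma

variable {K : Type*} [Field K] [Primcodable K] {α : Type*} [Primcodable α]

theorem Sigma1.genCert (hK : IsComputableField K) {n m : α → ℕ} {L : α → List (PolyXYCode K)}
    {out : α → List (PolyCode K × PolyCode K)} {p : α → PolyXYCode K} (hn : Computable n)
    (hm : Computable m) (hL : Computable L) (ho : Computable out) (hp : Computable p) :
    Sigma1 fun a => GenCert (n a) (m a) (L a) (out a) (p a) := by
  have f := Cmp.fst (Cmp.id (α := α × ((List K × List K × List K) × List K × List K × List K) ×
    (List K × List K) × (PolyCode K × PolyCode K) × ℕ))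
  have g := Cmp.snd (Cmp.id (α := α × ((List K × List K × List K) × List K × List K × List K) ×
    (List K × List K) × (PolyCode K × PolyCode K) × ℕ))
  have hn' := hn.comp f
  have hm' := hm.comp f
  have hL' := hL.comp f
  have ho' := ho.comp f
  have hp' := Cmp.codeXY hn' hm' (hp.comp f)
  have g1 := Cmp.fst (Cmp.fst g)
  have g2 := Cmp.snd (Cmp.fst g)
  have g3 := Cmp.fst (Cmp.snd g)
  have hFG := Cmp.fst (Cmp.snd (Cmp.snd g))
  have hN := Cmp.snd (Cmp.snd (Cmp.snd g))
  refine Sigma1.ex (Sigma1.and (Sigma1.of_decP (DecP.and (DecP.not ?_) (DecP.and (DecP.not ?_)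
    (DecP.and (DecP.not ?_) (DecP.and ?_ ?_))))) (Sigma1.and ?_ (Sigma1.and ?_ (Sigma1.and ?_ ?_))))
  · exact DecP.eq (Cmp.wvalue hK (Cmp.pointXY hn' hm' (Cmp.fst g1) (Cmp.fst (Cmp.snd g1))) hp')
      (Cmp.wvalue hK (Cmp.pointXY hn' hm' (Cmp.fst g1) (Cmp.snd (Cmp.snd g1))) hp')
  · exact DecP.eq
      (Cmp.wvalue hK (Cmp.pointXY hn' hm' (Cmp.fst g2) (Cmp.snd (Cmp.snd g2))) hp')
      (Cmp.wvalue hK (Cmp.pointXY hn' hm' (Cmp.fst (Cmp.snd g2)) (Cmp.snd (Cmp.snd g2))) hp')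
  · exact DecP.eq
      (Cmp.wvalue hK (Cmp.pointXY hn' hm' (Cmp.fst g3) (Cmp.const []))
        (Cmp.codeX (Cmp.const 0) hn' (Cmp.fst hFG)))
      (Cmp.wvalue hK (Cmp.pointXY hn' hm' (Cmp.snd g3) (Cmp.const []))
        (Cmp.codeX (Cmp.const 0) hn' (Cmp.fst hFG)))
  · exact DecP.ball (Cmp.fst hFG) (DecP.le (Cmp.mul (Cmp.const 2) (Cmp.length
      (Cmp.expWord (Cmp.const 0) (hn'.comp (Cmp.fst Cmp.id)) (Cmp.snd (Cmp.snd Cmp.id)))))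
      (hN.comp (Cmp.fst Cmp.id)))
  · exact DecP.ball (Cmp.snd hFG) (DecP.le (Cmp.mul (Cmp.const 2) (Cmp.length
      (Cmp.expWord (Cmp.const 0) (hm'.comp (Cmp.fst Cmp.id)) (Cmp.snd (Cmp.snd Cmp.id)))))
      (hN.comp (Cmp.fst Cmp.id)))
  · exact Sigma1.memIdeal hK hn' hm' hL' (Cmp.wmul hK hp'
      (Cmp.codeX (Cmp.const 0) hn' (Cmp.fst hFG)))
  · exact Sigma1.memIdeal hK hn' hm' hL' (Cmp.diffCode hK hn' hm' hFG)
  · exact Sigma1.ball ho' (Sigma1.memIdeal hK (hn'.comp (Cmp.fst Cmp.id))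
      (hm'.comp (Cmp.fst Cmp.id)) (hL'.comp (Cmp.fst Cmp.id)) (Cmp.diffCode hK
        (hn'.comp (Cmp.fst Cmp.id)) (hm'.comp (Cmp.fst Cmp.id)) (Cmp.snd Cmp.id)))
  · exact Sigma1.cover hK hn' hm' ho' hL' hN

theorem Sigma1.cert (hK : IsComputableField K) (hU : DecidesRootsOfUnity K) {n m : α → ℕ}
    {L : α → List (PolyXYCode K)} {out : α → List (PolyCode K × PolyCode K)} (hn : Computable n)
    (hm : Computable m) (hL : Computable L) (ho : Computable out) :
    Sigma1 fun a => Cert (n a) (m a) (L a) (out a) := by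
  have f := Cmp.fst (Cmp.id (α := α × PolyXYCode K × PolyXYCode K))
  have hP := Cmp.fst (Cmp.snd (Cmp.id (α := α × PolyXYCode K × PolyXYCode K)))
  have hQ := Cmp.snd (Cmp.snd (Cmp.id (α := α × PolyXYCode K × PolyXYCode K)))
  refine Sigma1.ex (Sigma1.and (Sigma1.ball (hL.comp f) ?_) (Sigma1.or (Sigma1.and
    (Sigma1.trivCert hK hU (hn.comp f) (hm.comp f) hP hQ)
    (Sigma1.of_decP (DecP.eq (ho.comp f) (Cmp.const [])))) (Sigma1.genCert hK (hn.comp f)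
      (hm.comp f) (hL.comp f) (ho.comp f) (Cmp.append hP hQ))))
  have f' := Cmp.fst (Cmp.id (α := (α × PolyXYCode K × PolyXYCode K) × PolyXYCode K))
  exact Sigma1.memIdeal hK (hn.comp (Cmp.fst f')) (hm.comp (Cmp.fst f'))
    (Cmp.cons (Cmp.append (hP.comp f') (hQ.comp f')) (Cmp.const []))
    (Cmp.codeXY (hn.comp (Cmp.fst f')) (hm.comp (Cmp.fst f')) (Cmp.snd Cmp.id))

end CertSigma

end SeparatedVariables

theorem mainTheorem4 {K : Type*} [Field K] [CharZero K] :
    (∀ (n m : ℕ) (I : Ideal (PolyXY K n m)),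
      IsZeroDimInfPrincipal I → (separatedAlgebra I).FG) ∧
    (∀ [Primcodable K], IsComputableField K → DecidesRootsOfUnity K →
      ∃ alg : ℕ × ℕ × List (PolyXYCode K) →. List (PolyCode K × PolyCode K),
        Partrec alg ∧
        ∀ (n m : ℕ) (L : List (PolyXYCode K)), IsZeroDimInfPrincipal (idealOf n m L) →
          ∃ out ∈ alg (n, m, L), algebraOf n m out = separatedAlgebra (idealOf n m L)) := by
  refine ⟨fun n m I hI => hI.fg_separatedAlgebra, fun hK hU => ?_⟩
  -- The algorithm is an unbounded search for an output with a certificate: it stops by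
  -- `exists_cert`, and whatever it finds is correct by `Cert.algebraOf_eq`.
  obtain ⟨alg, halg, h⟩ := Sigma1.exists_partrec
    (R := fun (a : ℕ × ℕ × List (PolyXYCode K)) out => Cert a.1 a.2.1 a.2.2 out)
    (Sigma1.cert hK hU (Cmp.fst (Cmp.fst Cmp.id)) (Cmp.fst (Cmp.snd (Cmp.fst Cmp.id)))
      (Cmp.snd (Cmp.snd (Cmp.fst Cmp.id))) (Cmp.snd Cmp.id))
  refine ⟨alg, halg, fun n m L hL => ?_⟩
  obtain ⟨out, hout, hcert⟩ := h (n, m, L) (exists_cert hL)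
  exact ⟨out, hout, hcert.algebraOf_eq⟩
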